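/- **Setting.** Consider the KdV equation $u_t=u_{xxx}+u\,u_x$. Its infinite prolongation $\mathcal E$ is the space with coordinates $x,\ t,\ u_k$ ($k\ge 0$, $u_0=u$), with total derivatives $$D_x=\partial_x+\sum_{k\ge0}u_{k+1}\,\partial_{u_k},\qquad D_t=\partial_t+\sum_{k\ge0}D_x^k(u_3+u_0u_1)\,\partial_{u_k}.$$ Let $a=(x_0,t_0,a_0,a_1,\dots)\in\mathcal E$ be any point (all coordinates in $\mathbb C$), and let $p\ge0$. Let $\mathfrak F$ be the free complex Lie algebra on symbols $\mathbf A^{l_1,l_2}_{i_0\dots i_p}$ and $\mathbf B^{l_1,l_2}_{j_0\dots j_{p+2}}$ (all indices in $\mathbb Z_{\ge0}$), and consider the formal power series $$\mathbf A=\sum (x-x_0)^{l_1}(t-t_0)^{l_2}(u_0-a_0)^{i_0}\cdots(u_p-a_p)^{i_p}\,\mathbf A^{l_1,l_2}_{i_0\dots i_p},\qquad \mathbf B=\sum (x-x_0)^{l_1}(t-t_0)^{l_2}(u_0-a_0)^{j_0}\cdots(u_{p+2}-a_{p+2})^{j_{p+2}}\,\mathbf B^{l_1,l_2}_{j_0\dots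 j_{p+2}}.$$ The Lie algebra $\mathbb F^p(\mathcal E,a)$ is the quotient of $\mathfrak F$ by the ideal generated by * all coefficients of the power series $D_x(\mathbf B)-D_t(\mathbf A)+[\mathbf A,\mathbf B]$ (expanded at $a$); * all $\mathbf A^{l_1,l_2}_{0\dots0}$ and all $\mathbf B^{0,l_2}_{0\dots0}$; * all $\mathbf A^{l_1,l_2}_{i_0\dots i_p}$ for which there is $r\in\{1,\dots,p\}$ with $i_r=1$ and $i_n=0$ for all $n>r$. For $p\ge1$ there is a homomorphism $\mathbb F^p(\mathcal E,a)\to\mathbb F^{p-1}(\mathcal E,a)$ sending the generators $\mathbf A^{l_1,l_2}_{i_0\dots i_p}$ with $i_p\ne0$ and $\mathbf B^{l_1,l_2}_{j_0\dots j_{p+2}}$ with $j_{p+2}\neq0$ to zero, and every other generator to the corresponding generator of $\mathbb F^{p-1}(\mathcal E,a)$. Let $\psi_p\colon\mathbb F^p(\mathcal E,a)\to\mathbb F^{0}(\mathcal E,a)$ be the composition of these homomorphisms. **Theorem.** For every point $a\in\mathcal E$: * the Lie algebra $\mathbb F^0(\mathcal E,a)$ is isomorphic to the direct sum of $\mathfrak{sl}_2(\mathbb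 C[\lambda])$ and a $3$-dimensional abelian Lie algebra (as Lie algebras over $\mathbb C$); * for every integer $p>0$, the homomorphism $\psi_p\colon\mathbb F^p(\mathcal E,a)\to\mathbb F^0(\mathcal E,a)$ is surjective and its kernel is a nilpotent Lie algebra. -/

import Mathlib

/-- Coordinates `x`, `t`, `u_k` (`k ≥ 0`, `u_0 = u`) on the infinite prolongation of a scalar
evolution equation `u_t = F`. -/
inductive JetCoord : Type
  | x : JetCoord
  | t : JetCoord
  | u (k : ℕ) : JetCoord
  deriving DecidableEq

namespace JetCoord

/-- Points of the infinite prolongation: all the coordinates are arbitrary complex numbers. -/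
abbrev Point : Type := JetCoord → ℂ

/-- Polynomial functions on the infinite prolongation. -/
abbrev Fun : Type := MvPolynomial JetCoord ℂ

/-- Components of the total derivative `D_x = ∂_x + ∑_k u_{k+1} ∂_{u_k}`. -/
noncomputable def totalX : JetCoord → Fun
  | x => 1
  | t => 0
  | u k => MvPolynomial.X (u (k + 1))

/-- `D_x` as a derivation of the algebra of polynomial functions. -/
noncomputable def Dx : Derivation ℂ Fun Fun := MvPolynomial.mkDerivation ℂ totalX

/-- Components of the total derivative `D_t = ∂_t + ∑_k D_x^k(F) ∂_{u_k}` of `u_t = F`. -/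
noncomputable def totalT (F : Fun) : JetCoord → Fun
  | x => 0
  | t => 1
  | u k => (fun g => Dx g)^[k] F

/-- The Taylor expansion at `a`: a function `g`, written as a polynomial in the
shifted coordinates `c - a(c)`. -/
noncomputable def taylorAt (a : Point) (g : Fun) : Fun :=
  MvPolynomial.aeval (fun c => MvPolynomial.X c + MvPolynomial.C (a c)) g

/-- Exponents of the monomials
`(x - x₀)^{l₁} (t - t₀)^{l₂} (u_0 - a_0)^{i_0} (u_1 - a_1)^{i_1} ⋯`. -/
abbrev Mono : Type := JetCoord →₀ ℕ

/-- The monomial contains no `u_k` with `k > n`. -/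
def Mono.OrderLE (μ : Mono) (n : ℕ) : Prop := ∀ k, n < k → μ (u k) = 0

/-- The monomial contains no `u_k` at all. -/
def Mono.NoU (μ : Mono) : Prop := ∀ k, μ (u k) = 0

/-- Formal power series in the shifted coordinates with coefficients in `L`
(`S μ` is the coefficient of the monomial `μ`). -/
abbrev Series (L : Type) : Type := Mono → L

section Series

variable {L : Type} [LieRing L] [LieAlgebra ℂ L]

/-- Partial derivative of a power series with respect to a coordinate. -/
noncomputable def partialD (c : JetCoord) (S : Series L) : Series L :=
  fun μ => (μ c + 1) • S (μ + Finsupp.single c 1)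

/-- Product of a polynomial in the shifted coordinates and a power series. -/
noncomputable def polyMul (g : Fun) (S : Series L) : Series L :=
  fun μ => ∑ q ∈ Finset.HasAntidiagonal.antidiagonal μ, MvPolynomial.coeff q.1 g • S q.2

/-- Bracket of two power series with coefficients in a Lie algebra. -/
noncomputable def seriesBracket (S T : Series L) : Series L :=
  fun μ => ∑ q ∈ Finset.HasAntidiagonal.antidiagonal μ, ⁅S q.1, T q.2⁆

/-- The vector field `∑_c V(c) ∂_c` applied to a power series at `a` that depends only on
`x, t, u_0, …, u_n` (so that the derivatives `∂_{u_k}`, `k > n`, do not contribute). -/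
noncomputable def applyField (V : JetCoord → Fun) (a : Point) (n : ℕ) (S : Series L) : Series L :=
  polyMul (taylorAt a (V x)) (partialD x S) + polyMul (taylorAt a (V t)) (partialD t S)
    + ∑ k ∈ Finset.range (n + 1), polyMul (taylorAt a (V (u k))) (partialD (u k) S)

/-- The power series `D_x(B) - D_t(A) + [A, B]`, where `A` depends only on
`x, t, u_0, …, u_p` and `B` depends only on `x, t, u_0, …, u_{p+d-1}`. -/
noncomputable def curvature (F : Fun) (d p : ℕ) (a : Point) (A B : Series L) : Series L :=
  applyField totalX a (p + d - 1) B - applyField (totalT F) a p A + seriesBracket A B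

end Series

/-- The symbols `A_α^{l₁,l₂}` and `B_β^{l₁,l₂}`; the exponents are recorded by one monomial
in `x, t, u_0, …, u_p`, respectively in `x, t, u_0, …, u_{p+d-1}`. -/
inductive Gen (d p : ℕ) : Type
  | A (μ : Mono) (h : μ.OrderLE p) : Gen d p
  | B (μ : Mono) (h : μ.OrderLE (p + d - 1)) : Gen d p

/-- The free Lie algebra on these symbols. -/
abbrev FreeAlg (d p : ℕ) : Type := FreeLieAlgebra ℂ (Gen d p)

open Classical in
/-- The generating power series of the symbols `A_α^{l₁,l₂}`. -/
noncomputable def seriesA (d p : ℕ) : Series (FreeAlg d p) :=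
  fun μ => if h : μ.OrderLE p then FreeLieAlgebra.of ℂ (Gen.A μ h) else 0

open Classical in
/-- The generating power series of the symbols `B_β^{l₁,l₂}`. -/
noncomputable def seriesB (d p : ℕ) : Series (FreeAlg d p) :=
  fun μ => if h : μ.OrderLE (p + d - 1) then FreeLieAlgebra.of ℂ (Gen.B μ h) else 0

/-- The relators of `𝔽^p`. -/
inductive Relator (F : Fun) (d p : ℕ) (a : Point) : FreeAlg d p → Prop
  /-- all coefficients of `D_x(B) - D_t(A) + [A, B]` -/
  | zcr (γ : Mono) : Relator F d p a (curvature F d p a (seriesA d p) (seriesB d p) γ)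
  /-- `A_0^{l₁,l₂}` -/
  | A_zero (μ : Mono) (h : μ.NoU) : Relator F d p a (seriesA d p μ)
  /-- `B_0^{0,l₂}` -/
  | B_zero (μ : Mono) (hx : μ x = 0) (h : μ.NoU) : Relator F d p a (seriesB d p μ)
  /-- `A_α^{l₁,l₂}` if the last nonzero exponent `α_r` has `1 ≤ r ≤ p` and equals `1` -/
  | A_one (μ : Mono) (r : ℕ) (hr : 1 ≤ r) (hrp : r ≤ p) (h1 : μ (u r) = 1)
      (h : μ.OrderLE r) : Relator F d p a (seriesA d p μ)

/-- The ideal of relations. -/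
noncomputable def relIdeal (F : Fun) (d p : ℕ) (a : Point) : LieIdeal ℂ (FreeAlg d p) :=
  LieSubmodule.lieSpan ℂ (FreeAlg d p) {z | Relator F d p a z}

/-- The Lie algebra `𝔽^p(𝓔, a)` for the infinite prolongation `𝓔` of the scalar evolution equation
`u_t = F` of order `d ≥ 1`. -/
abbrev FAlg (F : Fun) (d p : ℕ) (a : Point) : Type := FreeAlg d p ⧸ relIdeal F d p a

/-- The projection from the free Lie algebra to `𝔽^p(𝓔, a)`. -/
noncomputable def proj (F : Fun) (d p : ℕ) (a : Point) : FreeAlg d p →ₗ⁅ℂ⁆ FAlg F d p a :=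
  { (LieSubmodule.Quotient.mk' (relIdeal F d p a) : FreeAlg d p →ₗ[ℂ] FAlg F d p a) with
    map_lie' := fun {y z} => LieSubmodule.Quotient.mk_bracket (I := relIdeal F d p a) y z }

/-- The images in `𝔽^p(𝓔, a)` of the symbols of level `p + 1`: a symbol that involves `u_{p+1}`
(for `A`) or `u_{p+d}` (for `B`) goes to zero, any other one to the same symbol of level `p`. -/
noncomputable def stepGen (F : Fun) (d p : ℕ) (a : Point) : Gen d (p + 1) → FAlg F d p a
  | Gen.A μ _ => proj F d p a (seriesA d p μ)
  | Gen.B μ _ => proj F d p a (seriesB d p μ)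

theorem proj_eq_zero {F : Fun} {d p : ℕ} {a : Point} {z : FreeAlg d p} (h : Relator F d p a z) :
    proj F d p a z = 0 :=
  (LieSubmodule.Quotient.mk_eq_zero' (N := relIdeal F d p a)).2 (LieSubmodule.subset_lieSpan h)

section Functoriality

variable {L L' : Type} [LieRing L] [LieAlgebra ℂ L] [LieRing L'] [LieAlgebra ℂ L']

theorem map_polyMul (f : L →ₗ⁅ℂ⁆ L') (g : Fun) (S : Series L) (μ : Mono) :
    f (polyMul g S μ) = polyMul g (fun ν => f (S ν)) μ := by
  simp [polyMul, map_sum]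

theorem map_partialD (f : L →ₗ⁅ℂ⁆ L') (c : JetCoord) (S : Series L) :
    (fun μ => f (partialD c S μ)) = partialD c (fun ν => f (S ν)) := by
  funext μ
  simp only [partialD, map_nsmul]

theorem map_seriesBracket (f : L →ₗ⁅ℂ⁆ L') (S T : Series L) (μ : Mono) :
    f (seriesBracket S T μ) = seriesBracket (fun ν => f (S ν)) (fun ν => f (T ν)) μ := by
  simp [seriesBracket, map_sum]

theorem map_applyField (f : L →ₗ⁅ℂ⁆ L') (V : JetCoord → Fun) (a : Point) (n : ℕ) (S : Series L)
    (μ : Mono) : f (applyField V a n S μ) = applyField V a n (fun ν => f (S ν)) μ := by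
  simp only [applyField, Pi.add_apply, Finset.sum_apply, map_add, map_sum, map_polyMul,
    map_partialD]

theorem map_curvature (f : L →ₗ⁅ℂ⁆ L') (F : Fun) (d p : ℕ) (a : Point) (A B : Series L)
    (μ : Mono) : f (curvature F d p a A B μ)
      = curvature F d p a (fun ν => f (A ν)) (fun ν => f (B ν)) μ := by
  simp only [curvature, Pi.add_apply, Pi.sub_apply, map_add, map_sub, map_applyField,
    map_seriesBracket]

theorem applyField_mono (V : JetCoord → Fun) (a : Point) {m n : ℕ} (hmn : m ≤ n) (S : Series L)
    (hS : ∀ μ : Mono, ¬ μ.OrderLE m → S μ = 0) : applyField V a n S = applyField V a m S := by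
  unfold applyField
  congr 1
  symm
  apply Finset.sum_subset
  · intro k hk
    simp only [Finset.mem_range] at hk ⊢
    omega
  · intro k _ hk
    simp only [Finset.mem_range, not_lt] at hk
    have h0 : partialD (u k) S = 0 := by
      funext μ
      have : S (μ + Finsupp.single (u k) 1) = 0 := by
        apply hS
        intro h
        have := h k (by omega)
        simp at this
      simp [partialD, this]
    rw [h0]
    funext μ
    simp [polyMul]

end Functoriality

theorem seriesA_of_not {d p : ℕ} {μ : Mono} (h : ¬ μ.OrderLE p) : seriesA d p μ = 0 := by
  simp [seriesA, h]

theorem seriesB_of_not {d p : ℕ} {μ : Mono} (h : ¬ μ.OrderLE (p + d - 1)) :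
    seriesB d p μ = 0 := by
  simp [seriesB, h]

theorem Mono.OrderLE.mono {μ : Mono} {m n : ℕ} (h : μ.OrderLE m) (hmn : m ≤ n) : μ.OrderLE n :=
  fun k hk => h k (lt_of_le_of_lt hmn hk)

theorem lift_stepGen_A (F : Fun) (d p : ℕ) (a : Point) (μ : Mono) :
    FreeLieAlgebra.lift ℂ (stepGen F d p a) (seriesA d (p + 1) μ)
      = proj F d p a (seriesA d p μ) := by
  by_cases h : μ.OrderLE (p + 1)
  · rw [seriesA, dif_pos h, FreeLieAlgebra.lift_of_apply]
    rfl
  · rw [seriesA_of_not h, seriesA_of_not (fun h' => h (h'.mono (by omega))), map_zero, map_zero]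

theorem lift_stepGen_B (F : Fun) (d p : ℕ) (a : Point) (μ : Mono) :
    FreeLieAlgebra.lift ℂ (stepGen F d p a) (seriesB d (p + 1) μ)
      = proj F d p a (seriesB d p μ) := by
  by_cases h : μ.OrderLE (p + 1 + d - 1)
  · rw [seriesB, dif_pos h, FreeLieAlgebra.lift_of_apply]
    rfl
  · rw [seriesB_of_not h, seriesB_of_not (fun h' => h (h'.mono (by omega))), map_zero, map_zero]

theorem lift_stepGen_relator (F : Fun) (d p : ℕ) (a : Point) {z : FreeAlg d (p + 1)}
    (hz : Relator F d (p + 1) a z) : FreeLieAlgebra.lift ℂ (stepGen F d p a) z = 0 := by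
  cases hz with
  | zcr γ =>
    have hA : applyField (totalT F) a (p + 1) (fun ν => proj F d p a (seriesA d p ν))
        = applyField (totalT F) a p (fun ν => proj F d p a (seriesA d p ν)) :=
      applyField_mono _ _ (by omega) _ (fun μ h => by rw [seriesA_of_not h, map_zero])
    have hB : applyField totalX a (p + 1 + d - 1) (fun ν => proj F d p a (seriesB d p ν))
        = applyField totalX a (p + d - 1) (fun ν => proj F d p a (seriesB d p ν)) :=
      applyField_mono _ _ (by omega) _ (fun μ h => by rw [seriesB_of_not h, map_zero])
    have h0 := proj_eq_zero (Relator.zcr (F := F) (d := d) (p := p) (a := a) γ)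
    rw [map_curvature] at h0 ⊢
    simp only [lift_stepGen_A, lift_stepGen_B]
    rw [curvature, hA, hB]
    exact h0
  | A_zero μ h => rw [lift_stepGen_A]; exact proj_eq_zero (Relator.A_zero μ h)
  | B_zero μ hx h => rw [lift_stepGen_B]; exact proj_eq_zero (Relator.B_zero μ hx h)
  | A_one μ r hr hrp h1 h =>
    rw [lift_stepGen_A]
    by_cases hr' : r ≤ p
    · exact proj_eq_zero (Relator.A_one μ r hr hr' h1 h)
    · rw [seriesA_of_not, map_zero]
      intro h'
      have := h' r (by omega)
      omega

theorem relIdeal_le_ker (F : Fun) (d p : ℕ) (a : Point) :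
    relIdeal F d (p + 1) a ≤ (FreeLieAlgebra.lift ℂ (stepGen F d p a)).ker :=
  LieSubmodule.lieSpan_le.2 fun z hz => by
    rw [SetLike.mem_coe, LieHom.mem_ker]
    exact lift_stepGen_relator F d p a hz

/-- The homomorphism `𝔽^{p+1}(𝓔, a) → 𝔽^p(𝓔, a)` that sends the generators involving
`u_{p+1}` (for `A`) or `u_{p+d}` (for `B`) to zero and the other ones to the corresponding
generators. -/
noncomputable def step (F : Fun) (d p : ℕ) (a : Point) :
    FAlg F d (p + 1) a →ₗ⁅ℂ⁆ FAlg F d p a :=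
  { Submodule.liftQ (relIdeal F d (p + 1) a).toSubmodule
      (FreeLieAlgebra.lift ℂ (stepGen F d p a) : FreeAlg d (p + 1) →ₗ[ℂ] FAlg F d p a)
      (fun _ hz => relIdeal_le_ker F d p a hz) with
    map_lie' := by
      rintro ⟨y⟩ ⟨z⟩
      exact LieHom.map_lie (FreeLieAlgebra.lift ℂ (stepGen F d p a)) y z }

theorem step_proj (F : Fun) (d p : ℕ) (a : Point) (z : FreeAlg d (p + 1)) :
    step F d p a (proj F d (p + 1) a z) = FreeLieAlgebra.lift ℂ (stepGen F d p a) z :=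
  rfl

theorem step_A (F : Fun) (d p : ℕ) (a : Point) (μ : Mono) :
    step F d p a (proj F d (p + 1) a (seriesA d (p + 1) μ)) = proj F d p a (seriesA d p μ) := by
  rw [step_proj, lift_stepGen_A]

theorem step_B (F : Fun) (d p : ℕ) (a : Point) (μ : Mono) :
    step F d p a (proj F d (p + 1) a (seriesB d (p + 1) μ)) = proj F d p a (seriesB d p μ) := by
  rw [step_proj, lift_stepGen_B]

/-- The composition `𝔽^p(𝓔, a) → 𝔽^{p-1}(𝓔, a) → ⋯ → 𝔽^0(𝓔, a)`. -/
noncomputable def toZero (F : Fun) (d : ℕ) (a : Point) :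
    (p : ℕ) → FAlg F d p a →ₗ⁅ℂ⁆ FAlg F d 0 a
  | 0 => LieHom.id
  | p + 1 => (toZero F d a p).comp (step F d p a)

/-- The right-hand side `u_3 + u_0 u_1` of the KdV equation `u_t = u_{xxx} + u u_x`. -/
noncomputable def kdv : Fun :=
  MvPolynomial.X (u 3) + MvPolynomial.X (u 0) * MvPolynomial.X (u 1)

/-- The infinite-dimensional Lie algebra `sl_2(ℂ[λ])`, as a Lie algebra over `ℂ`. -/
abbrev Sl2Poly : Type :=
  RestrictScalars ℂ (Polynomial ℂ) (LieAlgebra.SpecialLinear.sl (Fin 2) (Polynomial ℂ))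

end JetCoord

/-! The series `A`, `B` with coefficients in `𝔽^p` are the universal pair that satisfies D_x B - D_t
A + [A, B] = 0 together with the normal form expressed by the other relators. Homomorphisms out of
`𝔽^p` are therefore the same as such pairs of power series (`exists_hom_of_isNormalZCR`,
`hom_ext_gen`), and everything can be computed in a Lie algebra of power series.

Kernels. Comparing the highest derivatives in the zero-curvature equation shows that S = ∂²A/∂u_p²
satisfies D_x S + [A, S] = 0 (`cov_pd_pd_A`). The normal form forces such an S to depend on t only
and to commute with A. Bracketing the zero-curvature equation with S then gives [S, B] = 0 and [A,
S_t] = 0, so the same holds for all t-derivatives of S, and all coefficients of S are central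
(`isCentral_of_lie`). Monomials linear in the last variable are excluded by the normal form, so in
`𝔽^{p+1}` every coefficient of A that involves u_{p+1}, and every coefficient of B that involves
u_{p+3}, is central. Hence the adjoint representation factors through `𝔽^p` and the kernel of each
step is central; a tower of such steps has a nilpotent kernel.

Level 0, upper bound. With v = u_0 - a_0 one gets A = vP + v²Q, where P depends on x, t and Q is
central and depends on t. The equation determines B up to a series b in t and leaves [P, [P, P_x]] =
0, P_x + 3[P, P_xx] = 2Q_t and P_t = P_xxx + a_0 P_x + [P, b]. The series R = 9[P, P_x] equals -3P
up to central terms, and [R, R_x] = R. Differentiating these identities in x and t extracts from R,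
R_x, R_xx, R_xxx an sl_2-triple and elements λe, λh whose Serre-type relations force the
multiplication table of sl_2(ℂ[λ]) (`IsKdVFlow.isCurrentData`, `IsCurrentData.lie_table`). Thus
`𝔽^0` is spanned by the elements λ^n e, λ^n h, λ^n f and three central elements.

Level 0, lower bound. Nothing collapses further. The Lax pair of KdV with values in sl_2(ℂ[λ]),
brought to normal form by exponentials, separates the currents (`exists_hom_sl2`). For an abelian
target the zero-curvature equation is a conservation law, and mass, momentum and the Galilean law
separate the three central elements (`exists_hom_abelian`). -/

namespace JetCoord

open Finset.HasAntidiagonal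

/-! ### Convolution sums over pairs of exponents -/

section Antidiagonal

variable {M : Type} [AddCommGroup M]

theorem sum_antidiagonal_assoc (f : Mono → Mono → Mono → M) (μ : Mono) :
    ∑ p ∈ antidiagonal μ, ∑ q ∈ antidiagonal p.1, f q.1 q.2 p.2
      = ∑ p ∈ antidiagonal μ, ∑ q ∈ antidiagonal p.2, f p.1 q.1 q.2 := by
  simp only [Finset.sum_sigma']
  apply Finset.sum_nbij' (fun ⟨⟨_i, j⟩, ⟨k, l⟩⟩ ↦ ⟨(k, l + j), (l, j)⟩)
    (fun ⟨⟨i, _j⟩, ⟨k, l⟩⟩ ↦ ⟨(i + k, l), (i, k)⟩) <;> aesop (add simp [add_assoc])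

theorem sum_antidiagonal_left_comm (f : Mono → Mono → Mono → M) (μ : Mono) :
    ∑ p ∈ antidiagonal μ, ∑ q ∈ antidiagonal p.2, f p.1 q.1 q.2
      = ∑ p ∈ antidiagonal μ, ∑ q ∈ antidiagonal p.2, f q.1 p.1 q.2 := by
  rw [← sum_antidiagonal_assoc, ← sum_antidiagonal_assoc (fun a b c => f b a c)]
  exact Finset.sum_congr rfl fun p _ =>
    Finsupp.sum_antidiagonal_swap p.1 fun a b => f a b p.2

/-- Shifting the first exponent by c reaches exactly the pairs whose first exponent contains c; the
weight kills the other ones. -/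
theorem sum_antidiagonal_add_single (c : JetCoord) (f : Mono → Mono → M) (μ : Mono) :
    ∑ q ∈ antidiagonal (μ + Finsupp.single c 1), (q.1 : Mono) c • f q.1 q.2
      = ∑ q ∈ antidiagonal μ, (q.1 c + 1) • f (q.1 + Finsupp.single c 1) q.2 := by
  symm
  refine Finset.sum_bij_ne_zero (fun q _ _ => (q.1 + Finsupp.single c 1, q.2)) ?_ ?_ ?_ ?_
  · intro q hq _
    rw [mem_antidiagonal] at hq ⊢
    rw [← hq, add_right_comm]
  · rintro ⟨q, q'⟩ _ _ ⟨r, r'⟩ _ _ h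
    simpa using h
  · rintro ⟨q, q'⟩ hq h
    have hc : q c ≠ 0 := fun h0 => h (by simp [h0])
    have hle : Finsupp.single c 1 ≤ q := by
      rw [Finsupp.single_le_iff]; omega
    rw [mem_antidiagonal] at hq
    dsimp only at hq h
    refine ⟨(q - Finsupp.single c 1, q'), ?_, ?_, ?_⟩
    · rw [mem_antidiagonal]
      apply add_right_cancel (b := Finsupp.single c 1)
      rw [← hq, add_right_comm, tsub_add_cancel_of_le hle]
    · dsimp only
      rw [tsub_add_cancel_of_le hle]
      have : (q - Finsupp.single c 1 : Mono) c + 1 = q c := by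
        simp; omega
      rwa [this]
    · simp [tsub_add_cancel_of_le hle]
  · rintro ⟨q, q'⟩ _ _
    simp

/-- The Leibniz rule for the coefficients of a product of power series. -/
theorem sum_antidiagonal_leibniz (c : JetCoord) (f : Mono → Mono → M) (μ : Mono) :
    (μ c + 1) • ∑ q ∈ antidiagonal (μ + Finsupp.single c 1), f q.1 q.2
      = ∑ q ∈ antidiagonal μ, (q.1 c + 1) • f (q.1 + Finsupp.single c 1) q.2
        + ∑ q ∈ antidiagonal μ, (q.2 c + 1) • f q.1 (q.2 + Finsupp.single c 1) := by
  rw [Finsupp.sum_antidiagonal_swap μ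
      (fun a b => (b c + 1) • f a (b + Finsupp.single c 1)), ← sum_antidiagonal_add_single,
    ← sum_antidiagonal_add_single c (fun a b => f b a) μ,
    Finsupp.sum_antidiagonal_swap _ (fun a b => (a : Mono) c • f b a), ← Finset.sum_add_distrib,
    Finset.smul_sum]
  refine Finset.sum_congr rfl fun q hq => ?_
  rw [← add_smul, ← Finsupp.add_apply, mem_antidiagonal.1 hq]
  simp

end Antidiagonal

/-! ### The differential Lie algebra of power series -/

/-- Formal power series in the shifted coordinates, with the Lie algebra structure given by
`seriesBracket`. -/
def PSeries (L : Type) : Type := Mono → L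

namespace PSeries

section Module

variable {L : Type} [LieRing L] [LieAlgebra ℂ L]

instance : AddCommGroup (PSeries L) := inferInstanceAs (AddCommGroup (Mono → L))

instance : Module ℂ (PSeries L) := inferInstanceAs (Module ℂ (Mono → L))

/-- The coefficient of a monomial, as a linear map. -/
def coeff (μ : Mono) : PSeries L →ₗ[ℂ] L := LinearMap.proj (R := ℂ) (φ := fun _ : Mono => L) μ

@[ext]
theorem ext {S T : PSeries L} (h : ∀ μ, coeff μ S = coeff μ T) : S = T := funext h

noncomputable instance : SMul Fun (PSeries L) := ⟨fun g S => polyMul g S⟩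

theorem coeff_fun_smul (g : Fun) (S : PSeries L) (μ : Mono) :
    coeff μ (g • S) = ∑ q ∈ antidiagonal μ, MvPolynomial.coeff q.1 g • coeff q.2 S := rfl

theorem coeff_C_smul (r : ℂ) (S : PSeries L) (μ : Mono) :
    coeff μ ((MvPolynomial.C r : Fun) • S) = r • coeff μ S := by
  rw [coeff_fun_smul, Finset.sum_eq_single (0, μ)]
  · simp
  · rintro ⟨q, q'⟩ hq hne
    rw [mem_antidiagonal] at hq
    dsimp only at hq ⊢
    rw [MvPolynomial.coeff_C, if_neg, zero_smul]
    rintro rfl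
    simp_all
  · simp

noncomputable instance : Module Fun (PSeries L) where
  one_smul S := by
    ext μ
    rw [← MvPolynomial.C_1, coeff_C_smul, one_smul]
  mul_smul g h S := by
    ext μ
    simp only [coeff_fun_smul, MvPolynomial.coeff_mul, Finset.sum_smul, Finset.smul_sum, mul_smul]
    exact sum_antidiagonal_assoc
      (fun i j k => MvPolynomial.coeff i g • MvPolynomial.coeff j h • coeff k S) μ
  smul_zero g := by
    ext μ
    simp [coeff_fun_smul]
  smul_add g S T := by
    ext μ
    simp [coeff_fun_smul, Finset.sum_add_distrib]
  add_smul g h S := by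
    ext μ
    simp [coeff_fun_smul, add_smul, Finset.sum_add_distrib]
  zero_smul S := by
    ext μ
    simp [coeff_fun_smul]

theorem C_smul (r : ℂ) (S : PSeries L) : (MvPolynomial.C r : Fun) • S = r • S := by
  ext μ
  rw [coeff_C_smul, map_smul]

instance : IsScalarTower ℂ Fun (PSeries L) where
  smul_assoc r g S := by
    rw [← C_smul, ← mul_smul, MvPolynomial.smul_eq_C_mul]

noncomputable instance : Bracket (PSeries L) (PSeries L) := ⟨fun S T => seriesBracket S T⟩

theorem coeff_lie (S T : PSeries L) (μ : Mono) :
    coeff μ ⁅S, T⁆ = ∑ q ∈ antidiagonal μ, ⁅coeff q.1 S, coeff q.2 T⁆ := rfl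

noncomputable instance : LieRing (PSeries L) where
  add_lie S T U := by
    ext μ
    simp [coeff_lie, Finset.sum_add_distrib]
  lie_add S T U := by
    ext μ
    simp [coeff_lie, Finset.sum_add_distrib]
  lie_self S := by
    ext μ
    rw [map_zero, coeff_lie]
    have h : ∑ q ∈ antidiagonal μ, ⁅coeff q.1 S, coeff q.2 S⁆
        = -∑ q ∈ antidiagonal μ, ⁅coeff q.1 S, coeff q.2 S⁆ := by
      rw [Finsupp.sum_antidiagonal_swap μ fun a b => ⁅coeff a S, coeff b S⁆,
        ← Finset.sum_neg_distrib]
      simp only [lie_skew]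
      exact (Finsupp.sum_antidiagonal_swap μ fun a b => ⁅coeff a S, coeff b S⁆).symm
    have h2 : (2 : ℂ) • ∑ q ∈ antidiagonal μ, ⁅coeff q.1 S, coeff q.2 S⁆ = 0 := by
      rw [two_smul]
      exact add_eq_zero_iff_eq_neg.2 h
    exact (smul_eq_zero.1 h2).resolve_left two_ne_zero
  leibniz_lie S T U := by
    ext μ
    simp only [map_add, coeff_lie, lie_sum, sum_lie]
    rw [sum_antidiagonal_assoc (fun i j k => ⁅⁅coeff i S, coeff j T⁆, coeff k U⁆),
      sum_antidiagonal_left_comm (fun i j k => ⁅coeff i T, ⁅coeff j S, coeff k U⁆⁆),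
      ← Finset.sum_add_distrib]
    refine Finset.sum_congr rfl fun p _ => ?_
    rw [← Finset.sum_add_distrib]
    exact Finset.sum_congr rfl fun q _ => leibniz_lie _ _ _

theorem fun_lie_smul (g : Fun) (S T : PSeries L) : ⁅S, g • T⁆ = g • ⁅S, T⁆ := by
  ext μ
  simp only [coeff_fun_smul, coeff_lie, lie_sum, Finset.smul_sum, lie_smul]
  exact sum_antidiagonal_left_comm
    (fun i j k => MvPolynomial.coeff j g • ⁅coeff i S, coeff k T⁆) μ

noncomputable instance : LieAlgebra Fun (PSeries L) where
  lie_smul := fun_lie_smul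

noncomputable instance : LieAlgebra ℂ (PSeries L) where
  lie_smul r S T := by
    rw [← C_smul, fun_lie_smul, C_smul]

/-- Partial derivative with respect to a coordinate. -/
noncomputable def pd (c : JetCoord) : PSeries L →ₗ[ℂ] PSeries L where
  toFun S := partialD c S
  map_add' S T := by
    ext μ
    exact smul_add (μ c + 1) (S _) (T _)
  map_smul' r S := by
    ext μ
    exact smul_comm (μ c + 1) r (S _)

theorem coeff_pd (c : JetCoord) (S : PSeries L) (μ : Mono) :
    coeff μ (pd c S) = (μ c + 1) • coeff (μ + Finsupp.single c 1) S := rfl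

theorem pd_lie (c : JetCoord) (S T : PSeries L) :
    pd c ⁅S, T⁆ = ⁅pd c S, T⁆ + ⁅S, pd c T⁆ := by
  ext μ
  simp only [map_add, coeff_pd, coeff_lie]
  have := sum_antidiagonal_leibniz c (fun a b => ⁅coeff a S, coeff b T⁆) μ
  rw [this]
  simp only [nsmul_lie, lie_nsmul]

theorem pd_smul (c : JetCoord) (g : Fun) (S : PSeries L) :
    pd c (g • S) = MvPolynomial.pderiv c g • S + g • pd c S := by
  ext μ
  simp only [map_add, coeff_pd, coeff_fun_smul, MvPolynomial.coeff_pderiv]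
  have := sum_antidiagonal_leibniz c (fun a b => MvPolynomial.coeff a g • coeff b S) μ
  rw [this]
  congr 1 <;> refine Finset.sum_congr rfl fun q _ => ?_
  · rw [mul_comm, mul_smul, ← Nat.cast_succ, Nat.cast_smul_eq_nsmul]
  · rw [smul_comm]

theorem pd_comm (c d : JetCoord) (S : PSeries L) : pd c (pd d S) = pd d (pd c S) := by
  ext μ
  simp only [coeff_pd, Finsupp.add_apply, smul_smul]
  rw [add_right_comm μ]
  by_cases h : c = d
  · subst h; rfl
  · congr 1
    simp [h, Ne.symm h, mul_comm]

end Module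

end PSeries

end JetCoord

/-! ### Highest derivatives in the zero-curvature equation -/

namespace JetCoord

open Finset.HasAntidiagonal
open MvPolynomial (pderiv)

section Taylor

theorem taylorAt_X (a : Point) (c : JetCoord) :
    taylorAt a (MvPolynomial.X c) = MvPolynomial.X c + MvPolynomial.C (a c) := by
  simp [taylorAt]

theorem pderiv_taylorAt (a : Point) (c : JetCoord) (g : Fun) :
    pderiv c (taylorAt a g) = taylorAt a (pderiv c g) := by
  induction g using MvPolynomial.induction_on with
  | C r => simp [taylorAt]
  | add f g hf hg => simp only [taylorAt, map_add] at *; rw [hf, hg]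
  | mul_X f d hf =>
    simp only [taylorAt, map_mul, Derivation.leibniz, smul_eq_mul, map_add, MvPolynomial.aeval_X,
      MvPolynomial.pderiv_X] at *
    rw [hf]
    by_cases h : c = d
    · subst h; simp
    · simp [Ne.symm h]

theorem pderiv_Dx (m : ℕ) (g : Fun) :
    pderiv (u (m + 1)) (Dx g) = Dx (pderiv (u (m + 1)) g) + pderiv (u m) g := by
  induction g using MvPolynomial.induction_on with
  | C r => simp [Dx]
  | add f g hf hg => simp only [map_add] at *; rw [hf, hg]; ring
  | mul_X f d hf =>
    simp only [Derivation.leibniz, smul_eq_mul, map_add, MvPolynomial.pderiv_X, hf]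
    have hd : pderiv (u (m + 1)) (Dx (MvPolynomial.X d)) = (Pi.single d 1 : JetCoord → Fun) (u m) := by
      cases d with
      | x => simp [Dx, totalX]
      | t => simp [Dx, totalX]
      | u k => by_cases h : k = m <;> simp [Dx, totalX, Pi.single_apply, h, eq_comm]
    have hs : Dx ((Pi.single (u (m + 1)) 1 : JetCoord → Fun) d) = 0 := by
      by_cases h : d = u (m + 1)
      · subst h; simp
      · simp [h]
    have hm : (Pi.single d 1 : JetCoord → Fun) (u m) = (Pi.single (u m) 1 : JetCoord → Fun) d := by
      simp only [Pi.single_apply, eq_comm]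
    rw [hd, hs, hm]
    ring

/-- The derivatives of `D_x^k(u_3 + u_0 u_1)` with respect to `u_{k+1}, u_{k+2}, …`. -/
theorem pderiv_totalT_kdv (k m : ℕ) (h : k < m) :
    pderiv (u m) (totalT kdv (u k))
      = if m = k + 3 then 1 else if m = k + 1 then MvPolynomial.X (u 0) else 0 := by
  induction k generalizing m with
  | zero =>
    simp only [totalT, Function.iterate_zero, id, kdv, map_add, Derivation.leibniz,
      MvPolynomial.pderiv_X, smul_eq_mul, Pi.single_apply, u.injEq]
    split_ifs <;> first | omega | simp
  | succ k ih =>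
    obtain ⟨m, rfl⟩ : ∃ m', m = m' + 1 := ⟨m - 1, by omega⟩
    have hs : totalT kdv (u (k + 1)) = Dx (totalT kdv (u k)) := by
      simp only [totalT, Function.iterate_succ_apply']
    rw [hs, pderiv_Dx, ih m (by omega), ih (m + 1) (by omega)]
    simp only [Nat.add_right_cancel_iff]
    split_ifs <;> first | omega | simp

end Taylor

namespace PSeries

variable {L L' : Type} [LieRing L] [LieAlgebra ℂ L] [LieRing L'] [LieAlgebra ℂ L']

/-- The image of a power series under a homomorphism of Lie algebras. -/
noncomputable def map (f : L →ₗ⁅ℂ⁆ L') : PSeries L →ₗ⁅ℂ⁆ PSeries L' where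
  toFun S := fun μ => f (coeff μ S)
  map_add' S T := funext fun μ => map_add f (coeff μ S) (coeff μ T)
  map_smul' r S := funext fun μ => map_smul f r (coeff μ S)
  map_lie' {S T} := funext fun μ => map_seriesBracket f S T μ

theorem coeff_map (f : L →ₗ⁅ℂ⁆ L') (S : PSeries L) (μ : Mono) :
    coeff μ (map f S) = f (coeff μ S) := rfl

theorem map_fun_smul (f : L →ₗ⁅ℂ⁆ L') (g : Fun) (S : PSeries L) : map f (g • S) = g • map f S :=
  funext fun μ => map_polyMul f g S μ

theorem map_pd (f : L →ₗ⁅ℂ⁆ L') (c : JetCoord) (S : PSeries L) :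
    map f (pd c S) = pd c (map f S) := map_partialD f c S

/-- The constant term, as a homomorphism of Lie algebras. -/
noncomputable def ev : PSeries L →ₗ⁅ℂ⁆ L :=
  { (coeff 0 : PSeries L →ₗ[ℂ] L) with
    map_lie' := fun {S T} => by
      change coeff 0 ⁅S, T⁆ = ⁅coeff 0 S, coeff 0 T⁆
      rw [coeff_lie, Finsupp.antidiagonal_zero, Finset.sum_singleton] }

theorem ev_apply (S : PSeries L) : ev S = coeff 0 S := rfl

theorem coeff_eq_zero_of_pd {c : JetCoord} {S : PSeries L} (h : pd c S = 0) {μ : Mono}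
    (hμ : μ c ≠ 0) : coeff μ S = 0 := by
  have h1 := coeff_pd c S (μ - Finsupp.single c 1)
  have hle : Finsupp.single c 1 ≤ μ := by
    rw [Finsupp.single_le_iff]; omega
  rw [h, map_zero, tsub_add_cancel_of_le hle] at h1
  rw [← Nat.cast_smul_eq_nsmul ℂ] at h1
  refine (smul_eq_zero.1 h1.symm).resolve_left ?_
  exact Nat.cast_ne_zero.2 (Nat.succ_ne_zero _)

/-- A power series that does not depend on `u_0, u_1, …`. -/
def NoU (S : PSeries L) : Prop := ∀ k, pd (u k) S = 0

theorem NoU.coeff_eq_zero {S : PSeries L} (h : S.NoU) {μ : Mono} (hμ : ¬ μ.NoU) :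
    coeff μ S = 0 := by
  obtain ⟨k, hk⟩ := not_forall.1 hμ
  exact coeff_eq_zero_of_pd (h k) hk

theorem NoU.eq_zero {S : PSeries L} (h : S.NoU) (h0 : ∀ μ : Mono, μ.NoU → coeff μ S = 0) :
    S = 0 := by
  ext μ
  by_cases hμ : μ.NoU
  · exact h0 μ hμ
  · exact h.coeff_eq_zero hμ

/-- The vector field `∑_c V(c) ∂_c`, truncated at `u_n`, as a linear operator on power series
at `a`. -/
noncomputable def field (V : JetCoord → Fun) (a : Point) (n : ℕ) : PSeries L →ₗ[ℂ] PSeries L where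
  toFun S := taylorAt a (V x) • pd x S + taylorAt a (V t) • pd t S
    + ∑ k ∈ Finset.range (n + 1), taylorAt a (V (u k)) • pd (u k) S
  map_add' S T := by
    simp only [map_add, smul_add, Finset.sum_add_distrib]
    abel
  map_smul' r S := by
    simp only [map_smul, smul_add, Finset.smul_sum, RingHom.id_apply, smul_comm r]

theorem field_apply (V : JetCoord → Fun) (a : Point) (n : ℕ) (S : PSeries L) :
    field V a n S = taylorAt a (V x) • pd x S + taylorAt a (V t) • pd t S
    + ∑ k ∈ Finset.range (n + 1), taylorAt a (V (u k)) • pd (u k) S := rfl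

theorem field_lie (V : JetCoord → Fun) (a : Point) (n : ℕ) (S T : PSeries L) :
    field V a n ⁅S, T⁆ = ⁅field V a n S, T⁆ + ⁅S, field V a n T⁆ := by
  simp only [field_apply, pd_lie, smul_add, Finset.sum_add_distrib, add_lie, lie_add,
    sum_lie, lie_sum, smul_lie, lie_smul]
  abel

theorem pd_field (V : JetCoord → Fun) (a : Point) (n : ℕ) (c : JetCoord) (S : PSeries L) :
    pd c (field V a n S) = field V a n (pd c S)
      + (taylorAt a (pderiv c (V x)) • pd x S + taylorAt a (pderiv c (V t)) • pd t S
    + ∑ k ∈ Finset.range (n + 1), taylorAt a (pderiv c (V (u k))) • pd (u k) S) := by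
  simp only [field_apply, map_add, map_sum, pd_smul, pderiv_taylorAt, Finset.sum_add_distrib,
    pd_comm c]
  abel

theorem NoU.field_eq {S : PSeries L} (h : S.NoU) (V : JetCoord → Fun) (a : Point) (n : ℕ) :
    field V a n S = taylorAt a (V x) • pd x S + taylorAt a (V t) • pd t S := by
  have : ∀ k, pd (u k) S = 0 := h
  simp [field_apply, this]

theorem NoU.field_totalX {S : PSeries L} (hS : S.NoU) (a : Point) (n : ℕ) :
    field totalX a n S = pd x S := by
  rw [hS.field_eq]
  simp [totalX, taylorAt]

theorem NoU.pd {S : PSeries L} (h : S.NoU) (c : JetCoord) : (pd c S).NoU := fun k => by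
  rw [pd_comm, h k, map_zero]

theorem NoU.add {S T : PSeries L} (hS : S.NoU) (hT : T.NoU) : (S + T).NoU := fun k => by
  rw [map_add, hS k, hT k, add_zero]

theorem NoU.sub {S T : PSeries L} (hS : S.NoU) (hT : T.NoU) : (S - T).NoU := fun k => by
  rw [map_sub, hS k, hT k, sub_zero]

theorem NoU.smul {S : PSeries L} (hS : S.NoU) (r : ℂ) : (r • S).NoU := fun k => by
  rw [map_smul, hS k, smul_zero]

theorem NoU.lie {S T : PSeries L} (hS : S.NoU) (hT : T.NoU) : NoU ⁅S, T⁆ := fun k => by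
  rw [pd_lie, hS k, hT k, zero_lie, lie_zero, add_zero]

/-- The operator `∂_{u_{m-1}}`, with `∂_{u_{-1}} = 0`. -/
noncomputable def pdPred : ℕ → PSeries L →ₗ[ℂ] PSeries L
  | 0 => 0
  | m + 1 => pd (u m)

theorem pdPred_succ (m : ℕ) (S : PSeries L) : pdPred (m + 1) S = pd (u m) S := rfl

/-- This is the commutator [∂_{u_m}, D_x] = ∂_{u_{m-1}}. The bound is `n + 1` because the field
truncated at u_n still contains u_{n+1}∂_{u_n}. -/
theorem pd_field_totalX (a : Point) {n m : ℕ} (hm : m ≤ n + 1) (S : PSeries L) :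
    pd (u m) (field totalX a n S) = field totalX a n (pd (u m) S) + pdPred m S := by
  rw [pd_field]
  congr 1
  have h1 : ∀ k, pderiv (u m) (totalX (u k)) = if m = k + 1 then 1 else 0 := by
    intro k
    simp only [totalX, MvPolynomial.pderiv_X, Pi.single_apply, u.injEq, eq_comm]
  have ht : taylorAt a 1 = 1 := map_one _
  have ht0 : taylorAt a 0 = 0 := map_zero _
  cases m with
  | zero => simp [totalX, ht0, pdPred]
  | succ m =>
    rw [Finset.sum_eq_single m]
    · simp [totalX, ht, ht0, pdPred]
    · intro k _ hk
      rw [h1, if_neg (by omega), ht0, zero_smul]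
    · intro hk
      simp at hk; omega

/-- A pair of power series that satisfies the defining relations of `𝔽^p` for the KdV equation. -/
structure IsNormalZCR (a : Point) (p : ℕ) (A B : PSeries L) : Prop where
  A_order : ∀ k, p < k → pd (u k) A = 0
  B_order : ∀ k, p + 2 < k → pd (u k) B = 0
  zcr : field totalX a (p + 2) B - field (totalT kdv) a p A + ⁅A, B⁆ = 0
  A_zero : ∀ μ : Mono, μ.NoU → coeff μ A = 0
  B_zero : ∀ μ : Mono, μ x = 0 → μ.NoU → coeff μ B = 0
  A_one : ∀ (μ : Mono) (r : ℕ), 1 ≤ r → r ≤ p → μ (u r) = 1 → μ.OrderLE r → coeff μ A = 0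

namespace IsNormalZCR

variable {a : Point} {p : ℕ} {A B : PSeries L} (h : IsNormalZCR a p A B)

include h

theorem pd_T (m : ℕ) (hm : p < m) : pd (u m) (field (totalT kdv) a p A)
    = ∑ k ∈ Finset.range (p + 1), taylorAt a (if m = k + 3 then 1 else if m = k + 1 then
      MvPolynomial.X (u 0) else 0) • pd (u k) A := by
  rw [pd_field, h.A_order m hm, map_zero, zero_add]
  have h0 : taylorAt a 0 = 0 := map_zero _
  simp only [totalT, map_zero, MvPolynomial.pderiv_one, h0, zero_smul, zero_add]
  refine Finset.sum_congr rfl fun k hk => ?_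
  rw [← pderiv_totalT_kdv k m (by simp at hk; omega)]
  rfl

/-- Only u_{k+3} and u_{k+1} occur among the variables above u_k in D_x^k(F) with a nonzero
derivative, and k + 1 = p + 2 is out of range. What remains is the term k = p - 1, which is absent
for p = 0. -/
theorem pd_T_add_two : pd (u (p + 2)) (field (totalT kdv) a p A) = pdPred p A := by
  have h0 : taylorAt a 0 = 0 := map_zero _
  have h1 : taylorAt a 1 = 1 := map_one _
  rw [h.pd_T _ (by omega)]
  cases p with
  | zero => simp [h0, pdPred]
  | succ q =>
    rw [Finset.sum_eq_single q]
    · simp [h1, pdPred]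
    · intro k hk hkq
      simp only [Finset.mem_range] at hk
      rw [if_neg (by omega), if_neg (by omega), h0, zero_smul]
    · intro hq
      simp at hq

theorem pd_pd_T : pd (u (p + 1)) (pd (u (p + 1)) (field (totalT kdv) a p A)) = 0 := by
  rw [h.pd_T _ (by omega), map_sum]
  refine Finset.sum_eq_zero fun k _ => ?_
  rw [pd_smul, pd_comm, h.A_order (p + 1) (by omega), map_zero, smul_zero, add_zero,
    pderiv_taylorAt]
  have h0 : taylorAt a 0 = 0 := map_zero _
  split_ifs
  · simp [h0]
  · simp [MvPolynomial.pderiv_X, h0]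
  · simp [h0]

theorem pd_zcr (m : ℕ) (hm : m ≤ p + 3) : field totalX a (p + 2) (pd (u m) B) + pdPred m B
    - pd (u m) (field (totalT kdv) a p A) + (⁅pd (u m) A, B⁆ + ⁅A, pd (u m) B⁆) = 0 := by
  have := congrArg (pd (u m)) h.zcr
  rwa [map_add, map_sub, pd_lie, map_zero, pd_field_totalX a hm] at this

/-- The variable u_{p+3} enters D_x B only through u_{p+3}∂_{u_{p+2}}, and D_t A only through the
top term of D_x^p(u_3). -/
theorem pd_B_add_two : pd (u (p + 2)) B = pd (u p) A := by
  have h1 := h.pd_zcr (p + 3) le_rfl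
  have h2 : pd (u (p + 3)) (field (totalT kdv) a p A) = pd (u p) A := by
    rw [h.pd_T _ (by omega), Finset.sum_eq_single p]
    · simp [taylorAt]
    · intro k hk hkp
      simp only [Finset.mem_range] at hk
      rw [if_neg (by omega), if_neg (by omega)]
      simp [taylorAt]
    · simp
  rw [h.B_order (p + 3) (by omega), h.A_order (p + 3) (by omega), h2] at h1
  simpa [pdPred, sub_eq_zero] using h1

theorem pd_B_add_one : pd (u (p + 1)) B
    = pdPred p A - field totalX a (p + 2) (pd (u p) A) - ⁅A, pd (u p) A⁆ := by
  have h1 := h.pd_zcr (p + 2) (by omega)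
  rw [h.pd_B_add_two, h.A_order (p + 2) (by omega), h.pd_T_add_two, zero_lie, zero_add] at h1
  rw [pdPred_succ] at h1
  rw [← sub_eq_zero, ← h1]
  abel

/-- Differentiate the zero-curvature equation twice in u_{p+1}. With ∇S = D_x S + [A, S], the known
derivatives of B give ∂²_{p+1}B = -∂²_p A and ∂_p∂_{p+1}B = -∇(∂²_p A). The mixed derivative appears
twice, so the outcome is -3∇(∂²_p A) = 0. -/
theorem cov_pd_pd_A : field totalX a (p + 2) (pd (u p) (pd (u p) A))
    + ⁅A, pd (u p) (pd (u p) A)⁆ = 0 := by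
  have hA := h.A_order (p + 1) (by omega)
  have hpred : pd (u (p + 1)) (pdPred p A) = 0 := by
    cases p with
    | zero => simp [pdPred]
    | succ q => rw [pdPred, pd_comm, hA, map_zero]
  have h11 : pd (u (p + 1)) (pd (u (p + 1)) B) = -pd (u p) (pd (u p) A) := by
    rw [h.pd_B_add_one, map_sub, map_sub, pd_field_totalX a (by omega), pd_lie, hA,
      pd_comm _ (u p) A, hA, hpred]
    simp [pdPred]
  have hpp : pd (u p) (pdPred p A) = pdPred p (pd (u p) A) := by
    cases p with
    | zero => simp [pdPred]
    | succ q => exact pd_comm _ _ _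
  have h01 : pd (u p) (pd (u (p + 1)) B) = -field totalX a (p + 2) (pd (u p) (pd (u p) A))
      - ⁅A, pd (u p) (pd (u p) A)⁆ := by
    rw [h.pd_B_add_one, map_sub, map_sub, pd_field_totalX a (by omega), pd_lie, hpp, lie_self]
    abel
  have h1 := congrArg (pd (u (p + 1))) (h.pd_zcr (p + 1) (by omega))
  rw [map_add, map_sub, map_add, map_add, pd_field_totalX a (by omega), hA, h.pd_pd_T,
    pd_lie _ A, hA, h11, zero_lie, zero_lie, map_zero, pdPred_succ, pdPred_succ,
    pd_comm (u (p + 1)) (u p), h01] at h1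
  simp only [map_neg, lie_neg] at h1
  have h3 : (3 : ℂ) • (field totalX a (p + 2) (pd (u p) (pd (u p) A))
    + ⁅A, pd (u p) (pd (u p) A)⁆) = 0 := by
    rw [← neg_eq_zero, ← h1]
    module
  exact (smul_eq_zero.1 h3).resolve_left (by norm_num)

/-- A covariantly constant power series depends on `t` only. -/
theorem noU_of_cov {S : PSeries L} (hS : ∀ k, p + 2 < k → pd (u k) S = 0)
    (hc : field totalX a (p + 2) S + ⁅A, S⁆ = 0) : S.NoU := by
  -- Descending induction on the highest variable: once S is free of u_{k+1}, u_{k+2}, …, the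
  -- u_{k+1}-derivative of the equation reads ∂_{u_k}S + [∂_{u_{k+1}}A, S] = 0.
  have key : ∀ j m, p + 3 ≤ m + j → ∀ k, m ≤ k → pd (u k) S = 0 := by
    intro j
    induction j with
    | zero => exact fun m hm k hk => hS k (by omega)
    | succ j ih =>
      intro m hm k hk
      by_cases hk' : m + 1 ≤ k
      · exact ih (m + 1) (by omega) k hk'
      obtain rfl : k = m := by omega
      by_cases hk3 : p + 2 < k
      · exact hS k hk3
      have hi : ∀ n, k + 1 ≤ n → pd (u n) S = 0 := fun n hn => ih (k + 1) (by omega) n hn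
      have h1 := congrArg (pd (u (k + 1))) hc
      rw [map_add, pd_field_totalX a (by omega), hi _ le_rfl, pd_lie, hi _ le_rfl] at h1
      simp only [pdPred_succ, map_zero, lie_zero, zero_add, add_zero] at h1
      by_cases hkp : p < k + 1
      · simpa [h.A_order _ hkp] using h1
      ext ν
      -- On monomials free of u_{k+1}, u_{k+2}, … only coefficients of A linear in their last
      -- variable u_{k+1} enter the bracket, and `A_one` kills these.
      by_cases hν : ∀ n, k + 1 ≤ n → ν (u n) = 0
      · have h2 := congrArg (coeff ν) h1
        rw [map_add, coeff_lie, Finset.sum_eq_zero, add_zero] at h2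
        · exact h2
        · rintro ⟨q, q'⟩ hq
          rw [mem_antidiagonal] at hq
          have hq0 : ∀ n, k + 1 ≤ n → q (u n) = 0 := by
            intro n hn
            have := hν n hn
            rw [← hq] at this
            simp at this
            exact this.1
          dsimp only
          rw [coeff_pd, h.A_one _ (k + 1) (by omega) (by omega) (by simp [hq0]), smul_zero, zero_lie]
          intro n hn
          simp [hq0 n (by omega), Finsupp.single_apply]
          omega
      · obtain ⟨n, hn⟩ := not_forall.1 hν
        rw [Classical.not_imp] at hn
        exact coeff_eq_zero_of_pd (c := u n) (by rw [pd_comm, hi n hn.1, map_zero]) hn.2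
  exact fun k => key (p + 3) 0 (by omega) k (by omega)

theorem coeff_lie_A {S : PSeries L} {μ : Mono} (hμ : μ.NoU) : coeff μ ⁅A, S⁆ = 0 := by
  rw [coeff_lie]
  refine Finset.sum_eq_zero ?_
  rintro ⟨q, q'⟩ hq
  rw [mem_antidiagonal] at hq
  rw [h.A_zero, zero_lie]
  intro n
  have := hμ n
  rw [← hq] at this
  simp at this
  exact this.1

theorem pd_x_of_cov {S : PSeries L} (hS : ∀ k, p + 2 < k → pd (u k) S = 0)
    (hc : field totalX a (p + 2) S + ⁅A, S⁆ = 0) : pd x S = 0 := by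
  have hU := h.noU_of_cov hS hc
  rw [hU.field_totalX] at hc
  refine (hU.pd x).eq_zero fun μ hμ => ?_
  have := congrArg (coeff μ) hc
  rwa [map_add, h.coeff_lie_A hμ, add_zero] at this

theorem lie_of_cov {S : PSeries L} (hS : ∀ k, p + 2 < k → pd (u k) S = 0)
    (hc : field totalX a (p + 2) S + ⁅A, S⁆ = 0) : ⁅A, S⁆ = 0 := by
  have hx := h.pd_x_of_cov hS hc
  rwa [(h.noU_of_cov hS hc).field_totalX, hx, zero_add] at hc

end IsNormalZCR

end PSeries

end JetCoord

/-! ### Covariantly constant series have central coefficients -/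

namespace JetCoord

open Finset.HasAntidiagonal
open MvPolynomial (pderiv)

namespace PSeries

variable {L L' : Type} [LieRing L] [LieAlgebra ℂ L] [LieRing L'] [LieAlgebra ℂ L']

theorem NoU.field_totalT {S : PSeries L} (hS : S.NoU) (F : Fun) (a : Point) (n : ℕ) :
    field (totalT F) a n S = PSeries.pd t S := by
  rw [hS.field_eq]
  simp [totalT, taylorAt]

theorem coeff_eq_inv_smul {c : JetCoord} (S : PSeries L) {μ : Mono} (hμ : μ c ≠ 0) :
    coeff μ S = (μ c : ℂ)⁻¹ • coeff (μ - Finsupp.single c 1) (pd c S) := by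
  have hle : Finsupp.single c 1 ≤ μ := by
    rw [Finsupp.single_le_iff]; omega
  have h : (μ - Finsupp.single c 1 : Mono) c + 1 = μ c := by
    simp; omega
  rw [coeff_pd, tsub_add_cancel_of_le hle, h, ← Nat.cast_smul_eq_nsmul ℂ, inv_smul_smul₀]
  exact Nat.cast_ne_zero.2 hμ

namespace IsNormalZCR

variable {a : Point} {p : ℕ} {A B : PSeries L} (h : IsNormalZCR a p A B)

include h

/-- Bracketing the zero-curvature equation with S shows that [S, B] - S_t is again covariantly
constant, hence a series in t. So [S, B] is a series in t as well, and it vanishes because the pure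
t-coefficients of B do. What is left is -S_t, which therefore commutes with A. -/
theorem lie_B_and_pd_t {S : PSeries L} (hU : S.NoU) (hx : pd x S = 0) (hA : ⁅A, S⁆ = 0) :
    ⁅S, B⁆ = 0 ∧ ⁅A, pd t S⁆ = 0 := by
  have hA' : ⁅S, A⁆ = 0 := by rw [← lie_skew, hA, neg_zero]
  have hT : ⁅S, field (totalT kdv) a p A⁆ = -⁅pd t S, A⁆ := by
    have := field_lie (totalT kdv) a p S A
    rw [hA', map_zero, hU.field_totalT] at this
    exact (neg_eq_of_add_eq_zero_right this.symm).symm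
  have hXB : field totalX a (p + 2) ⁅S, B⁆ = ⁅S, field totalX a (p + 2) B⁆ := by
    rw [field_lie, hU.field_totalX, hx, zero_lie, zero_add]
  have hX : field totalX a (p + 2) (⁅S, B⁆ - pd t S) + ⁅A, ⁅S, B⁆ - pd t S⁆ = 0 := by
    have h1 := congrArg (fun Z => ⁅S, Z⁆) h.zcr
    simp only [lie_add, lie_sub, lie_zero, hT] at h1
    rw [leibniz_lie S A B, hA', zero_lie, zero_add] at h1
    rw [map_sub, (hU.pd t).field_totalX, pd_comm, hx, map_zero, hXB, sub_zero, lie_sub, ← h1,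
      ← lie_skew A (pd t S)]
    abel
  have hord : ∀ k, p + 2 < k → pd (u k) (⁅S, B⁆ - pd t S) = 0 := fun k hk => by
    rw [map_sub, pd_lie, hU k, h.B_order k hk, hU.pd t k]
    simp
  have hV := h.noU_of_cov hord hX
  have hVx := h.pd_x_of_cov hord hX
  have hB : ⁅S, B⁆ = 0 := by
    ext μ
    rw [map_zero]
    by_cases hμ : μ.NoU
    · by_cases hμx : μ x = 0
      · rw [coeff_lie]
        refine Finset.sum_eq_zero ?_
        rintro ⟨q, q'⟩ hq
        rw [mem_antidiagonal] at hq
        have hle : ∀ c, μ c = 0 → q' c = 0 := fun c hc => by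
          rw [← hq] at hc
          simp at hc
          exact hc.2
        rw [h.B_zero q' (hle _ hμx) fun k => hle _ (hμ k), lie_zero]
      · have h1 : coeff μ (⁅S, B⁆ - pd t S) = 0 := coeff_eq_zero_of_pd hVx hμx
        have h2 : coeff μ (pd t S) = 0 :=
          coeff_eq_zero_of_pd (c := x) (by rw [pd_comm, hx, map_zero]) hμx
        rwa [map_sub, h2, sub_zero] at h1
    · have h1 := hV.coeff_eq_zero hμ
      rwa [map_sub, (hU.pd t).coeff_eq_zero hμ, sub_zero] at h1
  refine ⟨hB, ?_⟩
  have := h.lie_of_cov hord hX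
  rwa [hB, zero_sub, lie_neg, neg_eq_zero] at this

end IsNormalZCR

/-- If all the `t`-derivatives of a power series in `t` commute with a power series, then so do
all the coefficients. -/
theorem lie_coeff_of_lie_iterate {S T : PSeries L} (hU : S.NoU) (hx : pd x S = 0)
    (h : ∀ n, ⁅(pd t)^[n] S, T⁆ = 0) (μ ν : Mono) : ⁅coeff μ S, coeff ν T⁆ = 0 := by
  obtain ⟨l, hl⟩ : ∃ l, ν t = l := ⟨_, rfl⟩
  induction l using Nat.strong_induction_on generalizing S μ ν with
  | _ l ihl =>
  obtain ⟨k, hk⟩ : ∃ k, μ t = k := ⟨_, rfl⟩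
  induction k generalizing S μ with
  | succ k ihk =>
    rw [coeff_eq_inv_smul S (by omega : μ t ≠ 0), smul_lie]
    rw [ihk (hU.pd t) (by rw [pd_comm, hx, map_zero]) (fun n => h (n + 1)), smul_zero]
    simp [hk]
  | zero =>
    have h0 : ∀ q : Mono, q t = 0 → q ≠ 0 → coeff q S = 0 := by
      intro q hq hq0
      obtain ⟨c, hc⟩ := DFunLike.ne_iff.1 hq0
      cases c with
      | x => exact coeff_eq_zero_of_pd hx hc
      | t => exact absurd hq hc
      | u k => exact coeff_eq_zero_of_pd (hU k) hc
    -- In the ν-coefficient of [S, T], every term other than [S_0, T_ν] either vanishes or pairs a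
    -- positive power of t in S with a coefficient of T of smaller t-degree, which the outer
    -- induction handles. Higher coefficients of S are constant terms of its t-derivatives up to a
    -- scalar.
    by_cases hμ : μ = 0
    · subst hμ
      have h1 := congrArg (coeff ν) (h 0)
      rw [Function.iterate_zero, id, coeff_lie, Finset.sum_eq_single (0, ν)] at h1
      · exact h1
      · rintro ⟨q, q'⟩ hq hne
        rw [mem_antidiagonal] at hq
        dsimp only at hq ⊢
        by_cases hqt : q t = 0
        · rw [h0 q hqt, zero_lie]
          rintro rfl
          simp_all
        · refine ihl (q' t) ?_ hU hx h q q' rfl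
          rw [← hl, ← hq, Finsupp.add_apply]
          omega
      · simp
    · rw [h0 μ hk hμ, zero_lie]

/-- All the coefficients are central. -/
def IsCentral (S : PSeries L) : Prop := ∀ μ, ∀ y : L, ⁅coeff μ S, y⁆ = 0

theorem IsCentral.lie_eq_zero {S : PSeries L} (h : S.IsCentral) (T : PSeries L) : ⁅S, T⁆ = 0 := by
  ext μ
  rw [coeff_lie, map_zero]
  exact Finset.sum_eq_zero fun q _ => h _ _

theorem IsCentral.lie_eq_zero' {S : PSeries L} (h : S.IsCentral) (T : PSeries L) :
    ⁅T, S⁆ = 0 := by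
  rw [← lie_skew, h.lie_eq_zero, neg_zero]

theorem IsCentral.pd {S : PSeries L} (h : S.IsCentral) (c : JetCoord) : (pd c S).IsCentral :=
  fun μ y => by rw [coeff_pd, ← Nat.cast_smul_eq_nsmul ℂ, smul_lie, h, smul_zero]

theorem IsCentral.add {S T : PSeries L} (hS : S.IsCentral) (hT : T.IsCentral) :
    (S + T).IsCentral := fun μ y => by rw [map_add, add_lie, hS, hT, add_zero]

theorem IsCentral.sub {S T : PSeries L} (hS : S.IsCentral) (hT : T.IsCentral) :
    (S - T).IsCentral := fun μ y => by rw [map_sub, sub_lie, hS, hT, sub_zero]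

theorem IsCentral.smul {S : PSeries L} (hS : S.IsCentral) (r : ℂ) : (r • S).IsCentral :=
  fun μ y => by rw [map_smul, smul_lie, hS, smul_zero]

theorem IsCentral.fun_smul {S : PSeries L} (hS : S.IsCentral) (g : Fun) : (g • S).IsCentral :=
  fun μ y => by
    rw [coeff_fun_smul, sum_lie]
    exact Finset.sum_eq_zero fun q _ => by rw [smul_lie, hS, smul_zero]

namespace IsNormalZCR

variable {a : Point} {p : ℕ} {A B : PSeries L} (h : IsNormalZCR a p A B)

include h

/-- The hypothesis on S is inherited by S_t through `lie_B_and_pd_t`, so all t-derivatives commute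
with A and B, and then so do the individual coefficients. The assumption `hgen` says that the
coefficients of A and B detect the centre. -/
theorem isCentral_of_lie (hgen : ∀ z : L, (∀ μ, ⁅z, coeff μ A⁆ = 0) → (∀ μ, ⁅z, coeff μ B⁆ = 0) →
    ∀ y : L, ⁅z, y⁆ = 0) {S : PSeries L} (hU : S.NoU) (hx : PSeries.pd x S = 0) (hA : ⁅A, S⁆ = 0) :
    S.IsCentral := by
  have hn : ∀ n, NoU ((PSeries.pd t)^[n] S) ∧ PSeries.pd x ((PSeries.pd t)^[n] S) = 0 ∧
      ⁅A, (PSeries.pd t)^[n] S⁆ = 0 := by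
    intro n
    induction n with
    | zero => exact ⟨hU, hx, hA⟩
    | succ n ih =>
      rw [Function.iterate_succ_apply']
      exact ⟨ih.1.pd t, by rw [pd_comm, ih.2.1, map_zero], (h.lie_B_and_pd_t ih.1 ih.2.1 ih.2.2).2⟩
  intro μ
  apply hgen
  · refine lie_coeff_of_lie_iterate hU hx (fun n => ?_) μ
    rw [← lie_skew, (hn n).2.2, neg_zero]
  · exact lie_coeff_of_lie_iterate hU hx
      (fun n => (h.lie_B_and_pd_t (hn n).1 (hn n).2.1 (hn n).2.2).1) μ

theorem pd_pd_A_order (k : ℕ) (hk : p + 2 < k) :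
    PSeries.pd (u k) (PSeries.pd (u p) (PSeries.pd (u p) A)) = 0 := by
  rw [pd_comm, pd_comm (u k), h.A_order k (by omega), map_zero, map_zero]

theorem noU_pd_pd_A : NoU (PSeries.pd (u p) (PSeries.pd (u p) A)) :=
  h.noU_of_cov h.pd_pd_A_order h.cov_pd_pd_A

theorem pd_x_pd_pd_A : PSeries.pd x (PSeries.pd (u p) (PSeries.pd (u p) A)) = 0 :=
  h.pd_x_of_cov h.pd_pd_A_order h.cov_pd_pd_A

theorem isCentral_pd_pd_A (hgen : ∀ z : L, (∀ μ, ⁅z, coeff μ A⁆ = 0) →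
    (∀ μ, ⁅z, coeff μ B⁆ = 0) → ∀ y : L, ⁅z, y⁆ = 0) :
    (PSeries.pd (u p) (PSeries.pd (u p) A)).IsCentral :=
  h.isCentral_of_lie hgen h.noU_pd_pd_A h.pd_x_pd_pd_A (h.lie_of_cov h.pd_pd_A_order h.cov_pd_pd_A)

end IsNormalZCR

end PSeries

end JetCoord

/-! ### The universal zero-curvature pair -/

namespace JetCoord

open PSeries

section LieGeneration

/-- A Lie subalgebra that contains the free generators is everything. -/
theorem _root_.FreeLieAlgebra.mem_of_forall_of {X : Type} (K : LieSubalgebra ℂ (FreeLieAlgebra ℂ X))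
    (h : ∀ i, FreeLieAlgebra.of ℂ i ∈ K) (z : FreeLieAlgebra ℂ X) : z ∈ K := by
  have h1 : K.incl.comp (FreeLieAlgebra.lift ℂ fun i => (⟨FreeLieAlgebra.of ℂ i, h i⟩ : K))
      = LieHom.id := by
    apply FreeLieAlgebra.hom_ext
    intro i
    simp
  have h2 := LieHom.congr_fun h1 z
  rw [LieHom.comp_apply] at h2
  simp only [LieHom.id_apply] at h2
  rw [← h2]
  exact Subtype.property _

end LieGeneration

variable {F : Fun} {d p : ℕ} {a : Point}

theorem proj_surjective : Function.Surjective (proj F d p a) := by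
  rintro ⟨z⟩
  exact ⟨z, rfl⟩

/-- The generating series `A` with coefficients in `𝔽^p`. -/
noncomputable def genA (F : Fun) (d p : ℕ) (a : Point) : PSeries (FAlg F d p a) :=
  fun μ => proj F d p a (seriesA d p μ)

/-- The generating series `B` with coefficients in `𝔽^p`. -/
noncomputable def genB (F : Fun) (d p : ℕ) (a : Point) : PSeries (FAlg F d p a) :=
  fun μ => proj F d p a (seriesB d p μ)

theorem coeff_genA (μ : Mono) : coeff μ (genA F d p a) = proj F d p a (seriesA d p μ) := rfl

theorem coeff_genB (μ : Mono) : coeff μ (genB F d p a) = proj F d p a (seriesB d p μ) := rfl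

theorem mem_of_coeff_mem (K : LieSubalgebra ℂ (FAlg F d p a))
    (hA : ∀ μ, coeff μ (genA F d p a) ∈ K) (hB : ∀ μ, coeff μ (genB F d p a) ∈ K)
    (y : FAlg F d p a) : y ∈ K := by
  obtain ⟨z, rfl⟩ := proj_surjective y
  refine FreeLieAlgebra.mem_of_forall_of (K.comap (proj F d p a)) ?_ z
  rintro (⟨μ, h⟩ | ⟨μ, h⟩)
  · have := hA μ
    rwa [coeff_genA, seriesA, dif_pos h] at this
  · have := hB μ
    rwa [coeff_genB, seriesB, dif_pos h] at this

theorem lie_eq_zero_of_lie_gen (z : FAlg F d p a) (hA : ∀ μ, ⁅z, coeff μ (genA F d p a)⁆ = 0)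
    (hB : ∀ μ, ⁅z, coeff μ (genB F d p a)⁆ = 0) (y : FAlg F d p a) : ⁅z, y⁆ = 0 := by
  let K : LieSubalgebra ℂ (FAlg F d p a) :=
    { LinearMap.ker (LieAlgebra.ad ℂ (FAlg F d p a) z) with
      lie_mem' := by
        intro v w hv hw
        change ⁅z, v⁆ = 0 at hv
        change ⁅z, w⁆ = 0 at hw
        change ⁅z, ⁅v, w⁆⁆ = 0
        rw [leibniz_lie, hv, hw, zero_lie, lie_zero, add_zero] }
  exact mem_of_coeff_mem K hA hB y

theorem pd_eq_zero_of_order {L : Type} [LieRing L] [LieAlgebra ℂ L] {S : PSeries L} {n : ℕ}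
    (h : ∀ μ : Mono, ¬ μ.OrderLE n → coeff μ S = 0) (k : ℕ) (hk : n < k) : pd (u k) S = 0 := by
  ext μ
  rw [coeff_pd, h, smul_zero, map_zero]
  intro h'
  have := h' k hk
  simp at this

theorem isNormalZCR_gen (p : ℕ) (a : Point) :
    IsNormalZCR a p (genA kdv 3 p a) (genB kdv 3 p a) where
  A_order := pd_eq_zero_of_order fun μ h => by rw [coeff_genA, seriesA_of_not h, map_zero]
  B_order := pd_eq_zero_of_order fun μ h => by rw [coeff_genB, seriesB_of_not h, map_zero]
  zcr := by
    ext μ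
    have := proj_eq_zero (Relator.zcr (F := kdv) (d := 3) (p := p) (a := a) μ)
    rw [map_curvature] at this
    exact this
  A_zero μ h := proj_eq_zero (Relator.A_zero μ h)
  B_zero μ hx h := proj_eq_zero (Relator.B_zero μ hx h)
  A_one μ r hr hrp h1 h := proj_eq_zero (Relator.A_one μ r hr hrp h1 h)

/-- The homomorphism from `𝔽^p` that corresponds to a pair of power series. -/
theorem exists_hom_of_isNormalZCR {L : Type} [LieRing L] [LieAlgebra ℂ L] {A B : PSeries L}
    (h : IsNormalZCR a p A B) : ∃ f : FAlg kdv 3 p a →ₗ⁅ℂ⁆ L,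
      map f (genA kdv 3 p a) = A ∧ map f (genB kdv 3 p a) = B := by
  let g : FreeAlg 3 p →ₗ⁅ℂ⁆ L := FreeLieAlgebra.lift ℂ fun i => match i with
    | Gen.A μ _ => coeff μ A
    | Gen.B μ _ => coeff μ B
  have hA : ∀ μ, g (seriesA 3 p μ) = coeff μ A := by
    intro μ
    by_cases hμ : μ.OrderLE p
    · rw [seriesA, dif_pos hμ, FreeLieAlgebra.lift_of_apply]
    · rw [seriesA_of_not hμ, map_zero]
      simp only [Mono.OrderLE, not_forall] at hμ
      obtain ⟨k, hk, hk'⟩ := hμ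
      exact (coeff_eq_zero_of_pd (h.A_order k hk) hk').symm
  have hB : ∀ μ, g (seriesB 3 p μ) = coeff μ B := by
    intro μ
    by_cases hμ : μ.OrderLE (p + 3 - 1)
    · rw [seriesB, dif_pos hμ, FreeLieAlgebra.lift_of_apply]
    · rw [seriesB_of_not hμ, map_zero]
      simp only [Mono.OrderLE, not_forall] at hμ
      obtain ⟨k, hk, hk'⟩ := hμ
      exact (coeff_eq_zero_of_pd (h.B_order k (by omega)) hk').symm
  have hg : relIdeal kdv 3 p a ≤ g.ker := LieSubmodule.lieSpan_le.2 fun z hz => by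
    rw [SetLike.mem_coe, LieHom.mem_ker]
    cases hz with
    | zcr γ =>
      rw [map_curvature]
      simp only [hA, hB]
      exact congrArg (coeff γ) h.zcr
    | A_zero μ hμ => rw [hA, h.A_zero μ hμ]
    | B_zero μ hx hμ => rw [hB, h.B_zero μ hx hμ]
    | A_one μ r hr hrp h1 hμ => rw [hA, h.A_one μ r hr hrp h1 hμ]
  refine ⟨{ Submodule.liftQ (relIdeal kdv 3 p a).toSubmodule (g : FreeAlg 3 p →ₗ[ℂ] L)
      (fun _ hz => hg hz) with
    map_lie' := by
      rintro ⟨y⟩ ⟨z⟩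
      exact LieHom.map_lie g y z }, ?_, ?_⟩
  · ext μ
    exact hA μ
  · ext μ
    exact hB μ

theorem hom_ext_gen {L : Type} [LieRing L] [LieAlgebra ℂ L] {f g : FAlg F d p a →ₗ⁅ℂ⁆ L}
    (hA : map f (genA F d p a) = map g (genA F d p a))
    (hB : map f (genB F d p a) = map g (genB F d p a)) : f = g := by
  let K : LieSubalgebra ℂ (FAlg F d p a) :=
    { LinearMap.eqLocus (f : FAlg F d p a →ₗ[ℂ] L) (g : FAlg F d p a →ₗ[ℂ] L) with
      lie_mem' := by
        intro v w hv hw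
        change f v = g v at hv
        change f w = g w at hw
        change f ⁅v, w⁆ = g ⁅v, w⁆
        rw [LieHom.map_lie, LieHom.map_lie, hv, hw] }
  ext y
  exact mem_of_coeff_mem K (fun μ => congrArg (coeff μ) hA) (fun μ => congrArg (coeff μ) hB) y

theorem step_surjective : Function.Surjective (step F d p a) := fun y =>
  mem_of_coeff_mem (step F d p a).range
    (fun μ => ⟨_, step_A F d p a μ⟩) (fun μ => ⟨_, step_B F d p a μ⟩) y

theorem toZero_surjective (F : Fun) (d : ℕ) (a : Point) (p : ℕ) :
    Function.Surjective (toZero F d a p) := by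
  induction p with
  | zero => exact Function.surjective_id
  | succ p ih => exact ih.comp step_surjective

end JetCoord

/-! ### Central kernels of the steps and nilpotency -/

namespace JetCoord

open PSeries

namespace PSeries

variable {L L' : Type} [LieRing L] [LieAlgebra ℂ L] [LieRing L'] [LieAlgebra ℂ L']

theorem map_field (f : L →ₗ⁅ℂ⁆ L') (V : JetCoord → Fun) (a : Point) (n : ℕ) (S : PSeries L) :
    map f (field V a n S) = field V a n (map f S) := by
  simp only [field_apply, map_add, map_sum, map_fun_smul, map_pd]

theorem field_succ_of_pd_eq_zero (V : JetCoord → Fun) (a : Point) (n : ℕ) {S : PSeries L}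
    (h : pd (u (n + 1)) S = 0) : field V a (n + 1) S = field V a n S := by
  rw [field_apply, field_apply, Finset.sum_range_succ, h, smul_zero, add_zero]

namespace IsNormalZCR

variable {a : Point} {p : ℕ} {A B : PSeries L}

theorem map (h : IsNormalZCR a p A B) (f : L →ₗ⁅ℂ⁆ L') :
    IsNormalZCR a p (PSeries.map f A) (PSeries.map f B) where
  A_order k hk := by rw [← map_pd, h.A_order k hk, map_zero]
  B_order k hk := by rw [← map_pd, h.B_order k hk, map_zero]
  zcr := by rw [← map_field, ← map_field, ← LieHom.map_lie, ← map_sub, ← map_add, h.zcr, map_zero]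
  A_zero μ hμ := by rw [coeff_map, h.A_zero μ hμ, map_zero]
  B_zero μ hx hμ := by rw [coeff_map, h.B_zero μ hx hμ, map_zero]
  A_one μ r hr hrp h1 hμ := by rw [coeff_map, h.A_one μ r hr hrp h1 hμ, map_zero]

theorem of_succ (h : IsNormalZCR a (p + 1) A B) (hA : pd (u (p + 1)) A = 0)
    (hB : pd (u (p + 3)) B = 0) : IsNormalZCR a p A B where
  A_order k hk := by
    rcases (show p + 1 = k ∨ p + 1 < k by omega) with rfl | hk'
    exacts [hA, h.A_order k hk']
  B_order k hk := by
    rcases (show p + 3 = k ∨ p + 1 + 2 < k by omega) with rfl | hk'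
    exacts [hB, h.B_order k hk']
  zcr := by
    rw [← field_succ_of_pd_eq_zero _ a p hA, ← field_succ_of_pd_eq_zero _ a (p + 2) hB]
    exact h.zcr
  A_zero := h.A_zero
  B_zero := h.B_zero
  A_one μ r hr hrp := h.A_one μ r hr (by omega)

/-- Exponent 1 of the last variable is excluded by the normal form; for exponents at least 2 the
coefficient is a multiple of one of the central series ∂²A/∂u_{p+1}². -/
theorem lie_coeff_A (h : IsNormalZCR a (p + 1) A B)
    (hS : (pd (u (p + 1)) (pd (u (p + 1)) A)).IsCentral) {μ : Mono} (hμ : μ (u (p + 1)) ≠ 0)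
    (y : L) : ⁅coeff μ A, y⁆ = 0 := by
  by_cases h1 : μ (u (p + 1)) = 1
  · by_cases hord : μ.OrderLE (p + 1)
    · rw [h.A_one μ (p + 1) (by omega) le_rfl h1 hord, zero_lie]
    · simp only [Mono.OrderLE, not_forall] at hord
      obtain ⟨k, hk, hk'⟩ := hord
      rw [coeff_eq_zero_of_pd (h.A_order k hk) hk', zero_lie]
  · have h2 : (μ - Finsupp.single (u (p + 1)) 1 : Mono) (u (p + 1)) ≠ 0 := by
      simp; omega
    rw [coeff_eq_inv_smul A hμ, coeff_eq_inv_smul _ h2, smul_lie, smul_lie, hS, smul_zero,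
      smul_zero]

theorem lie_coeff_B (h : IsNormalZCR a (p + 1) A B)
    (hS : (pd (u (p + 1)) (pd (u (p + 1)) A)).IsCentral) {μ : Mono} (hμ : μ (u (p + 3)) ≠ 0)
    (y : L) : ⁅coeff μ B, y⁆ = 0 := by
  have hB : pd (u (p + 3)) B = pd (u (p + 1)) A := h.pd_B_add_two
  rw [coeff_eq_inv_smul B hμ, hB, coeff_pd, ← Nat.cast_smul_eq_nsmul ℂ, smul_lie, smul_lie,
    h.lie_coeff_A hS, smul_zero, smul_zero]
  simp

end IsNormalZCR

end PSeries

section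

attribute [local instance] LieRing.ofAssociativeRing

/-- The kernel of `𝔽^{p+1} → 𝔽^p` is central. -/
theorem lie_eq_zero_of_step_eq_zero {p : ℕ} {a : Point} {y : FAlg kdv 3 (p + 1) a}
    (hy : step kdv 3 p a y = 0) (z : FAlg kdv 3 (p + 1) a) : ⁅y, z⁆ = 0 := by
  have h := isNormalZCR_gen (p + 1) a
  have hS := h.isCentral_pd_pd_A lie_eq_zero_of_lie_gen
  -- Applying ad annihilates the central coefficients, so the image pair has level p. By
  -- universality ad then factors through the step map, and an element killed by the step acts
  -- trivially.
  have had := h.map (LieAlgebra.ad ℂ (FAlg kdv 3 (p + 1) a))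
  have hA : pd (u (p + 1)) (map (LieAlgebra.ad ℂ _) (genA kdv 3 (p + 1) a)) = 0 := by
    ext μ : 1
    rw [coeff_pd, coeff_map, map_zero, ← Nat.cast_smul_eq_nsmul ℂ]
    ext z
    simp [h.lie_coeff_A hS]
  have hB : pd (u (p + 3)) (map (LieAlgebra.ad ℂ _) (genB kdv 3 (p + 1) a)) = 0 := by
    ext μ : 1
    rw [coeff_pd, coeff_map, map_zero, ← Nat.cast_smul_eq_nsmul ℂ]
    ext z
    simp [h.lie_coeff_B hS]
  obtain ⟨f, hfA, hfB⟩ := exists_hom_of_isNormalZCR (had.of_succ hA hB)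
  have hf : f.comp (step kdv 3 p a) = LieAlgebra.ad ℂ (FAlg kdv 3 (p + 1) a) := by
    apply hom_ext_gen
    · rw [← hfA]
      ext μ : 1
      exact congrArg f (step_A kdv 3 p a μ)
    · rw [← hfB]
      ext μ : 1
      exact congrArg f (step_B kdv 3 p a μ)
  have := LieHom.congr_fun hf y
  rw [LieHom.comp_apply, hy, map_zero] at this
  rw [← LieAlgebra.ad_apply ℂ, ← this, LinearMap.zero_apply]

end

theorem isNilpotent_ker_toZero (a : Point) (p : ℕ) :
    LieRing.IsNilpotent (toZero kdv 3 a p).ker := by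
  induction p with
  | zero =>
    have : Subsingleton (toZero kdv 3 a 0).ker := by
      refine ⟨fun y z => Subtype.ext ?_⟩
      have hy : y.1 = 0 := y.2
      have hz : z.1 = 0 := z.2
      rw [hy, hz]
    infer_instance
  | succ p ih =>
    let g : (toZero kdv 3 a (p + 1)).ker →ₗ⁅ℂ⁆ (toZero kdv 3 a p).ker :=
      { toFun := fun y => ⟨step kdv 3 p a y, y.2⟩
        map_add' := fun y z => Subtype.ext (map_add (step kdv 3 p a) y.1 z.1)
        map_smul' := fun r y => Subtype.ext (map_smul (step kdv 3 p a) r y.1)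
        map_lie' := fun {y z} => Subtype.ext (LieHom.map_lie (step kdv 3 p a) y.1 z.1) }
    -- The kernel at level p + 1 is a central extension of a subalgebra of the kernel at level p.
    refine LieAlgebra.nilpotent_of_nilpotent_quotient (R := ℂ) (I := g.ker) ?_ ?_
    · intro y hy
      rw [LieModule.mem_maxTrivSubmodule]
      intro z
      rw [← lie_skew, neg_eq_zero]
      refine Subtype.ext (lie_eq_zero_of_step_eq_zero ?_ z.1)
      exact congrArg Subtype.val (LieHom.mem_ker.1 hy)
    · have : LieRing.IsNilpotent g.range :=
        Function.Injective.lieAlgebra_isNilpotent (R := ℂ) (f := g.range.incl)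
          Subtype.val_injective
      exact g.quotKerEquivRange.nilpotent_iff_equiv_nilpotent.2 this

end JetCoord

/-! ### The current algebra sl_2(ℂ[λ]) from finitely many relations -/

section CurrentAlgebra

variable {𝔨 : Type} [LieRing 𝔨] [LieAlgebra ℂ 𝔨]

/-- `x, y, z` span a copy of the adjoint representation of the algebra `sl_2` with basis
`e, h, f`. -/
structure IsAdjointTriple (e h f x y z : 𝔨) : Prop where
  ex : ⁅e, x⁆ = 0
  ey : ⁅e, y⁆ = x
  ez : ⁅e, z⁆ = y
  hx : ⁅h, x⁆ = -x
  hy : ⁅h, y⁆ = 0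
  hz : ⁅h, z⁆ = z
  fx : ⁅f, x⁆ = -y
  fy : ⁅f, y⁆ = -z
  fz : ⁅f, z⁆ = 0

namespace IsAdjointTriple

variable {e h f x y z x' y' z' x'' y'' z'' : 𝔨}

/-- The brackets between two copies of the adjoint representation with values in a third one. -/
theorem lie_table (hT : IsAdjointTriple e h f x y z) (hT' : IsAdjointTriple e h f x' y' z')
    (hT'' : IsAdjointTriple e h f x'' y'' z'') (hb : ⁅x, z'⁆ = y'') :
    ⁅x, x'⁆ = 0 ∧ ⁅x, y'⁆ = x'' ∧ ⁅y, x'⁆ = -x'' ∧ ⁅y, y'⁆ = 0 ∧ ⁅y, z'⁆ = z'' ∧ ⁅z, x'⁆ = -y'' ∧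
      ⁅z, y'⁆ = -z'' ∧ ⁅z, z'⁆ = 0 := by
  have h1 := leibniz_lie e x z'
  rw [hb, hT''.ey, hT.ex, zero_lie, zero_add, hT'.ez] at h1
  have h2 := leibniz_lie e x y'
  rw [← h1, hT''.ex, hT.ex, zero_lie, zero_add, hT'.ey] at h2
  have h3 := leibniz_lie f x z'
  rw [hb, hT''.fy, hT.fx, hT'.fz, lie_zero, add_zero, neg_lie, neg_inj] at h3
  have h4 := leibniz_lie f y z'
  rw [← h3, hT''.fz, hT.fy, hT'.fz, lie_zero, add_zero, neg_lie, eq_comm, neg_eq_zero] at h4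
  have h5 := leibniz_lie f x y'
  rw [← h1, hT''.fx, hT.fx, hT'.fy, neg_lie, lie_neg, hb] at h5
  have h6 : ⁅y, y'⁆ = 0 := by
    linear_combination (norm := module) h5
  have h7 := leibniz_lie e y y'
  rw [h6, lie_zero, hT.ey, hT'.ey, ← h1] at h7
  have h8 : ⁅y, x'⁆ = -x'' := by
    linear_combination (norm := module) -h7
  have h9 := leibniz_lie f y x'
  rw [h8, lie_neg, hT''.fx, hT.fy, hT'.fx, neg_lie, lie_neg, h6] at h9
  have h10 := leibniz_lie f y y'
  rw [h6, lie_zero, hT.fy, hT'.fy, neg_lie, lie_neg, ← h3] at h10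
  refine ⟨h2.symm, h1.symm, h8, h6, h3.symm, ?_, ?_, h4⟩
  · linear_combination (norm := module) h9
  · linear_combination (norm := module) h10

/-- If the highest component of the brackets between two copies of the adjoint representation
vanishes, then the symmetric part does. -/
theorem lie_symm (hT : IsAdjointTriple e h f x y z) (hT' : IsAdjointTriple e h f x' y' z')
    (hb : ⁅x, x'⁆ = 0) : ⁅z, x'⁆ + (2 : ℂ) • ⁅y, y'⁆ + ⁅x, z'⁆ = 0 ∧ ⁅z, z'⁆ = 0 := by
  have h1 := leibniz_lie f x x'
  -- The vector x ⊗ x' generates the five-dimensional component of the tensor square under ad f. The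
  -- second power of ad f gives the zero-weight vector, the fourth gives 6[z, z'].
  rw [hb, lie_zero, hT.fx, hT'.fx, neg_lie, lie_neg] at h1
  have h2 := congrArg (fun w => ⁅f, w⁆) h1
  simp only [lie_zero, lie_add, lie_neg, leibniz_lie f, hT.fx, hT'.fx, hT.fy, hT'.fy, neg_lie]
    at h2
  have h3 := congrArg (fun w => ⁅f, w⁆) h2
  simp only [lie_zero, lie_add, lie_neg, leibniz_lie f, hT.fx, hT'.fx, hT.fy, hT'.fy, neg_lie,
    hT.fz, hT'.fz, zero_lie] at h3
  have h4 := congrArg (fun w => ⁅f, w⁆) h3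
  simp only [lie_zero, lie_add, lie_neg, leibniz_lie f, hT.fx, hT'.fx, hT.fy, hT'.fy, neg_lie,
    hT.fz, hT'.fz, zero_lie] at h4
  constructor
  · linear_combination (norm := module) -h2
  · linear_combination (norm := module) (-1 / 6 : ℂ) • h4

end IsAdjointTriple

/-- Elements `e, h, f` that span `sl_2`, and an element `e₁` that satisfies the relations of
`λ e` in `sl_2(ℂ[λ])`. -/
structure IsCurrentData (e h f e₁ h₁ : 𝔨) : Prop where
  eh : ⁅e, h⁆ = e
  ef : ⁅e, f⁆ = h
  hf : ⁅h, f⁆ = f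
  ee₁ : ⁅e, e₁⁆ = 0
  he₁ : ⁅h, e₁⁆ = -e₁
  e₁f : ⁅e₁, f⁆ = h₁
  serre_f : ⁅⁅h₁, f⁆, f⁆ = 0
  serre_e : ⁅e₁, ⁅e₁, h₁⁆⁆ = 0

/-- The elements that correspond to `λ^n e`. -/
def currentE (e h₁ : 𝔨) : ℕ → 𝔨
  | 0 => e
  | n + 1 => ⁅currentE e h₁ n, h₁⁆

/-- The elements that correspond to `λ^n h`. -/
def currentH (e f h₁ : 𝔨) (n : ℕ) : 𝔨 := ⁅currentE e h₁ n, f⁆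

/-- The elements that correspond to `λ^n f`. -/
def currentF (e f h₁ : 𝔨) (n : ℕ) : 𝔨 := ⁅currentH e f h₁ n, f⁆

namespace IsCurrentData

variable {e h f e₁ h₁ : 𝔨} (hd : IsCurrentData e h f e₁ h₁)

include hd

local notation "E" => currentE e h₁
local notation "H" => currentH e f h₁
local notation "F" => currentF e f h₁

theorem H_zero : H 0 = h := hd.ef

theorem F_zero : F 0 = f := by rw [currentF, hd.H_zero, hd.hf]

theorem E_one : E 1 = e₁ := by
  change ⁅e, h₁⁆ = e₁
  rw [← hd.e₁f, leibniz_lie, hd.ee₁, hd.ef, zero_lie, zero_add, ← lie_skew, hd.he₁, neg_neg]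

theorem H_one : H 1 = h₁ := by rw [currentH, hd.E_one, hd.e₁f]

theorem triple_zero : IsAdjointTriple e h f (E 0) (H 0) (F 0) := by
  rw [hd.H_zero, hd.F_zero]
  change IsAdjointTriple e h f e h f
  constructor <;> simp [hd.eh, hd.ef, hd.hf, ← lie_skew h e, ← lie_skew f e, ← lie_skew f h]

theorem triple_of {x : 𝔨} (hx : ⁅e, x⁆ = 0) (hhx : ⁅h, x⁆ = -x) (hz : ⁅⁅⁅x, f⁆, f⁆, f⁆ = 0) :
    IsAdjointTriple e h f x ⁅x, f⁆ ⁅⁅x, f⁆, f⁆ := by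
  have hxh : ⁅x, h⁆ = x := by rw [← lie_skew, hhx, neg_neg]
  have hy : ⁅h, ⁅x, f⁆⁆ = 0 := by
    rw [leibniz_lie, hhx, hd.hf, neg_lie, neg_add_cancel]
  have hyh : ⁅⁅x, f⁆, h⁆ = 0 := by rw [← lie_skew, hy, neg_zero]
  have hey : ⁅e, ⁅x, f⁆⁆ = x := by rw [leibniz_lie, hx, hd.ef, zero_lie, zero_add, hxh]
  refine ⟨hx, hey, ?_, hhx, hy, ?_, ?_, ?_, ?_⟩
  · rw [leibniz_lie, hey, hd.ef, hyh, add_zero]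
  · rw [leibniz_lie, hy, hd.hf, zero_lie, zero_add]
  · rw [lie_skew]
  · rw [lie_skew]
  · rw [← lie_skew, hz, neg_zero]

theorem triple_one : IsAdjointTriple e h f (E 1) (H 1) (F 1) := by
  rw [currentF, currentH, hd.E_one]
  exact hd.triple_of hd.ee₁ hd.he₁ (by rw [hd.e₁f, hd.serre_f])

theorem lie_h₁_E (n : ℕ) : ⁅H 1, E n⁆ = -E (n + 1) := by
  rw [hd.H_one, currentE, lie_skew]

/-- For n = 2 this is the Serre relation. For n ≥ 3, applying ad H_1 to vanishing brackets of degree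
n gives [E_1, E_n] = -[E_2, E_{n-1}] = [E_3, E_{n-2}], while ad H_2 applied to [E_1, E_{n-2}] = 0
gives [E_3, E_{n-2}] = -[E_1, E_n]. -/
theorem lie_E_one_E {n : ℕ} (hn : 1 ≤ n)
    (hT : ∀ k ≤ n, IsAdjointTriple e h f (E k) (H k) (F k))
    (hB : ∀ i j, i + j ≤ n → ⁅E i, F j⁆ = H (i + j)) : ⁅E 1, E n⁆ = 0 := by
  have ht : ∀ i j, i + j ≤ n → _ := fun i j hij =>
    (hT i (by omega)).lie_table (hT j (by omega)) (hT _ hij) (hB i j hij)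
  have h1 : ∀ i j, i + j = n → ⁅E (i + 1), E j⁆ + ⁅E i, E (j + 1)⁆ = 0 := by
    intro i j hij
    have := leibniz_lie (H 1) (E i) (E j)
    rw [(ht i j hij.le).1, lie_zero, hd.lie_h₁_E, hd.lie_h₁_E, neg_lie, lie_neg] at this
    linear_combination (norm := module) this
  rcases (show n = 1 ∨ n = 2 ∨ 3 ≤ n by omega) with rfl | rfl | hn3
  · exact lie_self _
  · change ⁅E 1, ⁅E 1, h₁⁆⁆ = 0
    rw [hd.E_one, hd.serre_e]
  · have h2 := leibniz_lie (H 2) (E 1) (E (n - 2))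
    rw [(ht 1 (n - 2) (by omega)).1, lie_zero, (ht 2 1 (by omega)).2.2.1,
      (ht 2 (n - 2) (by omega)).2.2.1, neg_lie, lie_neg, show 2 + (n - 2) = n by omega,
      show 2 + 1 = 3 from rfl] at h2
    have h3 := h1 1 (n - 1) (by omega)
    have h4 := h1 2 (n - 2) (by omega)
    rw [show n - 1 + 1 = n by omega] at h3
    rw [show n - 2 + 1 = n - 1 by omega] at h4
    simp only [Nat.reduceAdd] at h3 h4
    linear_combination (norm := module) (1 / 2 : ℂ) • h2 + (1 / 2 : ℂ) • h3 - (1 / 2 : ℂ) • h4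

/-- E_{n+1} = [E_n, H_1] is a highest weight vector because [E_n, E_1] = 0. The same vanishing kills
the five-dimensional component of the brackets, in particular [F_n, F_1], and this makes the third
power of ad f vanish on E_{n+1}. -/
theorem triple_succ {n : ℕ} (hn : 1 ≤ n)
    (hT : ∀ k ≤ n, IsAdjointTriple e h f (E k) (H k) (F k))
    (hc : ⁅E 1, E n⁆ = 0) :
    IsAdjointTriple e h f (E (n + 1)) (H (n + 1)) (F (n + 1)) := by
  have hc' : ⁅E n, E 1⁆ = 0 := by rw [← lie_skew, hc, neg_zero]
  have hTn := hT n le_rfl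
  have hT1 := hT 1 hn
  have hE : E (n + 1) = ⁅E n, H 1⁆ := by rw [hd.H_one, currentE]
  refine hd.triple_of ?_ ?_ ?_
  · rw [hE, leibniz_lie, hTn.ex, hT1.ey, zero_lie, zero_add, hc']
  · rw [hE, leibniz_lie, hTn.hx, hT1.hy, lie_zero, add_zero, neg_lie]
  · have hff := (hTn.lie_symm hT1 hc').2
    have h1 : ⁅⁅⁅E n, H 1⁆, f⁆, f⁆ = ⁅F n, H 1⁆ + (2 : ℂ) • ⁅H n, F 1⁆ := by
      rw [← lie_skew ⁅E n, H 1⁆ f, leibniz_lie f (E n), hTn.fx, hT1.fy, ← lie_skew _ f, lie_neg,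
        lie_add, neg_lie, lie_neg, lie_neg, lie_neg, leibniz_lie f (H n), leibniz_lie f (E n),
        hTn.fx, hT1.fz, hTn.fy, hT1.fy]
      simp only [neg_lie, lie_neg, lie_zero]
      module
    rw [hE, h1, ← lie_skew, lie_add, lie_smul, leibniz_lie f (F n), leibniz_lie f (H n), hTn.fz,
      hTn.fy, hT1.fy, hT1.fz, zero_lie, lie_neg, neg_lie, lie_zero, hff]
    simp

/-- Shifting degree from E to F with ad H_1 yields [E_i, F_j] = H_{n+1} + j[H_1, H_n]. Inserting
this into the zero-weight relation of `lie_symm` gives (n + 1)[H_1, H_n] = 0. -/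
theorem lie_E_F_succ {n : ℕ} (hn : 1 ≤ n)
    (hT : ∀ k ≤ n, IsAdjointTriple e h f (E k) (H k) (F k))
    (hB : ∀ i j, i + j ≤ n → ⁅E i, F j⁆ = H (i + j)) (hc : ⁅E 1, E n⁆ = 0) (j : ℕ) :
    ∀ i, 1 ≤ i → i + j = n + 1 → ⁅E i, F j⁆ = H (n + 1) := by
  have hT0 := hd.triple_zero
  have key : ∀ j i, 1 ≤ i → i + j = n + 1 →
      ⁅E i, F j⁆ = H (n + 1) + (j : ℂ) • ⁅H 1, H n⁆ := by
    intro j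
    induction j with
    | zero =>
      intro i hi hij
      obtain rfl : i = n + 1 := by omega
      rw [hd.F_zero, currentH]
      simp
    | succ j ih =>
      intro i hi hij
      have h1 := leibniz_lie (H 1) (E i) (F j)
      have h2 := ((hT 1 hn).lie_table (hT j (by omega)) (hT (1 + j) (by omega))
        (hB 1 j (by omega))).2.2.2.2.1
      rw [hB i j (by omega), hd.lie_h₁_E, h2, neg_lie, ih (i + 1) (by omega) (by omega),
        show i + j = n by omega, add_comm 1 j] at h1
      push_cast
      linear_combination (norm := module) -h1
  have hs := ((hT 1 hn).lie_symm (hT n le_rfl) hc).1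
  rw [key n 1 le_rfl (by omega), ← lie_skew, key 1 n hn rfl] at hs
  have hz : ((n : ℂ) + 1) • ⁅H 1, H n⁆ = 0 := by
    push_cast at hs
    linear_combination (norm := module) hs
  have hz' := (smul_eq_zero.1 hz).resolve_left (by exact_mod_cast Nat.succ_ne_zero n)
  intro i hi hij
  rw [key j i hi hij, hz', smul_zero, add_zero]

theorem triple_and_lie_E_F (n : ℕ) : (∀ k ≤ n, IsAdjointTriple e h f (E k) (H k) (F k)) ∧
    ∀ i j, i + j ≤ n → ⁅E i, F j⁆ = H (i + j) := by
  have hT0 := hd.triple_zero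
  induction n with
  | zero =>
    refine ⟨fun k hk => by rwa [Nat.le_zero.1 hk], fun i j hij => ?_⟩
    obtain ⟨rfl, rfl⟩ : i = 0 ∧ j = 0 := by omega
    exact hT0.ez
  | succ n ih =>
    have hstep : IsAdjointTriple e h f (E (n + 1)) (H (n + 1)) (F (n + 1)) ∧
        ∀ j i, 1 ≤ i → i + j = n + 1 → ⁅E i, F j⁆ = H (n + 1) := by
      rcases Nat.eq_zero_or_pos n with rfl | hn
      · refine ⟨hd.triple_one, fun j i hi hij => ?_⟩
        obtain ⟨rfl, rfl⟩ : i = 1 ∧ j = 0 := by omega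
        rw [hd.F_zero, currentH]
      · have hc := hd.lie_E_one_E hn ih.1 ih.2
        exact ⟨hd.triple_succ hn ih.1 hc, hd.lie_E_F_succ hn ih.1 ih.2 hc⟩
    refine ⟨fun k hk => ?_, fun i j hij => ?_⟩
    · rcases (show k ≤ n ∨ k = n + 1 by omega) with hk' | rfl
      exacts [ih.1 k hk', hstep.1]
    · rcases (show i + j ≤ n ∨ i + j = n + 1 by omega) with hk' | hk'
      · exact ih.2 i j hk'
      · rw [hk']
        rcases Nat.eq_zero_or_pos i with rfl | hi
        · obtain rfl : j = n + 1 := by omega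
          exact hstep.1.ez
        · exact hstep.2 j i hi hk'

theorem triple (n : ℕ) : IsAdjointTriple e h f (E n) (H n) (F n) :=
  (hd.triple_and_lie_E_F n).1 n le_rfl

/-- The multiplication table of `sl_2(ℂ[λ])`. -/
theorem lie_table (i j : ℕ) : ⁅E i, E j⁆ = 0 ∧ ⁅E i, H j⁆ = E (i + j) ∧ ⁅H i, E j⁆ = -E (i + j) ∧
    ⁅H i, H j⁆ = 0 ∧ ⁅H i, F j⁆ = F (i + j) ∧ ⁅F i, E j⁆ = -H (i + j) ∧
      ⁅F i, H j⁆ = -F (i + j) ∧ ⁅F i, F j⁆ = 0 :=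
  (hd.triple i).lie_table (hd.triple j) (hd.triple _)
    ((hd.triple_and_lie_E_F (i + j)).2 i j le_rfl)

theorem lie_E_F (i j : ℕ) : ⁅E i, F j⁆ = H (i + j) :=
  (hd.triple_and_lie_E_F (i + j)).2 i j le_rfl

end IsCurrentData

end CurrentAlgebra

/-! ### Consequences of [R, R_x] = R along a KdV-type flow -/

section KdVFlow

variable {𝔨 : Type} [LieRing 𝔨] [LieAlgebra ℂ 𝔨]

theorem lie_weight_add {h y z : 𝔨} {m n : ℂ} (hy : ⁅h, y⁆ = m • y) (hz : ⁅h, z⁆ = n • z) :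
    ⁅h, ⁅y, z⁆⁆ = (m + n) • ⁅y, z⁆ := by
  rw [leibniz_lie, hy, hz, smul_lie, lie_smul, add_smul]

theorem weight_components_eq_zero {h y₁ y₂ y₃ y₄ : 𝔨} (h₁ : ⁅h, y₁⁆ = (3 : ℂ) • y₁)
    (h₂ : ⁅h, y₂⁆ = (1 : ℂ) • y₂) (h₃ : ⁅h, y₃⁆ = (-1 : ℂ) • y₃) (h₄ : ⁅h, y₄⁆ = (-3 : ℂ) • y₄)
    (hs : y₁ + y₂ + y₃ + y₄ = 0) : y₁ = 0 ∧ y₃ = 0 := by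
  have s1 := congrArg (fun y => ⁅h, y⁆) hs
  simp only [lie_add, h₁, h₂, h₃, h₄, lie_zero] at s1
  have s2 := congrArg (fun y => ⁅h, y⁆) s1
  simp only [lie_add, lie_smul, h₁, h₂, h₃, h₄, lie_zero] at s2
  have s3 := congrArg (fun y => ⁅h, y⁆) s2
  simp only [lie_add, lie_smul, h₁, h₂, h₃, h₄, lie_zero] at s3
  constructor
  -- The coefficients are those of the Lagrange polynomials for the eigenvalues 3, 1, -1, -3:
  -- (h-1)(h+1)(h+3)/48 projects to weight 3, and (h-3)(h-1)(h+3)/16 projects to weight -1.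
  · linear_combination (norm := module)
      (1 / 48 : ℂ) • s3 + (3 / 48 : ℂ) • s2 - (1 / 48 : ℂ) • s1 - (3 / 48 : ℂ) • hs
  · linear_combination (norm := module)
      (1 / 16 : ℂ) • s3 - (1 / 16 : ℂ) • s2 - (9 / 16 : ℂ) • s1 + (9 / 16 : ℂ) • hs

/-- The single relation `hrel` contains both Serre relations: its ad h-components of weights 3 and
-1 vanish separately, and applying ad e to them leaves multiples of [[h₁, f], f] and [e₁, [e₁, h₁]].
-/
theorem isCurrentData_of_relation {e h f e₁ h₁ r₄ r₅ : 𝔨} (eh : ⁅e, h⁆ = e) (ef : ⁅e, f⁆ = h)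
    (hf : ⁅h, f⁆ = f) (ee₁ : ⁅e, e₁⁆ = 0) (he₁ : ⁅h, e₁⁆ = -e₁) (e₁f : ⁅e₁, f⁆ = h₁)
    (hr₄ : r₄ = ⁅(1 / 2 : ℂ) • e₁ - f, h₁⁆) (hr₅ : r₅ = ⁅(1 / 2 : ℂ) • e₁ - f, r₄⁆)
    (hrel : ⁅f + (1 / 2 : ℂ) • e₁, r₅⁆ + ⁅h₁, r₄⁆ = 0) : IsCurrentData e h f e₁ h₁ := by
  have fe₁ : ⁅f, e₁⁆ = -h₁ := by rw [← lie_skew, e₁f]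
  have w_f : ⁅h, f⁆ = (1 : ℂ) • f := by rw [hf, one_smul]
  have w_e₁ : ⁅h, e₁⁆ = (-1 : ℂ) • e₁ := by rw [he₁, neg_one_smul]
  have w_h₁ : ⁅h, h₁⁆ = (0 : ℂ) • h₁ := by
    rw [← e₁f, lie_weight_add w_e₁ w_f]; norm_num
  have eh₁ : ⁅e, h₁⁆ = e₁ := by
    rw [← e₁f, leibniz_lie, ee₁, ef, zero_lie, zero_add, ← lie_skew, he₁, neg_neg]
  obtain ⟨f₁, hf₁⟩ : ∃ f₁, ⁅h₁, f⁆ = f₁ := ⟨_, rfl⟩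
  obtain ⟨w, hw⟩ : ∃ w, ⁅e₁, h₁⁆ = w := ⟨_, rfl⟩
  obtain ⟨v, hv⟩ : ∃ v, ⁅f₁, f⁆ = v := ⟨_, rfl⟩
  obtain ⟨p, hp⟩ : ∃ p, ⁅e₁, f₁⁆ = p := ⟨_, rfl⟩
  obtain ⟨q, hq⟩ : ∃ q, ⁅e₁, w⁆ = q := ⟨_, rfl⟩
  have w_f₁ : ⁅h, f₁⁆ = (1 : ℂ) • f₁ := by
    rw [← hf₁, lie_weight_add w_h₁ w_f]; norm_num
  have w_w : ⁅h, w⁆ = (-1 : ℂ) • w := by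
    rw [← hw, lie_weight_add w_e₁ w_h₁]; norm_num
  have w_v : ⁅h, v⁆ = (2 : ℂ) • v := by
    rw [← hv, lie_weight_add w_f₁ w_f]; norm_num
  have w_p : ⁅h, p⁆ = (0 : ℂ) • p := by
    rw [← hp, lie_weight_add w_e₁ w_f₁]; norm_num
  have w_q : ⁅h, q⁆ = (-2 : ℂ) • q := by
    rw [← hq, lie_weight_add w_e₁ w_w]; norm_num
  have fh₁ : ⁅f, h₁⁆ = -f₁ := by rw [← lie_skew, hf₁]
  have ff₁ : ⁅f, f₁⁆ = -v := by rw [← lie_skew, hv]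
  have fw : ⁅f, w⁆ = -p := by
    rw [← hw, leibniz_lie, fe₁, fh₁, neg_lie, lie_self, neg_zero, zero_add, lie_neg, hp]
  have h4 : r₄ = f₁ + (1 / 2 : ℂ) • w := by
    rw [hr₄, sub_lie, smul_lie, fh₁, hw]; module
  have h5 : r₅ = v + p + (1 / 4 : ℂ) • q := by
    rw [hr₅, h4, sub_lie, smul_lie, lie_add, lie_add, lie_smul, lie_smul, hp, hq, ff₁, fw]; module
  have fq : ⁅f, q⁆ = -⁅h₁, w⁆ - ⁅e₁, p⁆ := by
    rw [← hq, leibniz_lie, fe₁, fw, neg_lie, lie_neg, sub_eq_add_neg]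
  have hsum : ⁅f, v⁆ + (⁅f, p⁆ + (1 / 2 : ℂ) • ⁅e₁, v⁆ + ⁅h₁, f₁⁆)
      + ((1 / 4 : ℂ) • (⁅h₁, w⁆ + ⁅e₁, p⁆)) + (1 / 8 : ℂ) • ⁅e₁, q⁆ = 0 := by
    rw [h4, h5, add_lie, smul_lie] at hrel
    simp only [lie_add, lie_smul, fq] at hrel
    linear_combination (norm := module) hrel
  obtain ⟨hv0, hq0⟩ := weight_components_eq_zero (h := h)
    (by rw [lie_weight_add w_f w_v]; norm_num)
    (by
      rw [lie_add, lie_add, lie_smul, lie_weight_add w_f w_p, lie_weight_add w_e₁ w_v,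
        lie_weight_add w_h₁ w_f₁]
      module)
    (by
      rw [lie_smul, lie_add, lie_weight_add w_h₁ w_w, lie_weight_add w_e₁ w_p]
      module)
    (by rw [lie_smul, lie_weight_add w_e₁ w_q]; module) hsum
  have ef₁ : ⁅e, f₁⁆ = h₁ := by
    rw [← hf₁, leibniz_lie, eh₁, ef, e₁f, ← lie_skew, w_h₁, zero_smul, neg_zero, add_zero]
  have ev : ⁅e, v⁆ = 0 := by
    rw [← hv, leibniz_lie, ef₁, ef, hf₁, ← lie_skew f₁ h, w_f₁]; module
  have hv' : (2 : ℂ) • v = 0 := by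
    have := leibniz_lie e f v
    rwa [hv0, lie_zero, ef, ev, lie_zero, add_zero, w_v, eq_comm] at this
  have ew : ⁅e, w⁆ = 0 := by
    rw [← hw, leibniz_lie, ee₁, eh₁, zero_lie, lie_self, add_zero]
  have ep : ⁅e, p⁆ = w := by
    rw [← hp, leibniz_lie, ee₁, ef₁, zero_lie, zero_add, hw]
  have hq' : (1 / 2 : ℂ) • q = 0 := by
    have := congrArg (fun y => ⁅e, y⁆) hq0
    simp only [lie_smul, lie_add, lie_zero, leibniz_lie e, eh₁, ew, ee₁, ep, zero_lie, hq] at this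
    rw [← this]
    module
  refine ⟨eh, ef, hf, ee₁, he₁, e₁f, ?_, ?_⟩
  · rw [hf₁, hv]
    exact (smul_eq_zero.1 hv').resolve_left (by norm_num)
  · rw [hw, hq]
    exact (smul_eq_zero.1 hq').resolve_left (by norm_num)

/-- A sequence `r, r_x, r_{xx}, …` with `[r, r_x] = r` and
`r_t = r_{xxx} + a r_x + [r, b] + κ`, where `b` does not depend on `x` and `κ` is central. -/
structure IsKdVFlow (D T : 𝔨 →ₗ[ℂ] 𝔨) (R : ℕ → 𝔨) (b κ : 𝔨) (a : ℂ) : Prop where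
  D_lie : ∀ y z : 𝔨, D ⁅y, z⁆ = ⁅D y, z⁆ + ⁅y, D z⁆
  T_lie : ∀ y z : 𝔨, T ⁅y, z⁆ = ⁅T y, z⁆ + ⁅y, T z⁆
  T_D : ∀ y, T (D y) = D (T y)
  D_R : ∀ k, D (R k) = R (k + 1)
  lie_R : ⁅R 0, R 1⁆ = R 0
  T_R : T (R 0) = R 3 + a • R 1 + ⁅R 0, b⁆ + κ
  D_b : D b = 0
  lie_κ : ∀ y : 𝔨, ⁅y, κ⁆ = 0

namespace IsKdVFlow

variable {D T : 𝔨 →ₗ[ℂ] 𝔨} {R : ℕ → 𝔨} {b κ : 𝔨} {a : ℂ} (hk : IsKdVFlow D T R b κ a)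

include hk

theorem lie_R_two : ⁅R 0, R 2⁆ = R 1 := by
  have := congrArg D hk.lie_R
  rwa [hk.D_lie, hk.D_R, hk.D_R, lie_self, zero_add] at this

theorem lie_R_three : ⁅R 0, R 3⁆ + ⁅R 1, R 2⁆ = R 2 := by
  have := congrArg D hk.lie_R_two
  rw [hk.D_lie, hk.D_R, hk.D_R, hk.D_R] at this
  exact (add_comm _ _).trans this

theorem lie_R_four : ⁅R 0, R 4⁆ + (2 : ℂ) • ⁅R 1, R 3⁆ = R 3 := by
  have := congrArg D hk.lie_R_three
  rw [map_add, hk.D_lie, hk.D_lie, hk.D_R, hk.D_R, hk.D_R, hk.D_R, lie_self] at this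
  linear_combination (norm := module) this

theorem lie_D_κ (y : 𝔨) : ⁅y, D κ⁆ = 0 := by
  have := congrArg D (hk.lie_κ y)
  rwa [hk.D_lie, hk.lie_κ, zero_add, map_zero] at this

theorem T_R_succ (k : ℕ) : T (R k) = R (k + 3) + a • R (k + 1) + ⁅R k, b⁆ + D^[k] κ := by
  induction k with
  | zero => exact hk.T_R
  | succ k ih =>
    rw [← hk.D_R, hk.T_D, ih, Function.iterate_succ_apply']
    simp only [map_add, map_smul, hk.D_lie, hk.D_R, hk.D_b, lie_zero, add_zero]

/-- Compare T[R_0, R_1] = T R_0 with the evolution law. The terms with b cancel by the Jacobi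
identity, those with a by [R_0, R_2] = R_1, and [R_0, R_4] is eliminated by the third x-derivative
of [R_0, R_1] = R_0. -/
theorem lie_R_one_three : (3 : ℂ) • ⁅R 1, R 3⁆ = -κ := by
  have h1 := congrArg T hk.lie_R
  rw [hk.T_lie, hk.T_R, hk.T_R_succ 1] at h1
  simp only [add_lie, lie_add, smul_lie, lie_smul, Function.iterate_one, hk.lie_D_κ, lie_self,
    Nat.reduceAdd, hk.lie_R_two] at h1
  rw [← lie_skew κ, hk.lie_κ, leibniz_lie (R 0) (R 1) b, hk.lie_R, ← lie_skew (R 3) (R 1),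
    ← lie_skew ⁅R 0, b⁆ (R 1)] at h1
  linear_combination (norm := module) -h1 + hk.lie_R_four

theorem lie_R_one_three_central (y : 𝔨) : ⁅y, ⁅R 1, R 3⁆⁆ = 0 := by
  have := hk.lie_κ y
  rw [← neg_neg κ, ← hk.lie_R_one_three, lie_neg, lie_smul, neg_eq_zero] at this
  exact (smul_eq_zero.1 this).resolve_left (by norm_num)

theorem lie_R_one_lie : ⁅R 1, ⁅R 0, R 3⁆⁆ = -⁅R 0, R 3⁆ := by
  rw [leibniz_lie, hk.lie_R_one_three_central, add_zero, ← lie_skew (R 1), hk.lie_R, neg_lie]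

theorem lie_R_one_two : ⁅R 1, R 2⁆ = R 2 - ⁅R 0, R 3⁆ :=
  eq_sub_of_add_eq' hk.lie_R_three

theorem lie_R_zero_lie : ⁅R 0, ⁅R 0, R 3⁆⁆ = 0 := by
  have := leibniz_lie (R 1) (R 0) (R 2)
  rw [hk.lie_R_two, lie_self, ← lie_skew (R 1) (R 0), hk.lie_R, neg_lie, hk.lie_R_two,
    hk.lie_R_one_two, lie_sub, hk.lie_R_two] at this
  linear_combination (norm := module) this

theorem D_lie_R : D ⁅R 0, R 3⁆ = R 3 - ⁅R 1, R 3⁆ := by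
  rw [hk.D_lie, hk.D_R, hk.D_R]
  linear_combination (norm := module) hk.lie_R_four

theorem lie_lie_R_two : ⁅⁅R 0, R 3⁆, R 2⁆ = R 3 := by
  have := congrArg D hk.lie_R_one_lie
  rw [hk.D_lie, map_neg, hk.D_lie_R, lie_sub, hk.lie_R_one_three_central, hk.D_R,
    ← lie_skew] at this
  linear_combination (norm := module) -this

/-- Apply ad R_1, a derivation, to [[R_0, R_3], R_2] = R_3. It acts on [R_0, R_3] as -1 and sends
R_2 to R_2 - [R_0, R_3], so the right-hand side becomes -R_3 + R_3. -/
theorem lie_R_one_three_eq_zero : ⁅R 1, R 3⁆ = 0 := by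
  have := leibniz_lie (R 1) ⁅R 0, R 3⁆ (R 2)
  rw [hk.lie_lie_R_two, hk.lie_R_one_lie, hk.lie_R_one_two, neg_lie, lie_sub, hk.lie_lie_R_two,
    lie_self] at this
  rw [this]
  abel

theorem κ_eq_zero : κ = 0 := by
  have := hk.lie_R_one_three
  rwa [hk.lie_R_one_three_eq_zero, smul_zero, eq_comm, neg_eq_zero] at this

theorem D_lie_R' : D ⁅R 0, R 3⁆ = R 3 := by
  rw [hk.D_lie_R, hk.lie_R_one_three_eq_zero, sub_zero]

theorem R_four : R 4 = ⁅⁅R 0, R 3⁆ - R 2, R 3⁆ := by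
  have := congrArg D hk.lie_lie_R_two
  rw [hk.D_lie, hk.D_lie_R', hk.D_R, hk.D_R, ← lie_skew] at this
  rw [sub_lie, ← this]
  abel

theorem R_five : R 5 = ⁅⁅R 0, R 3⁆ - R 2, R 4⁆ := by
  have := congrArg D hk.R_four
  rw [hk.D_lie, map_sub, hk.D_lie_R', hk.D_R, hk.D_R, hk.D_R] at this
  rw [this]
  simp

/-- The T-derivative and the third D-derivative of [R_1, R_3] = 0 share [R_1, R_6]. Their difference
is three times the asserted sum, plus a multiple of the first D-derivative. -/
theorem lie_R_two_five : ⁅R 2, R 5⁆ + ⁅R 3, R 4⁆ = 0 := by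
  have h0 := hk.lie_R_one_three_eq_zero
  have d1 := congrArg D h0
  rw [hk.D_lie, hk.D_R, hk.D_R, map_zero] at d1
  have d2 := congrArg D d1
  simp only [map_add, hk.D_lie, hk.D_R, map_zero, lie_self, Nat.reduceAdd] at d2
  have d3 := congrArg D d2
  simp only [map_add, hk.D_lie, hk.D_R, map_zero, Nat.reduceAdd] at d3
  have h1 := congrArg T h0
  have hκ : ∀ k, D^[k] κ = 0 := fun k => by
    rw [hk.κ_eq_zero]
    exact iterate_map_zero D k
  rw [hk.T_lie, hk.T_R_succ 1, hk.T_R_succ 3, hκ, hκ, map_zero] at h1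
  simp only [add_lie, lie_add, smul_lie, lie_smul, lie_zero, zero_lie, Nat.reduceAdd] at h1
  rw [leibniz_lie (R 1) (R 3) b, h0, zero_lie, ← lie_skew ⁅R 1, b⁆ (R 3),
    ← lie_skew (R 4) (R 3)] at h1
  linear_combination (norm := module) (1 / 3 : ℂ) • d3 - (1 / 3 : ℂ) • h1 + (a / 3) • d1

/-- R_2 is not of weight 1 for ad R_1; subtracting half of the weight -1 element [R_0, R_3] makes it
so. In terms of the resulting basis D acts as ad(½λe - f), which supplies the expressions for R_4
and R_5. -/
theorem isCurrentData : IsCurrentData (R 0) (R 1) (R 2 - (1 / 2 : ℂ) • ⁅R 0, R 3⁆) ⁅R 0, R 3⁆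
    (R 3) := by
  have hX : (1 / 2 : ℂ) • ⁅R 0, R 3⁆ - (R 2 - (1 / 2 : ℂ) • ⁅R 0, R 3⁆) = ⁅R 0, R 3⁆ - R 2 := by
    module
  refine isCurrentData_of_relation (r₄ := R 4) (r₅ := R 5) hk.lie_R ?_ ?_ hk.lie_R_zero_lie
    hk.lie_R_one_lie ?_ ?_ ?_ ?_
  · rw [lie_sub, lie_smul, hk.lie_R_two, hk.lie_R_zero_lie, smul_zero, sub_zero]
  · rw [lie_sub, lie_smul, hk.lie_R_one_two, hk.lie_R_one_lie]
    module
  · rw [lie_sub, lie_smul, lie_self, smul_zero, sub_zero, hk.lie_lie_R_two]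
  · rw [hX, hk.R_four]
  · rw [hX, hk.R_five]
  · rw [sub_add_cancel, hk.lie_R_two_five]

/-- All the `R k` are combinations of the elements that correspond to
`λ^n e`, `λ^n h` and `λ^n f`. -/
theorem R_mem {K : Submodule ℂ 𝔨}
    (hE : ∀ n, currentE (R 0) (R 3) n ∈ K)
    (hH : ∀ n, currentH (R 0) (R 2 - (1 / 2 : ℂ) • ⁅R 0, R 3⁆) (R 3) n ∈ K)
    (hF : ∀ n, currentF (R 0) (R 2 - (1 / 2 : ℂ) • ⁅R 0, R 3⁆) (R 3) n ∈ K) (k : ℕ) :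
    R k ∈ K := by
  have hd := hk.isCurrentData
  set f := R 2 - (1 / 2 : ℂ) • ⁅R 0, R 3⁆ with hf
  have hDf : D f = ⁅⁅R 0, R 3⁆ - R 2, f⁆ := by
    have hX : ⁅R 0, R 3⁆ - R 2 = (1 / 2 : ℂ) • ⁅R 0, R 3⁆ - f := by rw [hf]; module
    rw [hX, sub_lie, smul_lie, lie_self, hd.e₁f, hf, map_sub, map_smul, hk.D_lie_R', hk.D_R]
    module
  -- On all the currents D coincides with the inner derivation by ½λe - f, so their span is stable
  -- under D and contains every R_k together with R_0.
  have hDE : ∀ n, D (currentE (R 0) (R 3) n) = ⁅⁅R 0, R 3⁆ - R 2, currentE (R 0) (R 3) n⁆ := by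
    intro n
    induction n with
    | zero =>
      rw [currentE, hk.D_R, sub_lie, ← lie_skew, hk.lie_R_zero_lie, ← lie_skew, hk.lie_R_two]
      simp
    | succ n ih =>
      rw [currentE, hk.D_lie, ih, hk.D_R, hk.R_four, leibniz_lie (⁅R 0, R 3⁆ - R 2)]
  have hDH : ∀ n, D (currentH (R 0) f (R 3) n)
      = ⁅⁅R 0, R 3⁆ - R 2, currentH (R 0) f (R 3) n⁆ := by
    intro n
    rw [currentH, hk.D_lie, hDE, hDf, leibniz_lie (⁅R 0, R 3⁆ - R 2)]
  have hDF : ∀ n, D (currentF (R 0) f (R 3) n)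
      = ⁅⁅R 0, R 3⁆ - R 2, currentF (R 0) f (R 3) n⁆ := by
    intro n
    rw [currentF, hk.D_lie, hDH, hDf, leibniz_lie (⁅R 0, R 3⁆ - R 2)]
  have hX : ⁅R 0, R 3⁆ - R 2 = (1 / 2 : ℂ) • currentE (R 0) (R 3) 1
      - currentF (R 0) f (R 3) 0 := by
    rw [hd.E_one, hd.F_zero, hf]
    module
  let S : Submodule ℂ 𝔨 := Submodule.span ℂ (Set.range (currentE (R 0) (R 3)) ∪
    (Set.range (currentH (R 0) f (R 3)) ∪ Set.range (currentF (R 0) f (R 3))))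
  have sE : ∀ n, currentE (R 0) (R 3) n ∈ S := fun n => Submodule.subset_span (Or.inl ⟨n, rfl⟩)
  have sH : ∀ n, currentH (R 0) f (R 3) n ∈ S :=
    fun n => Submodule.subset_span (Or.inr (Or.inl ⟨n, rfl⟩))
  have sF : ∀ n, currentF (R 0) f (R 3) n ∈ S :=
    fun n => Submodule.subset_span (Or.inr (Or.inr ⟨n, rfl⟩))
  have hDS : S ≤ S.comap D := by
    refine Submodule.span_le.2 ?_
    rintro _ (⟨n, rfl⟩ | ⟨n, rfl⟩ | ⟨n, rfl⟩)
    · rw [SetLike.mem_coe, Submodule.mem_comap, hDE, hX, sub_lie, smul_lie,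
        (hd.lie_table 1 n).1, (hd.lie_table 0 n).2.2.2.2.2.1, smul_zero, zero_sub, neg_neg]
      exact sH _
    · rw [SetLike.mem_coe, Submodule.mem_comap, hDH, hX, sub_lie, smul_lie,
        (hd.lie_table 1 n).2.1, (hd.lie_table 0 n).2.2.2.2.2.2.1, sub_neg_eq_add]
      exact S.add_mem (S.smul_mem _ (sE _)) (sF _)
    · rw [SetLike.mem_coe, Submodule.mem_comap, hDF, hX, sub_lie, smul_lie,
        hd.lie_E_F, (hd.lie_table 0 n).2.2.2.2.2.2.2, sub_zero]
      exact S.smul_mem _ (sH _)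
  have hR : R k ∈ S := by
    induction k with
    | zero => exact sE 0
    | succ k ih =>
      rw [← hk.D_R]
      exact hDS ih
  refine (Submodule.span_le.2 ?_ : S ≤ K) hR
  rintro _ (⟨n, rfl⟩ | ⟨n, rfl⟩ | ⟨n, rfl⟩)
  exacts [hE n, hH n, hF n]

end IsKdVFlow

end KdVFlow

/-! ### Level 0: the form of A and the derivatives of B -/

namespace JetCoord

open Finset.HasAntidiagonal
open MvPolynomial (pderiv)

namespace PSeries

variable {L L' : Type} [LieRing L] [LieAlgebra ℂ L] [LieRing L'] [LieAlgebra ℂ L']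

theorem coeff_X_smul_eq_zero {c : JetCoord} {μ : Mono} (hμ : μ c = 0) (S : PSeries L) :
    coeff μ ((MvPolynomial.X c : Fun) • S) = 0 := by
  rw [coeff_fun_smul]
  refine Finset.sum_eq_zero ?_
  rintro ⟨q, q'⟩ hq
  rw [mem_antidiagonal] at hq
  dsimp only
  rw [MvPolynomial.coeff_X, if_neg, zero_smul]
  rintro rfl
  rw [← hq] at hμ
  simp at hμ

theorem field_smul (V : JetCoord → Fun) (a : Point) (n : ℕ) (g : Fun) (S : PSeries L) :
    field V a n (g • S) = (taylorAt a (V x) * pderiv x g + taylorAt a (V t) * pderiv t g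
      + ∑ k ∈ Finset.range (n + 1), taylorAt a (V (u k)) * pderiv (u k) g) • S
      + g • field V a n S := by
  simp only [field_apply, pd_smul, smul_add, add_smul, Finset.sum_add_distrib, Finset.sum_smul,
    Finset.smul_sum, mul_smul, smul_comm g]
  abel

/-- The coefficient of `(u_0 - a_0)^2` in `A`. -/
noncomputable def quadCoeff (A : PSeries L) : PSeries L := (1 / 2 : ℂ) • pd (u 0) (pd (u 0) A)

/-- The coefficient of `u_0 - a_0` in `A`. -/
noncomputable def linCoeff (A : PSeries L) : PSeries L :=
  pd (u 0) A - (2 : ℕ) • (MvPolynomial.X (u 0) : Fun) • quadCoeff A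

namespace IsNormalZCR

variable {a : Point} {A B : PSeries L} (h : IsNormalZCR a 0 A B)

local notation "v" => (MvPolynomial.X (u 0) : Fun)
local notation "P" => linCoeff A
local notation "Q" => quadCoeff A
local notation "P₁" => pd x (linCoeff A)
local notation "P₂" => pd x (pd x (linCoeff A))
local notation "P₃" => pd x (pd x (pd x (linCoeff A)))
local notation "U" k:max => taylorAt a (MvPolynomial.X (u k))

section

include h

theorem noU_quadCoeff : (Q).NoU := h.noU_pd_pd_A.smul _

theorem pd_x_quadCoeff : pd x Q = 0 := by
  rw [quadCoeff, map_smul, h.pd_x_pd_pd_A, smul_zero]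

omit h in
theorem pd_pd_A : pd (u 0) (pd (u 0) A) = (2 : ℕ) • Q := by
  rw [quadCoeff]; module

omit h in
theorem pd_A : pd (u 0) A = P + (2 : ℕ) • v • Q := by
  rw [linCoeff, sub_add_cancel]

theorem noU_linCoeff : (P).NoU := by
  intro k
  rw [linCoeff, map_sub, map_nsmul, pd_smul, h.noU_quadCoeff k, smul_zero, add_zero]
  cases k with
  | zero => rw [pd_pd_A, MvPolynomial.pderiv_X_self, one_smul, sub_self]
  | succ k =>
    rw [pd_comm, h.A_order (k + 1) (by omega), map_zero, MvPolynomial.pderiv_X_of_ne (by simp),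
      zero_smul, smul_zero, sub_zero]

theorem A_eq : A = v • P + v • v • Q := by
  rw [← sub_eq_zero]
  refine NoU.eq_zero (fun k => ?_) fun μ hμ => ?_
  · rw [map_sub, map_add, pd_smul, pd_smul, pd_smul, h.noU_linCoeff k, h.noU_quadCoeff k]
    cases k with
    | zero => rw [pd_A, MvPolynomial.pderiv_X_self]; module
    | succ k => rw [h.A_order (k + 1) (by omega), MvPolynomial.pderiv_X_of_ne (by simp)]; module
  · rw [map_sub, map_add, h.A_zero μ hμ, coeff_X_smul_eq_zero (hμ 0), coeff_X_smul_eq_zero (hμ 0)]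
    simp

theorem pd_one_A : pd (u 1) A = 0 := h.A_order 1 (by omega)

theorem pd_two_B : pd (u 2) B = P + (2 : ℕ) • v • Q := by
  rw [← pd_A]; exact h.pd_B_add_two

end

theorem field_totalX_v_smul {S : PSeries L} (hS : S.NoU) :
    field totalX a 2 (v • S) = U 1 • S + v • pd x S := by
  rw [field_smul, hS.field_totalX]
  simp [totalX, MvPolynomial.pderiv_X, Pi.single_apply]

theorem field_totalX_U_smul {S : PSeries L} (hS : S.NoU) :
    field totalX a 2 (U 1 • S) = U 2 • S + U 1 • pd x S := by
  rw [field_smul, hS.field_totalX]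
  simp [Finset.sum_range_succ, totalX, pderiv_taylorAt, MvPolynomial.pderiv_X, Pi.single_apply]
  simp [taylorAt]

include h

theorem pd_one_B (hc : (Q).IsCentral) : pd (u 1) B = -P₁ - (2 : ℕ) • U 1 • Q := by
  have h1 : pd (u 1) B = pdPred 0 A - field totalX a 2 (pd (u 0) A) - ⁅A, pd (u 0) A⁆ :=
    h.pd_B_add_one
  have h2 : ⁅A, pd (u 0) A⁆ = 0 := by
    rw [pd_A, lie_add, lie_nsmul, fun_lie_smul, hc.lie_eq_zero', smul_zero, smul_zero, add_zero]
    nth_rw 1 [h.A_eq]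
    rw [add_lie, smul_lie, smul_lie, smul_lie, lie_self, hc.lie_eq_zero]
    simp
  have h3 : pdPred 0 A = 0 := rfl
  rw [h1, h2, h3, pd_A, map_add, map_nsmul, field_totalX_v_smul h.noU_quadCoeff, h.pd_x_quadCoeff,
    h.noU_linCoeff.field_totalX]
  module

theorem lie_A (hc : (Q).IsCentral) (S : PSeries L) : ⁅A, S⁆ = v • ⁅P, S⁆ := by
  nth_rw 1 [h.A_eq]
  rw [add_lie, smul_lie, smul_lie, smul_lie, hc.lie_eq_zero, smul_zero, smul_zero, add_zero]

theorem pd_zero_B (hc : (Q).IsCentral) : pd (u 0) B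
    = P₂ + (2 : ℕ) • U 2 • Q + U 0 • (P + (2 : ℕ) • v • Q) + v • ⁅P, P₁⁆ := by
  have h1 := h.pd_zcr 1 (by omega)
  have h2 : pd (u 1) (field (totalT kdv) a 0 A) = U 0 • (P + (2 : ℕ) • v • Q) := by
    rw [h.pd_T 1 (by omega), ← pd_A]
    simp
  rw [h.pd_one_A, zero_lie, zero_add, h.pd_one_B hc, h2, pdPred_succ, h.lie_A hc, map_sub,
    map_neg, map_nsmul, field_totalX_U_smul h.noU_quadCoeff, (h.noU_linCoeff.pd x).field_totalX,
    h.pd_x_quadCoeff, lie_sub, lie_neg, lie_nsmul, fun_lie_smul, hc.lie_eq_zero'] at h1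
  linear_combination (norm := module) h1

/-- After substitution of the u-derivatives of B, the terms with u_3, with u_0 u_1 and with Q
outside A and B cancel. -/
theorem zcr_reduced (hc : (Q).IsCentral) :
    pd x B - pd t A + U 1 • (P₂ + v • ⁅P, P₁⁆) - U 2 • P₁ + ⁅A, B⁆ = 0 := by
  have h1 := h.zcr
  have h2 : field totalX a 2 B = pd x B + U 1 • pd (u 0) B + U 2 • pd (u 1) B
      + U 3 • pd (u 2) B := by
    rw [field_apply]
    simp [Finset.sum_range_succ, totalX, taylorAt]
    abel
  have h3 : field (totalT kdv) a 0 A = pd t A + (U 3 + U 0 * U 1) • pd (u 0) A := by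
    rw [field_apply]
    simp [totalT, taylorAt, kdv]
  rw [h3, zero_add, h2, h.pd_zero_B hc, h.pd_one_B hc, h.pd_two_B, pd_A] at h1
  linear_combination (norm := module) h1

end IsNormalZCR

end PSeries

end JetCoord

/-! ### Level 0: solving the zero-curvature equation -/

namespace JetCoord

open Finset.HasAntidiagonal
open MvPolynomial (pderiv)

namespace PSeries

variable {L L' : Type} [LieRing L] [LieAlgebra ℂ L] [LieRing L'] [LieAlgebra ℂ L']

theorem pd_X_smul_self (c : JetCoord) (S : PSeries L) :
    pd c ((MvPolynomial.X c : Fun) • S) = S + (MvPolynomial.X c : Fun) • pd c S := by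
  rw [pd_smul, MvPolynomial.pderiv_X_self, one_smul]

theorem pd_X_smul_of_ne {c d : JetCoord} (h : d ≠ c) (S : PSeries L) :
    pd c ((MvPolynomial.X d : Fun) • S) = (MvPolynomial.X d : Fun) • pd c S := by
  rw [pd_smul, MvPolynomial.pderiv_X_of_ne h, zero_smul, zero_add]

theorem pd_taylorAt_X_smul_self (a : Point) (c : JetCoord) (S : PSeries L) :
    pd c (taylorAt a (MvPolynomial.X c) • S) = S + taylorAt a (MvPolynomial.X c) • pd c S := by
  rw [taylorAt_X, add_smul, map_add, pd_X_smul_self, C_smul, map_smul, ← C_smul]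
  module

theorem pd_taylorAt_X_smul_of_ne (a : Point) {c d : JetCoord} (h : d ≠ c) (S : PSeries L) :
    pd c (taylorAt a (MvPolynomial.X d) • S) = taylorAt a (MvPolynomial.X d) • pd c S := by
  rw [taylorAt_X, add_smul, map_add, pd_X_smul_of_ne h, C_smul, map_smul, ← C_smul]
  module

theorem eq_zero_of_nsmul_eq_zero {n : ℕ} (hn : n ≠ 0) {S : PSeries L} (hS : n • S = 0) : S = 0 := by
  rw [← Nat.cast_smul_eq_nsmul ℂ] at hS
  exact (smul_eq_zero.1 hS).resolve_left (Nat.cast_ne_zero.2 hn)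

section FreePart

local notation "v" => (MvPolynomial.X (u 0) : Fun)

/-- Six times the part of `B` that is determined by `A`. -/
noncomputable def determinedB (a : Point) (A : PSeries L) : PSeries L :=
  (6 : ℕ) • taylorAt a (MvPolynomial.X (u 2)) • linCoeff A
    - (6 : ℕ) • taylorAt a (MvPolynomial.X (u 1)) • pd x (linCoeff A)
    + (6 : ℕ) • v • pd x (pd x (linCoeff A)) + (3 : ℕ) • v • v • ⁅linCoeff A, pd x (linCoeff A)⁆
    + ((6 : ℕ) • (MvPolynomial.C (a (u 0)) : Fun) • v • linCoeff A
      + (3 : ℕ) • v • v • linCoeff A)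
    + ((12 : ℕ) • v • taylorAt a (MvPolynomial.X (u 2)) • quadCoeff A
      - (6 : ℕ) • taylorAt a (MvPolynomial.X (u 1)) • taylorAt a (MvPolynomial.X (u 1))
        • quadCoeff A
      + (6 : ℕ) • (MvPolynomial.C (a (u 0)) : Fun) • v • v • quadCoeff A
      + (4 : ℕ) • v • v • v • quadCoeff A)

/-- The part of `B` that is not determined by `A`. -/
noncomputable def freeB (a : Point) (A B : PSeries L) : PSeries L :=
  B - (1 / 6 : ℂ) • determinedB a A

theorem six_freeB (a : Point) (A B : PSeries L) :
    (6 : ℕ) • freeB a A B = (6 : ℕ) • B - determinedB a A := by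
  rw [freeB, smul_sub, ← Nat.cast_smul_eq_nsmul ℂ, ← Nat.cast_smul_eq_nsmul ℂ, smul_smul]
  norm_num

end FreePart

namespace IsNormalZCR

variable {a : Point} {A B : PSeries L} (h : IsNormalZCR a 0 A B) (hc : (quadCoeff A).IsCentral)

local notation "v" => (MvPolynomial.X (u 0) : Fun)
local notation "P" => linCoeff A
local notation "Q" => quadCoeff A
local notation "P₁" => pd x (linCoeff A)
local notation "P₂" => pd x (pd x (linCoeff A))
local notation "P₃" => pd x (pd x (pd x (linCoeff A)))
local notation "U" k:max => taylorAt a (MvPolynomial.X (u k))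

include h

omit h in
theorem pd_x_lie : pd x ⁅P, P₁⁆ = ⁅P, P₂⁆ := by
  rw [pd_lie, lie_self, zero_add]

theorem noU_lie : NoU ⁅P, P₁⁆ := h.noU_linCoeff.lie (h.noU_linCoeff.pd x)

include hc

theorem lie_pd_zero_B : ⁅P, pd (u 0) B⁆ = ⁅P, P₂⁆ + v • ⁅P, ⁅P, P₁⁆⁆ := by
  rw [h.pd_zero_B hc]
  simp only [lie_add, lie_nsmul, fun_lie_smul, hc.lie_eq_zero', lie_self]
  module

theorem zcr_pd_one : P₃ + U 0 • P₁ + (2 : ℕ) • v • ⁅P, P₂⁆ + v • v • ⁅P, ⁅P, P₁⁆⁆ - pd t P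
    - (2 : ℕ) • v • pd t Q + U 1 • ⁅P, P₁⁆ + ⁅P, B⁆ = 0 := by
  have h1 := congrArg (pd (u 0)) (h.zcr_reduced hc)
  simp only [map_add, map_sub, map_zero, pd_taylorAt_X_smul_of_ne a (show u 1 ≠ u 0 by simp),
    pd_taylorAt_X_smul_of_ne a (show u 2 ≠ u 0 by simp), pd_X_smul_self, pd_lie (u 0) A B,
    pd_comm (u 0) x B, pd_comm (u 0) t A, h.pd_zero_B hc, pd_A, (h.noU_linCoeff.pd x) 0,
    ((h.noU_linCoeff.pd x).pd x) 0, h.noU_lie 0, map_nsmul, add_lie, nsmul_lie, smul_lie,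
    hc.lie_eq_zero, pd_X_smul_of_ne (show u 0 ≠ x by simp),
    pd_X_smul_of_ne (show u 0 ≠ t by simp), pd_taylorAt_X_smul_of_ne a (show u 2 ≠ x by simp),
    pd_taylorAt_X_smul_of_ne a (show u 0 ≠ x by simp), h.pd_x_quadCoeff, pd_x_lie] at h1
  rw [← h.pd_zero_B hc, h.lie_A hc, h.lie_pd_zero_B hc] at h1
  linear_combination (norm := module) h1

theorem zcr_pd_two : P₁ + (3 : ℕ) • ⁅P, P₂⁆ + (3 : ℕ) • v • ⁅P, ⁅P, P₁⁆⁆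
    - (2 : ℕ) • pd t Q = 0 := by
  have h1 := congrArg (pd (u 0)) (h.zcr_pd_one hc)
  simp only [map_add, map_sub, map_zero, pd_taylorAt_X_smul_of_ne a (show u 1 ≠ u 0 by simp),
    pd_taylorAt_X_smul_self, pd_X_smul_self, pd_lie (u 0) (linCoeff A) B,
    (h.noU_linCoeff.pd x) 0, ((h.noU_linCoeff.pd x).pd x) 0, (((h.noU_linCoeff.pd x).pd x).pd x) 0,
    h.noU_lie 0, map_nsmul, h.noU_linCoeff 0, zero_lie, (h.noU_linCoeff.pd t) 0,
    (h.noU_quadCoeff.pd t) 0, (h.noU_linCoeff.lie h.noU_lie) 0,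
    (h.noU_linCoeff.lie ((h.noU_linCoeff.pd x).pd x)) 0, h.lie_pd_zero_B hc] at h1
  linear_combination (norm := module) h1

/-- The second u_0-derivative of the zero-curvature equation is affine in v, since P and Q do not
involve u_0, and this is its slope. -/
theorem lie_lie_linCoeff : ⁅P, ⁅P, P₁⁆⁆ = 0 := by
  have h1 := congrArg (pd (u 0)) (h.zcr_pd_two hc)
  simp only [map_add, map_sub, map_zero, pd_X_smul_self, (h.noU_linCoeff.pd x) 0, map_nsmul,
    (h.noU_quadCoeff.pd t) 0, (h.noU_linCoeff.lie h.noU_lie) 0,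
    (h.noU_linCoeff.lie ((h.noU_linCoeff.pd x).pd x)) 0] at h1
  apply eq_zero_of_nsmul_eq_zero three_ne_zero
  linear_combination (norm := module) h1

theorem pd_x_linCoeff : P₁ + (3 : ℕ) • ⁅P, P₂⁆ = (2 : ℕ) • pd t Q := by
  have := h.zcr_pd_two hc
  rw [h.lie_lie_linCoeff hc] at this
  linear_combination (norm := module) this

theorem noU_freeB : (freeB a A B).NoU := by
  intro k
  -- The factor 6 clears the denominators 2 and 3 that come from integrating the u-derivatives of B.
  apply eq_zero_of_nsmul_eq_zero (n := 6) (by norm_num)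
  rw [← map_nsmul, six_freeB, map_sub, map_nsmul, determinedB]
  have e0 := taylorAt_X a (u 0)
  rcases (show k = 0 ∨ k = 1 ∨ k = 2 ∨ 2 < k by omega) with rfl | rfl | rfl | hk
  · simp only [map_add, map_sub, map_nsmul, C_smul, map_smul,
      pd_taylorAt_X_smul_of_ne a (show u 1 ≠ u 0 by simp),
      pd_taylorAt_X_smul_of_ne a (show u 2 ≠ u 0 by simp), pd_X_smul_self, h.pd_zero_B hc,
      h.noU_linCoeff 0, (h.noU_linCoeff.pd x) 0, ((h.noU_linCoeff.pd x).pd x) 0, h.noU_lie 0,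
      h.noU_quadCoeff 0, e0, add_smul]
    simp only [← C_smul]
    module
  · simp only [map_add, map_sub, map_nsmul, C_smul, map_smul,
      pd_taylorAt_X_smul_self, pd_X_smul_of_ne (show u 0 ≠ u 1 by simp),
      pd_taylorAt_X_smul_of_ne a (show u 2 ≠ u 1 by simp), h.pd_one_B hc,
      h.noU_linCoeff 1, (h.noU_linCoeff.pd x) 1, ((h.noU_linCoeff.pd x).pd x) 1, h.noU_lie 1,
      h.noU_quadCoeff 1]
    simp only [← C_smul]
    module
  · simp only [map_add, map_sub, map_nsmul, C_smul, map_smul,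
      pd_taylorAt_X_smul_self, pd_X_smul_of_ne (show u 0 ≠ u 2 by simp),
      pd_taylorAt_X_smul_of_ne a (show u 1 ≠ u 2 by simp), h.pd_two_B,
      h.noU_linCoeff 2, (h.noU_linCoeff.pd x) 2, ((h.noU_linCoeff.pd x).pd x) 2, h.noU_lie 2,
      h.noU_quadCoeff 2]
    simp only [← C_smul]
    module
  · simp only [map_add, map_sub, map_nsmul, C_smul, map_smul,
      pd_X_smul_of_ne (show u 0 ≠ u k by simp; omega),
      pd_taylorAt_X_smul_of_ne a (show u 1 ≠ u k by simp; omega),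
      pd_taylorAt_X_smul_of_ne a (show u 2 ≠ u k by simp; omega), h.B_order k hk,
      h.noU_linCoeff k, (h.noU_linCoeff.pd x) k, ((h.noU_linCoeff.pd x).pd x) k, h.noU_lie k,
      h.noU_quadCoeff k]
    module

theorem pd_t_linCoeff : pd t P = P₃ + a (u 0) • P₁ + ⁅P, freeB a A B⁆ := by
  rw [← sub_eq_zero]
  apply eq_zero_of_nsmul_eq_zero (n := 6) (by norm_num)
  have h1 := h.zcr_pd_one hc
  have h2 := h.pd_x_linCoeff hc
  have h3 : (6 : ℕ) • ⁅P, freeB a A B⁆ = (6 : ℕ) • ⁅P, B⁆ + (6 : ℕ) • U 1 • ⁅P, P₁⁆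
      - (6 : ℕ) • v • ⁅P, P₂⁆ := by
    rw [← lie_nsmul, six_freeB, determinedB]
    simp only [lie_sub, lie_add, lie_nsmul, fun_lie_smul, lie_self, hc.lie_eq_zero',
      h.lie_lie_linCoeff hc]
    module
  rw [h.lie_lie_linCoeff hc, taylorAt_X, add_smul] at h1
  rw [← C_smul]
  linear_combination (norm := module) -h3 - (6 : ℕ) • h1 + (6 : ℕ) • v • h2

/-- The zero-curvature equation minus v times its u_0-derivative removes the evolution of P; the
rest is the x-derivative of `freeB`, up to a multiple of P_x + 3[P, P_xx] = 2Q_t. -/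
theorem pd_x_freeB : pd x (freeB a A B) = 0 := by
  apply eq_zero_of_nsmul_eq_zero (n := 6) (by norm_num)
  rw [← map_nsmul, six_freeB, map_sub, map_nsmul, determinedB]
  have h1 := h.zcr_reduced hc
  have h2 := h.zcr_pd_one hc
  have h3 := h.pd_x_linCoeff hc
  have h4 : pd t A = v • pd t P + v • v • pd t Q := by
    conv_lhs => rw [h.A_eq]
    rw [map_add, pd_X_smul_of_ne (by simp), pd_X_smul_of_ne (by simp), pd_X_smul_of_ne (by simp)]
  have h5 := congrArg (fun S => (6 : ℕ) • v • ⁅P, S⁆) (six_freeB a A B)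
  rw [h.lie_A hc, h4] at h1
  rw [h.lie_lie_linCoeff hc, taylorAt_X, add_smul] at h2
  simp only [map_add, map_sub, map_nsmul, C_smul, map_smul, pd_x_lie, h.pd_x_quadCoeff,
    pd_X_smul_of_ne (show u 0 ≠ x by simp), pd_taylorAt_X_smul_of_ne a (show u 1 ≠ x by simp),
    pd_taylorAt_X_smul_of_ne a (show u 2 ≠ x by simp)] at h1 h2 ⊢
  simp only [← C_smul] at h1 h2 ⊢
  linear_combination (norm := module) (6 : ℕ) • h1 - (6 : ℕ) • v • h2 + (3 : ℕ) • v • v • h3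

end IsNormalZCR

end PSeries

end JetCoord

/-! ### Level 0: splitting off the central part -/

namespace JetCoord

open Finset.HasAntidiagonal
open MvPolynomial (pderiv)

namespace PSeries

variable {L L' : Type} [LieRing L] [LieAlgebra ℂ L] [LieRing L'] [LieAlgebra ℂ L']

section Core

local notation "X" => (MvPolynomial.X x : Fun)

/-- The series whose coefficients generate the `sl_2(ℂ[λ])`-part of the coefficients of `A`. -/
noncomputable def core (A : PSeries L) : PSeries L := (9 : ℂ) • ⁅linCoeff A, pd x (linCoeff A)⁆

/-- A series with central coefficients. -/
noncomputable def centralPart (A : PSeries L) : PSeries L :=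
  ⁅linCoeff A, pd x (linCoeff A)⁆
    + (1 / 3 : ℂ) • (linCoeff A - (2 : ℂ) • X • pd t (quadCoeff A))

theorem linCoeff_eq (A : PSeries L) : linCoeff A
    = (3 : ℂ) • centralPart A + (2 : ℂ) • X • pd t (quadCoeff A) - (1 / 3 : ℂ) • core A := by
  rw [centralPart, core]
  generalize X • pd t (quadCoeff A) = y
  module

theorem core_eq (A : PSeries L) : core A
    = (9 : ℂ) • centralPart A + (6 : ℂ) • X • pd t (quadCoeff A) - (3 : ℂ) • linCoeff A := by
  rw [centralPart, core]
  generalize X • pd t (quadCoeff A) = y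
  module

theorem NoU.X_smul {S : PSeries L} (hS : S.NoU) : (X • S).NoU := fun k => by
  rw [pd_X_smul_of_ne (by simp), hS k, smul_zero]

namespace IsNormalZCR

variable {a : Point} {A B : PSeries L} (h : IsNormalZCR a 0 A B)
  (hgen : ∀ z : L, (∀ μ, ⁅z, coeff μ A⁆ = 0) → (∀ μ, ⁅z, coeff μ B⁆ = 0) → ∀ y : L, ⁅z, y⁆ = 0)

local notation "P" => linCoeff A
local notation "Q" => quadCoeff A
local notation "W" => centralPart A
local notation "P₁" => pd x (linCoeff A)

include h

theorem noU_core : (core A).NoU := h.noU_lie.smul _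

theorem noU_centralPart : (W).NoU :=
  h.noU_lie.add ((h.noU_linCoeff.sub ((h.noU_quadCoeff.pd t).X_smul.smul _)).smul _)

theorem pd_x_pd_t_quadCoeff : pd x (pd t Q) = 0 := by
  rw [pd_comm, h.pd_x_quadCoeff, map_zero]

include hgen

theorem isCentral_quadCoeff : (Q).IsCentral := (h.isCentral_pd_pd_A hgen).smul _

/-- The equation P_x + 3[P, P_xx] = 2Q_t is the x-derivative of 3[P, P_x] + P - 2xQ_t = 3W, apart
from a constant of integration. -/
theorem pd_x_centralPart : pd x W = 0 := by
  have := h.pd_x_linCoeff (h.isCentral_quadCoeff hgen)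
  rw [← Nat.cast_smul_eq_nsmul ℂ, ← Nat.cast_smul_eq_nsmul ℂ] at this
  rw [centralPart, map_add, map_smul, map_sub, map_smul, pd_X_smul_self, h.pd_x_pd_t_quadCoeff,
    pd_x_lie, smul_zero, add_zero]
  push_cast at this
  linear_combination (norm := module) (1 / 3 : ℂ) • this

theorem isCentral_centralPart : (W).IsCentral := by
  have hc := h.isCentral_quadCoeff hgen
  refine h.isCentral_of_lie hgen h.noU_centralPart (h.pd_x_centralPart hgen) ?_
  rw [h.lie_A hc, centralPart, lie_add, lie_smul, lie_sub, lie_smul, fun_lie_smul,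
    (hc.pd t).lie_eq_zero', lie_self, h.lie_lie_linCoeff hc]
  simp

theorem core_lie (S : PSeries L) : ⁅core A, S⁆ = -((3 : ℂ) • ⁅P, S⁆) := by
  rw [core_eq, sub_lie, add_lie, smul_lie, smul_lie, smul_lie, smul_lie,
    ((h.isCentral_quadCoeff hgen).pd t).lie_eq_zero, (h.isCentral_centralPart hgen).lie_eq_zero]
  simp

theorem pd_x_core : pd x (core A) = (6 : ℂ) • pd t Q - (3 : ℂ) • P₁ := by
  have := LinearMap.map_smul (pd (L := L) x)
  rw [core_eq, map_sub, map_add, this, this, this, pd_X_smul_self,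
    h.pd_x_pd_t_quadCoeff, h.pd_x_centralPart hgen, smul_zero, smul_zero, add_zero, zero_add]

/-- Modulo central series `core` is -3P, so [core, core_x] = 9[P, P_x] = core; this is the reason
for the factor 9. The evolution of P carries over, and κ collects the central corrections. -/
theorem isKdVFlow : IsKdVFlow (pd x) (pd t) (fun k => (pd x)^[k] (core A)) (freeB a A B)
    ((9 : ℂ) • pd t W + (6 : ℂ) • X • pd t (pd t Q) - (6 : ℂ) • a (u 0) • pd t Q) (a (u 0)) := by
  have hc := h.isCentral_quadCoeff hgen
  have hw := h.isCentral_centralPart hgen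
  have hk : ((9 : ℂ) • pd t W + (6 : ℂ) • X • pd t (pd t Q)
      - (6 : ℂ) • a (u 0) • pd t Q).IsCentral :=
    (((hw.pd t).smul _).add ((((hc.pd t).pd t).fun_smul _).smul _)).sub
      (((hc.pd t).smul _).smul _)
  refine ⟨pd_lie x, pd_lie t, fun y => pd_comm t x y,
    fun k => (Function.iterate_succ_apply' _ _ _).symm, ?_, ?_, h.pd_x_freeB hc,
    fun y => hk.lie_eq_zero' y⟩
  · change ⁅core A, pd x (core A)⁆ = core A
    rw [h.core_lie hgen, h.pd_x_core hgen, lie_sub, lie_smul, lie_smul, (hc.pd t).lie_eq_zero',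
      core]
    module
  · change pd t (core A) = pd x (pd x (pd x (core A))) + a (u 0) • pd x (core A)
      + ⁅core A, freeB a A B⁆ + _
    have h1 := LinearMap.map_smul (pd (L := L) x)
    have h2 := LinearMap.map_smul (pd (L := L) t)
    rw [h.core_lie hgen, h.pd_x_core hgen, core_eq, map_sub, map_sub, map_sub, map_add, h2, h2, h2,
      pd_X_smul_of_ne (by simp), h1, h1, h1, h1, h.pd_t_linCoeff hc, h.pd_x_pd_t_quadCoeff,
      map_zero]
    generalize X • pd t (pd t Q) = y
    module

theorem kappa_eq_zero :
    (9 : ℂ) • pd t W + (6 : ℂ) • X • pd t (pd t Q) - (6 : ℂ) • a (u 0) • pd t Q = 0 :=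
  (h.isKdVFlow hgen).κ_eq_zero

/-- W and Q do not depend on x, so the x-derivative of κ = 0 is 6Q_tt = 0. This is what limits the
centre to finitely many parameters. -/
theorem pd_t_pd_t_quadCoeff : pd t (pd t Q) = 0 := by
  have h1 := congrArg (pd x) (h.kappa_eq_zero hgen)
  simp only [map_sub, map_add, map_smul, map_zero, pd_X_smul_self, pd_comm x t, h.pd_x_quadCoeff,
    h.pd_x_centralPart hgen, smul_zero, zero_add, add_zero, sub_zero] at h1
  exact (smul_eq_zero.1 h1).resolve_left (by norm_num)

theorem pd_t_centralPart : pd t W = (2 / 3 * a (u 0)) • pd t Q := by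
  have h1 := h.kappa_eq_zero hgen
  rw [h.pd_t_pd_t_quadCoeff hgen, smul_zero, smul_zero] at h1
  linear_combination (norm := module) (1 / 9 : ℂ) • h1

theorem pd_t_core : pd t (core A) = pd x (pd x (pd x (core A))) + a (u 0) • pd x (core A)
    + ⁅core A, freeB a A B⁆ := by
  have h1 := (h.isKdVFlow hgen).T_R
  rw [h.kappa_eq_zero hgen, add_zero] at h1
  exact h1

end IsNormalZCR

end Core

end PSeries

end JetCoord

/-! ### Level 0: the currents and three central elements span -/

namespace JetCoord

open Finset.HasAntidiagonal
open MvPolynomial (pderiv)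

namespace PSeries

variable {L L' : Type} [LieRing L] [LieAlgebra ℂ L] [LieRing L'] [LieAlgebra ℂ L']

/-- The coefficients of the monomials of degree at most `l` in `t` lie in `K`. -/
def CoeffMem (K : LieSubalgebra ℂ L) (l : ℕ) (S : PSeries L) : Prop :=
  ∀ μ : Mono, μ t ≤ l → coeff μ S ∈ K

namespace CoeffMem

variable {K : LieSubalgebra ℂ L} {l : ℕ} {S T : PSeries L}

theorem zero : CoeffMem K l 0 := fun μ _ => by rw [map_zero]; exact K.zero_mem

theorem add (hS : CoeffMem K l S) (hT : CoeffMem K l T) : CoeffMem K l (S + T) := fun μ hμ => by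
  rw [map_add]; exact K.add_mem (hS μ hμ) (hT μ hμ)

theorem sub (hS : CoeffMem K l S) (hT : CoeffMem K l T) : CoeffMem K l (S - T) := fun μ hμ => by
  rw [map_sub]; exact K.sub_mem (hS μ hμ) (hT μ hμ)

theorem smul (hS : CoeffMem K l S) (r : ℂ) : CoeffMem K l (r • S) := fun μ hμ => by
  rw [map_smul]; exact K.smul_mem r (hS μ hμ)

theorem nsmul (hS : CoeffMem K l S) (n : ℕ) : CoeffMem K l (n • S) := by
  rw [← Nat.cast_smul_eq_nsmul ℂ]; exact hS.smul _

theorem fun_smul (hS : CoeffMem K l S) (g : Fun) : CoeffMem K l (g • S) := fun μ hμ => by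
  rw [coeff_fun_smul]
  refine sum_mem fun q hq => K.smul_mem _ (hS _ ?_)
  rw [mem_antidiagonal] at hq
  rw [← hq, Finsupp.add_apply] at hμ
  omega

theorem lie (hS : CoeffMem K l S) (hT : CoeffMem K l T) : CoeffMem K l ⁅S, T⁆ := fun μ hμ => by
  rw [coeff_lie]
  refine sum_mem fun q hq => K.lie_mem (hS _ ?_) (hT _ ?_) <;>
  · rw [mem_antidiagonal] at hq
    rw [← hq, Finsupp.add_apply] at hμ
    omega

theorem pd (hS : CoeffMem K l S) {c : JetCoord} (hc : c ≠ t) : CoeffMem K l (pd c S) :=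
  fun μ hμ => by
    rw [coeff_pd, ← Nat.cast_smul_eq_nsmul ℂ]
    refine K.smul_mem _ (hS _ ?_)
    rwa [Finsupp.add_apply, Finsupp.single_eq_of_ne hc.symm, add_zero]

theorem succ (hS : CoeffMem K 0 S) (hT : CoeffMem K l (PSeries.pd t S)) :
    CoeffMem K (l + 1) S := fun μ hμ => by
  rcases Nat.eq_zero_or_pos (μ t) with h0 | h0
  · exact hS μ h0.le
  · rw [coeff_eq_inv_smul S h0.ne']
    refine K.smul_mem _ (hT _ ?_)
    rw [Finsupp.tsub_apply, Finsupp.single_eq_same]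
    omega

theorem of_ev (hU : S.NoU) (h : ∀ k, ev ((PSeries.pd x)^[k] S) ∈ K) : CoeffMem K 0 S := by
  intro μ hμ
  obtain ⟨k, hk⟩ : ∃ k, μ x = k := ⟨_, rfl⟩
  induction k generalizing S μ with
  | zero =>
    by_cases hν : μ.NoU
    · have : μ = 0 := by
        ext (_ | _ | k)
        · exact hk
        · exact Nat.le_zero.1 hμ
        · exact hν k
      rw [this, ← ev_apply]
      exact h 0
    · rw [hU.coeff_eq_zero hν]
      exact K.zero_mem
  | succ k ih =>
    rw [coeff_eq_inv_smul S (c := x) (by omega)]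
    refine K.smul_mem _ (ih (hU.pd x) (fun n => h (n + 1)) _ ?_ ?_)
    · rw [Finsupp.tsub_apply, Finsupp.single_eq_of_ne (by simp)]
      omega
    · rw [Finsupp.tsub_apply, Finsupp.single_eq_same]
      omega

theorem of_pd_x (hU : S.NoU) (hx : PSeries.pd x S = 0) (h : ev S ∈ K) : CoeffMem K 0 S :=
  of_ev hU fun k => by
    cases k with
    | zero => exact h
    | succ k =>
      have : (PSeries.pd x)^[k] (0 : PSeries L) = 0 :=
        Function.iterate_fixed (map_zero (PSeries.pd (L := L) x)) k
      rw [Function.iterate_succ_apply, hx, this, map_zero]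
      exact K.zero_mem

end CoeffMem

namespace IsNormalZCR

variable {a : Point} {A B : PSeries L} (h : IsNormalZCR a 0 A B)
  (hgen : ∀ z : L, (∀ μ, ⁅z, coeff μ A⁆ = 0) → (∀ μ, ⁅z, coeff μ B⁆ = 0) → ∀ y : L, ⁅z, y⁆ = 0)
  {K : LieSubalgebra ℂ L} (hR : ∀ k, ev ((pd x)^[k] (core A)) ∈ K) (hQ : ev (quadCoeff A) ∈ K)
  (hQ' : ev (pd t (quadCoeff A)) ∈ K) (hW : ev (centralPart A) ∈ K)

local notation "P" => linCoeff A
local notation "Q" => quadCoeff A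
local notation "W" => centralPart A

theorem coeffMem_determinedB {l : ℕ} (hP : CoeffMem K l P) (hQ : CoeffMem K l Q) :
    CoeffMem K l (determinedB a A) := by
  have h1 := hP.pd (show x ≠ t by simp)
  have h2 := h1.pd (show x ≠ t by simp)
  exact (((((((hP.fun_smul _).nsmul _).sub ((h1.fun_smul _).nsmul _)).add
    ((h2.fun_smul _).nsmul _)).add ((((hP.lie h1).fun_smul _).fun_smul _).nsmul _))).add
    ((((hP.fun_smul _).fun_smul _).nsmul _).add (((hP.fun_smul _).fun_smul _).nsmul _))).add
    ((((((hQ.fun_smul _).fun_smul _).nsmul _).sub (((hQ.fun_smul _).fun_smul _).nsmul _)).add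
    ((((hQ.fun_smul _).fun_smul _).fun_smul _).nsmul _)).add
    ((((hQ.fun_smul _).fun_smul _).fun_smul _).nsmul _))

include h hgen

/-- `freeB` is a series in t, and B has no pure t-coefficients, so its coefficients are those of the
determined part up to the factor -1/6. -/
theorem coeffMem_freeB {l : ℕ} (hP : CoeffMem K l P) (hQ : CoeffMem K l Q) :
    CoeffMem K l (freeB a A B) := by
  intro μ hμ
  have hc := h.isCentral_quadCoeff hgen
  by_cases hν : μ.NoU
  · by_cases hx : μ x = 0
    · rw [freeB, map_sub, h.B_zero μ hx hν, zero_sub, map_smul]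
      exact K.neg_mem (K.smul_mem _ (coeffMem_determinedB hP hQ μ hμ))
    · rw [coeff_eq_zero_of_pd (h.pd_x_freeB hc) hx]
      exact K.zero_mem
  · rw [(h.noU_freeB hc).coeff_eq_zero hν]
    exact K.zero_mem

include hQ hQ'

theorem coeffMem_pd_t_quadCoeff (l : ℕ) : CoeffMem K l (pd t Q) := by
  have h0 := CoeffMem.of_pd_x (h.noU_quadCoeff.pd t) h.pd_x_pd_t_quadCoeff hQ'
  cases l with
  | zero => exact h0
  | succ l =>
    refine h0.succ ?_
    rw [h.pd_t_pd_t_quadCoeff hgen]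
    exact CoeffMem.zero

theorem coeffMem_quadCoeff (l : ℕ) : CoeffMem K l Q := by
  have h0 := CoeffMem.of_pd_x h.noU_quadCoeff h.pd_x_quadCoeff hQ
  cases l with
  | zero => exact h0
  | succ l => exact h0.succ (h.coeffMem_pd_t_quadCoeff hgen hQ hQ' l)

include hW

theorem coeffMem_centralPart (l : ℕ) : CoeffMem K l W := by
  have h0 := CoeffMem.of_pd_x h.noU_centralPart (h.pd_x_centralPart hgen) hW
  cases l with
  | zero => exact h0
  | succ l =>
    refine h0.succ ?_
    rw [h.pd_t_centralPart hgen]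
    exact (h.coeffMem_pd_t_quadCoeff hgen hQ hQ' l).smul _

theorem coeffMem_linCoeff {l : ℕ} (hr : CoeffMem K l (core A)) : CoeffMem K l P := by
  rw [linCoeff_eq]
  exact (((h.coeffMem_centralPart hgen hQ hQ' hW l).smul _).add
    (((h.coeffMem_pd_t_quadCoeff hgen hQ hQ' l).fun_smul _).smul _)).sub (hr.smul _)

include hR

/-- The evolution equation expresses the t-derivative through coefficients of t-degree at most l, so
the x-derivatives at the base point determine everything by induction on the degree in t. -/
theorem coeffMem_core (l : ℕ) : CoeffMem K l (core A) := by
  have h0 := CoeffMem.of_ev h.noU_core hR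
  induction l with
  | zero => exact h0
  | succ l ih =>
    refine h0.succ ?_
    rw [h.pd_t_core hgen]
    have hx : x ≠ t := by simp
    exact ((((ih.pd hx).pd hx).pd hx).add ((ih.pd hx).smul _)).add (ih.lie
      (h.coeffMem_freeB hgen (h.coeffMem_linCoeff hgen hQ hQ' hW ih)
        (h.coeffMem_quadCoeff hgen hQ hQ' l)))

theorem coeff_A_mem_and_coeff_B_mem (μ : Mono) : coeff μ A ∈ K ∧ coeff μ B ∈ K := by
  have hP := h.coeffMem_linCoeff hgen hQ hQ' hW (h.coeffMem_core hgen hR hQ hQ' hW (μ t))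
  have hQ := h.coeffMem_quadCoeff hgen hQ hQ' (μ t)
  have hA : CoeffMem K (μ t) A := by
    rw [h.A_eq]
    exact (hP.fun_smul _).add ((hQ.fun_smul _).fun_smul _)
  have hB : CoeffMem K (μ t) B := by
    rw [show B = freeB a A B + (1 / 6 : ℂ) • determinedB a A by rw [freeB, sub_add_cancel]]
    exact (h.coeffMem_freeB hgen hP hQ).add ((coeffMem_determinedB hP hQ).smul _)
  exact ⟨hA μ le_rfl, hB μ le_rfl⟩

end IsNormalZCR

end PSeries

section Spanning

variable {L L' : Type} [LieRing L] [LieAlgebra ℂ L] [LieRing L'] [LieAlgebra ℂ L']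

/-- The span of the `λ^n e`, `λ^n h`, `λ^n f` in a quotient of the current algebra. -/
noncomputable def currentSpan (e f h₁ : L) : Submodule ℂ L :=
  Submodule.span ℂ (Set.range (currentE e h₁) ∪ Set.range (currentH e f h₁)
    ∪ Set.range (currentF e f h₁))

theorem currentE_mem (e f h₁ : L) (n : ℕ) : currentE e h₁ n ∈ currentSpan e f h₁ :=
  Submodule.subset_span (.inl (.inl ⟨n, rfl⟩))

theorem currentH_mem (e f h₁ : L) (n : ℕ) : currentH e f h₁ n ∈ currentSpan e f h₁ :=
  Submodule.subset_span (.inl (.inr ⟨n, rfl⟩))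

theorem currentF_mem (e f h₁ : L) (n : ℕ) : currentF e f h₁ n ∈ currentSpan e f h₁ :=
  Submodule.subset_span (.inr ⟨n, rfl⟩)

theorem _root_.IsCurrentData.lie_mem_currentSpan {e h f e₁ h₁ : L} (hd : IsCurrentData e h f e₁ h₁)
    {y z : L} (hy : y ∈ currentSpan e f h₁) (hz : z ∈ currentSpan e f h₁) :
    ⁅y, z⁆ ∈ currentSpan e f h₁ := by
  have hE := currentE_mem e f h₁
  have hH := currentH_mem e f h₁
  have hF := currentF_mem e f h₁
  induction hy using Submodule.span_induction with
  | zero => rw [zero_lie]; exact Submodule.zero_mem _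
  | add y y' _ _ h h' => rw [add_lie]; exact Submodule.add_mem _ h h'
  | smul r y _ h => rw [smul_lie]; exact Submodule.smul_mem _ r h
  | mem y hy =>
    induction hz using Submodule.span_induction with
    | zero => rw [lie_zero]; exact Submodule.zero_mem _
    | add z z' _ _ h h' => rw [lie_add]; exact Submodule.add_mem _ h h'
    | smul r z _ h => rw [lie_smul]; exact Submodule.smul_mem _ r h
    | mem z hz =>
      rcases hy with (⟨i, rfl⟩ | ⟨i, rfl⟩) | ⟨i, rfl⟩ <;>
      rcases hz with (⟨j, rfl⟩ | ⟨j, rfl⟩) | ⟨j, rfl⟩ <;>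
      obtain ⟨t1, t2, t3, t4, t5, t6, t7, t8⟩ := hd.lie_table i j <;>
      simp only [t1, t2, t3, t4, t5, t6, t7, t8, hd.lie_E_F i j, Submodule.neg_mem_iff, hE, hH, hF,
        Submodule.zero_mem]

/-- The sum of a current algebra and a space of central elements. -/
noncomputable def _root_.IsCurrentData.subalgebra {e h f e₁ h₁ : L} (hd : IsCurrentData e h f e₁ h₁)
    (Z : Submodule ℂ L) (hZ : ∀ z ∈ Z, ∀ y : L, ⁅z, y⁆ = 0) : LieSubalgebra ℂ L :=
  { currentSpan e f h₁ ⊔ Z with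
    lie_mem' := by
      intro y y' hy hy'
      obtain ⟨c, hc, z, hz, rfl⟩ := Submodule.mem_sup.1 hy
      obtain ⟨c', hc', z', hz', rfl⟩ := Submodule.mem_sup.1 hy'
      rw [add_lie, lie_add, hZ z hz, ← lie_skew c z', hZ z' hz', neg_zero, add_zero, add_zero]
      exact Submodule.mem_sup_left (hd.lie_mem_currentSpan hc hc') }

theorem _root_.IsCurrentData.map {e h f e₁ h₁ : L} (hd : IsCurrentData e h f e₁ h₁) (φ : L →ₗ⁅ℂ⁆ L') :
    IsCurrentData (φ e) (φ h) (φ f) (φ e₁) (φ h₁) := by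
  constructor <;> simp only [← LieHom.map_lie, ← map_neg, hd.eh, hd.ef, hd.hf, hd.ee₁, hd.he₁,
    hd.e₁f, hd.serre_f, hd.serre_e, map_zero]

theorem map_currentE (φ : L →ₗ⁅ℂ⁆ L') (e h₁ : L) (n : ℕ) :
    φ (currentE e h₁ n) = currentE (φ e) (φ h₁) n := by
  induction n with
  | zero => rfl
  | succ n ih => rw [currentE, currentE, LieHom.map_lie, ih]

theorem map_currentH (φ : L →ₗ⁅ℂ⁆ L') (e f h₁ : L) (n : ℕ) :
    φ (currentH e f h₁ n) = currentH (φ e) (φ f) (φ h₁) n := by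
  rw [currentH, currentH, LieHom.map_lie, map_currentE]

theorem map_currentF (φ : L →ₗ⁅ℂ⁆ L') (e f h₁ : L) (n : ℕ) :
    φ (currentF e f h₁ n) = currentF (φ e) (φ f) (φ h₁) n := by
  rw [currentF, currentF, LieHom.map_lie, map_currentH]

end Spanning

section Generators

open PSeries

variable (a : Point)

local notation "𝔸" => genA kdv 3 0 a
local notation "𝔹" => genB kdv 3 0 a

theorem isKdVFlow_gen : IsKdVFlow (pd x) (pd t) (fun k => (pd x)^[k] (core 𝔸)) (freeB a 𝔸 𝔹)
    ((9 : ℂ) • pd t (centralPart 𝔸) + (6 : ℂ) • (MvPolynomial.X x : Fun) • pd t (pd t (quadCoeff 𝔸))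
      - (6 : ℂ) • a (u 0) • pd t (quadCoeff 𝔸)) (a (u 0)) :=
  (isNormalZCR_gen 0 a).isKdVFlow lie_eq_zero_of_lie_gen

/-- The generator `e`. -/
noncomputable def genE : FAlg kdv 3 0 a := ev (core 𝔸)

/-- The generator `f`. -/
noncomputable def genF : FAlg kdv 3 0 a :=
  ev ((pd x)^[2] (core 𝔸) - (1 / 2 : ℂ) • ⁅core 𝔸, (pd x)^[3] (core 𝔸)⁆)

/-- The generator `λ h`. -/
noncomputable def genH₁ : FAlg kdv 3 0 a := ev ((pd x)^[3] (core 𝔸))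

theorem isCurrentData_gen : IsCurrentData (genE a) (ev (pd x (core 𝔸))) (genF a)
    (ev ⁅core 𝔸, (pd x)^[3] (core 𝔸)⁆) (genH₁ a) :=
  (isKdVFlow_gen a).isCurrentData.map ev

/-- The span of the central generators. -/
noncomputable def centralSpan : Submodule ℂ (FAlg kdv 3 0 a) :=
  Submodule.span ℂ {ev (centralPart 𝔸), ev (quadCoeff 𝔸), ev (pd t (quadCoeff 𝔸))}

theorem centralSpan_lie (z : FAlg kdv 3 0 a) (hz : z ∈ centralSpan a) (y : FAlg kdv 3 0 a) :
    ⁅z, y⁆ = 0 := by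
  have h := isNormalZCR_gen 0 a
  have hgen := lie_eq_zero_of_lie_gen (F := kdv) (d := 3) (p := 0) (a := a)
  have hQ := h.isCentral_quadCoeff hgen
  induction hz using Submodule.span_induction with
  | zero => rw [zero_lie]
  | add z z' _ _ h h' => rw [add_lie, h, h', add_zero]
  | smul r z _ h => rw [smul_lie, h, smul_zero]
  | mem z hz =>
    rcases hz with rfl | rfl | rfl <;> rw [ev_apply]
    exacts [h.isCentral_centralPart hgen 0 y, hQ 0 y, hQ.pd t 0 y]

/-- Currents plus central elements already form a subalgebra, so it suffices that it contains the
coefficients of A and B; those are built from the constant terms of the x-derivatives of `core` and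
of W, Q, Q_t. -/
theorem mem_currentSpan_sup_centralSpan (y : FAlg kdv 3 0 a) :
    y ∈ currentSpan (genE a) (genF a) (genH₁ a) ⊔ centralSpan a := by
  let K := (isCurrentData_gen a).subalgebra (centralSpan a) (centralSpan_lie a)
  have hC : ∀ z ∈ currentSpan (genE a) (genF a) (genH₁ a), z ∈ K :=
    fun z hz => Submodule.mem_sup_left hz
  have hZ : ∀ z ∈ centralSpan a, z ∈ K := fun z hz => Submodule.mem_sup_right hz
  have hR : ∀ k, ev ((pd x)^[k] (core 𝔸)) ∈ K := by
    intro k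
    refine (isKdVFlow_gen a).R_mem (K := K.toSubmodule.comap (ev : PSeries (FAlg kdv 3 0 a) →ₗ⁅ℂ⁆ _).toLinearMap) ?_ ?_ ?_ k
    · intro n
      rw [Submodule.mem_comap]
      change ev _ ∈ K
      rw [map_currentE]
      exact hC _ (currentE_mem _ (genF a) _ n)
    · intro n
      rw [Submodule.mem_comap]
      change ev _ ∈ K
      rw [map_currentH]
      exact hC _ (currentH_mem _ _ _ n)
    · intro n
      rw [Submodule.mem_comap]
      change ev _ ∈ K
      rw [map_currentF]
      exact hC _ (currentF_mem _ _ _ n)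
  have key := (isNormalZCR_gen 0 a).coeff_A_mem_and_coeff_B_mem
    lie_eq_zero_of_lie_gen hR (hZ _ (Submodule.subset_span (by simp)))
    (hZ _ (Submodule.subset_span (by simp))) (hZ _ (Submodule.subset_span (by simp)))
  exact mem_of_coeff_mem K (fun μ => (key μ).1) (fun μ => (key μ).2) y

end Generators

end JetCoord

/-! ### Constructing zero-curvature pairs from exponentials -/

namespace JetCoord

open Finset.HasAntidiagonal
open MvPolynomial (pderiv)

namespace PSeries

variable {L L' : Type} [LieRing L] [LieAlgebra ℂ L] [LieRing L'] [LieAlgebra ℂ L']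

section Const

/-- The series with only a constant term. -/
noncomputable def const (y : L) : PSeries L := Pi.single 0 y

theorem coeff_const_zero (y : L) : coeff 0 (const y) = y :=
  Pi.single_eq_same (M := fun _ : Mono => L) 0 y

theorem coeff_const_of_ne (y : L) {μ : Mono} (hμ : μ ≠ 0) : coeff μ (const y) = 0 :=
  Pi.single_eq_of_ne (M := fun _ : Mono => L) hμ y

theorem pd_const (c : JetCoord) (y : L) : pd c (const y) = 0 := by
  ext μ
  rw [coeff_pd, coeff_const_of_ne, smul_zero, map_zero]
  intro h
  have := DFunLike.congr_fun h c
  simp at this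

theorem noU_const (y : L) : (const y).NoU := fun _ => pd_const _ y

theorem coeff_const_lie (y : L) (S : PSeries L) (μ : Mono) :
    coeff μ ⁅const y, S⁆ = ⁅y, coeff μ S⁆ := by
  rw [coeff_lie, Finset.sum_eq_single (0, μ)]
  · rw [coeff_const_zero]
  · rintro ⟨q, q'⟩ hq hne
    rw [mem_antidiagonal] at hq
    rw [coeff_const_of_ne, zero_lie]
    rintro (rfl : q = 0)
    simp_all
  · intro h
    simp at h

end Const

section Exp

open Classical in
/-- The solution of `∂_x S = exp[α, y]`, `∂_t S = [β, S]` with constant term `y`. -/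
noncomputable def expSeries (α β : L) (y : L) : PSeries L := fun μ =>
  if μ.NoU then ((μ x).factorial : ℂ)⁻¹ • ((μ t).factorial : ℂ)⁻¹ •
    (LieAlgebra.ad ℂ L β ^ μ t) ((LieAlgebra.ad ℂ L α ^ μ x) y) else 0

variable (α β : L)

theorem coeff_expSeries (y : L) {μ : Mono} (hμ : μ.NoU) : coeff μ (expSeries α β y)
    = ((μ x).factorial : ℂ)⁻¹ • ((μ t).factorial : ℂ)⁻¹ •
      (LieAlgebra.ad ℂ L β ^ μ t) ((LieAlgebra.ad ℂ L α ^ μ x) y) := if_pos hμ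

theorem coeff_expSeries_of_not (y : L) {μ : Mono} (hμ : ¬ μ.NoU) :
    coeff μ (expSeries α β y) = 0 := if_neg hμ

theorem noU_expSeries (y : L) : (expSeries α β y).NoU := by
  intro k
  ext μ
  rw [coeff_pd, coeff_expSeries_of_not, smul_zero, map_zero]
  intro h
  have := h k
  simp at this

theorem ev_expSeries (y : L) : ev (expSeries α β y) = y := by
  rw [ev_apply, coeff_expSeries α β y (fun _ => rfl)]
  simp

theorem expSeries_add (y z : L) : expSeries α β (y + z) = expSeries α β y + expSeries α β z := by
  ext μ
  by_cases h : μ.NoU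
  · simp [coeff_expSeries α β _ h]
  · simp [coeff_expSeries_of_not α β _ h]

theorem expSeries_smul (r : ℂ) (y : L) : expSeries α β (r • y) = r • expSeries α β y := by
  ext μ
  by_cases h : μ.NoU
  · simp only [coeff_expSeries α β _ h, map_smul, smul_comm _ r]
  · simp [coeff_expSeries_of_not α β _ h]

theorem Mono.noU_add_single_iff {c : JetCoord} (hc : ∀ k, c ≠ u k) (μ : Mono) :
    (μ + Finsupp.single c 1 : Mono).NoU ↔ μ.NoU := by
  refine forall_congr' fun k => ?_
  rw [Finsupp.add_apply, Finsupp.single_eq_of_ne (hc k).symm, add_zero]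

theorem pd_x_expSeries (y : L) : pd x (expSeries α β y) = expSeries α β ⁅α, y⁆ := by
  ext μ
  have hν := Mono.noU_add_single_iff (c := x) (by simp) μ
  rw [coeff_pd]
  by_cases h : μ.NoU
  · rw [coeff_expSeries α β _ h, coeff_expSeries α β _ (hν.2 h), Finsupp.add_apply,
      Finsupp.add_apply, Finsupp.single_eq_same, Finsupp.single_eq_of_ne (by simp), add_zero,
      pow_succ, Module.End.mul_apply, LieAlgebra.ad_apply, ← Nat.cast_smul_eq_nsmul ℂ, smul_smul,
      Nat.factorial_succ, Nat.cast_mul, mul_inv, ← mul_assoc,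
      mul_inv_cancel₀ (Nat.cast_ne_zero.2 (Nat.succ_ne_zero _)), one_mul]
  · rw [coeff_expSeries_of_not α β _ h, coeff_expSeries_of_not α β _ (fun h' => h (hν.1 h')),
      smul_zero]

theorem pd_t_expSeries (y : L) : pd t (expSeries α β y) = ⁅const β, expSeries α β y⁆ := by
  ext μ
  have hν := Mono.noU_add_single_iff (c := t) (by simp) μ
  rw [coeff_pd, coeff_const_lie]
  by_cases h : μ.NoU
  · rw [coeff_expSeries α β _ h, coeff_expSeries α β _ (hν.2 h), Finsupp.add_apply,
      Finsupp.add_apply, Finsupp.single_eq_same, Finsupp.single_eq_of_ne (by simp), add_zero,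
      pow_succ', Module.End.mul_apply, LieAlgebra.ad_apply, ← Nat.cast_smul_eq_nsmul ℂ, smul_smul,
      smul_smul, lie_smul, lie_smul, smul_smul, Nat.factorial_succ, Nat.cast_mul, mul_inv]
    congr 1
    field_simp
  · rw [coeff_expSeries_of_not α β _ h, coeff_expSeries_of_not α β _ (fun h' => h (hν.1 h')),
      smul_zero, lie_zero]

/-- The series is exp(t ad β) exp(x ad α) y, and exponentials of derivations are automorphisms. No
relation between α and β is needed, because of the order of the two factors. -/
theorem lie_expSeries (y z : L) :
    ⁅expSeries α β y, expSeries α β z⁆ = expSeries α β ⁅y, z⁆ := by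
  rw [← sub_eq_zero]
  have hU : ∀ y z, NoU (⁅expSeries α β y, expSeries α β z⁆ - expSeries α β ⁅y, z⁆) :=
    fun y z => ((noU_expSeries α β y).lie (noU_expSeries α β z)).sub (noU_expSeries α β _)
  refine (hU y z).eq_zero fun μ hμ => ?_
  obtain ⟨n, hn⟩ : ∃ n, μ x + μ t = n := ⟨_, rfl⟩
  induction n generalizing μ y z with
  | zero =>
    have : μ = 0 := by
      ext (_ | _ | k)
      · simp; omega
      · simp; omega
      · exact hμ k
    rw [this, ← ev_apply, map_sub, LieHom.map_lie, ev_expSeries, ev_expSeries, ev_expSeries,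
      sub_self]
  | succ n ih =>
    have hν : ∀ c, (μ - Finsupp.single c 1 : Mono).NoU := fun c k => by
      rw [Finsupp.tsub_apply, hμ k, zero_tsub]
    rcases Nat.eq_zero_or_pos (μ x) with hx | hx
    · rw [coeff_eq_inv_smul (c := t) _ (by omega), map_sub, pd_lie, pd_t_expSeries,
        pd_t_expSeries, pd_t_expSeries, ← leibniz_lie, ← lie_sub, coeff_const_lie, ih y z _ (hν t),
        lie_zero, smul_zero]
      simp
      omega
    · have h1 : pd x (⁅expSeries α β y, expSeries α β z⁆ - expSeries α β ⁅y, z⁆)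
          = (⁅expSeries α β ⁅α, y⁆, expSeries α β z⁆ - expSeries α β ⁅⁅α, y⁆, z⁆)
          + (⁅expSeries α β y, expSeries α β ⁅α, z⁆⁆ - expSeries α β ⁅y, ⁅α, z⁆⁆) := by
        rw [map_sub, pd_lie, pd_x_expSeries, pd_x_expSeries, pd_x_expSeries, leibniz_lie α y z,
          expSeries_add]
        abel
      have h2 : (μ - Finsupp.single x 1 : Mono) x + (μ - Finsupp.single x 1 : Mono) t = n := by
        simp
        omega
      rw [coeff_eq_inv_smul (c := x) _ (by omega), h1, map_add, ih _ _ _ (hν x) h2,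
        ih _ _ _ (hν x) h2, add_zero, smul_zero]

/-- At x = x_0 only exp(t ad β)β = β is left. This is how the condition on the pure t-coefficients
of B is met. -/
theorem coeff_expSeries_self_sub_const {μ : Mono} (hx : μ x = 0) (hμ : μ.NoU) :
    coeff μ (expSeries α β β - const β) = 0 := by
  rcases Nat.eq_zero_or_pos (μ t) with ht | ht
  · have : μ = 0 := by
      ext (_ | _ | k)
      exacts [hx, ht, hμ k]
    rw [map_sub, this, coeff_const_zero, ← ev_apply, ev_expSeries, sub_self]
  · obtain ⟨n, hn⟩ := Nat.exists_eq_succ_of_ne_zero ht.ne'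
    rw [map_sub, coeff_const_of_ne, coeff_expSeries α β _ hμ, hn, hx, pow_zero, pow_succ,
      Module.End.mul_apply, Module.End.one_apply, LieAlgebra.ad_apply, lie_self]
    · simp
    · rintro rfl
      simp at ht

end Exp

section Construction

variable (a : Point) {p b : PSeries L}

local notation "v" => (MvPolynomial.X (u 0) : Fun)
local notation "U" k:max => taylorAt a (MvPolynomial.X (u k))

/-- The component `B` of the zero-curvature representation with `A = 3 (u_0 - a_0) p`. -/
noncomputable def linearB (p b : PSeries L) : PSeries L :=
  (3 : ℕ) • U 2 • p - (3 : ℕ) • U 1 • pd x p + (3 : ℕ) • v • pd x (pd x p)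
    + ((3 : ℕ) • (MvPolynomial.C (a (u 0)) : Fun) • v • p + v • v • p) + b

variable {a}

theorem field_totalX_linearB (hp : p.NoU) (hb : b.NoU) (hb' : pd x b = 0) :
    field totalX a 2 (linearB a p b) = (3 : ℕ) • U 3 • p + (3 : ℕ) • v • pd x (pd x (pd x p))
      + U 1 • ((3 : ℕ) • (MvPolynomial.C (a (u 0)) : Fun) • p + (2 : ℕ) • v • p)
      + ((3 : ℕ) • (MvPolynomial.C (a (u 0)) : Fun) • v • pd x p + v • v • pd x p) := by
  have h2 : ∀ S : PSeries L, S.NoU → field totalX a 2 (U 2 • S) = U 3 • S + U 2 • pd x S := by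
    intro S hS
    rw [field_smul, hS.field_totalX]
    simp [Finset.sum_range_succ, totalX, pderiv_taylorAt, MvPolynomial.pderiv_X, Pi.single_apply]
    simp [taylorAt]
  have h3 : field totalX a 2 (v • v • p) = (2 : ℕ) • U 1 • v • p + v • v • pd x p := by
    rw [← mul_smul, field_smul, hp.field_totalX]
    simp [Finset.sum_range_succ, totalX, MvPolynomial.pderiv_X, Pi.single_apply]
    module
  rw [linearB, map_add, map_add, map_add, map_sub, map_add, map_nsmul, map_nsmul, map_nsmul,
    map_nsmul, h2 p hp, h3, IsNormalZCR.field_totalX_v_smul ((hp.pd x).pd x),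
    IsNormalZCR.field_totalX_U_smul (hp.pd x), C_smul, map_smul, ← C_smul,
    IsNormalZCR.field_totalX_v_smul hp, hb.field_totalX, hb']
  module

/-- A zero-curvature representation with `A = 3 (u_0 - a_0) p`. -/
theorem isNormalZCR_linear (hp : p.NoU) (hb : b.NoU) (hb' : pd x b = 0)
    (h1 : (9 : ℕ) • ⁅p, pd x p⁆ = -p) (h2 : (9 : ℕ) • ⁅p, pd x (pd x p)⁆ = -pd x p)
    (ht : pd t p = pd x (pd x (pd x p)) + a (u 0) • pd x p + ⁅p, b⁆)
    (h0 : ∀ μ : Mono, μ x = 0 → μ.NoU → coeff μ ((3 : ℕ) • a (u 2) • p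
      - (3 : ℕ) • a (u 1) • pd x p + b) = 0) :
    IsNormalZCR a 0 ((3 : ℕ) • v • p) (linearB a p b) where
  A_order k hk := by
    rw [map_nsmul, pd_X_smul_of_ne (by simp; omega), hp k, smul_zero, smul_zero]
  B_order k hk := by
    have e0 : u 0 ≠ u k := by simp; omega
    have e1 : u 1 ≠ u k := by simp; omega
    have e2 : u 2 ≠ u k := by simp; omega
    rw [linearB]
    simp only [map_add, map_sub, map_nsmul, C_smul, map_smul, pd_X_smul_of_ne e0,
      pd_taylorAt_X_smul_of_ne a e1, pd_taylorAt_X_smul_of_ne a e2, hp k, (hp.pd x) k,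
      ((hp.pd x).pd x) k, hb k]
    simp
  zcr := by
    have h3 : field (totalT kdv) a 0 ((3 : ℕ) • v • p)
        = (3 : ℕ) • v • pd t p + (3 : ℕ) • (U 3 + U 0 * U 1) • p := by
      rw [map_nsmul, field_smul, hp.field_totalT]
      simp [totalT, taylorAt, kdv]
      module
    have h4 : ⁅(3 : ℕ) • v • p, linearB a p b⁆ = v • U 1 • p - v • v • pd x p
        + (3 : ℕ) • v • ⁅p, b⁆ := by
      rw [linearB]
      simp only [lie_add, lie_sub, lie_nsmul, fun_lie_smul, smul_lie, nsmul_lie, lie_self]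
      linear_combination (norm := module) (-v * U 1) • h1 + (v * v) • h2
    rw [zero_add, field_totalX_linearB hp hb hb', h3, h4, ht, taylorAt_X a (u 0), ← C_smul]
    module
  A_zero μ hμ := by
    rw [map_nsmul, coeff_X_smul_eq_zero (hμ 0), smul_zero]
  B_zero μ hx hμ := by
    have h1 := h0 μ hx hμ
    rw [linearB, taylorAt_X, taylorAt_X]
    simp only [map_add, map_sub, map_nsmul, C_smul, map_smul, add_smul,
      coeff_X_smul_eq_zero (hμ _)] at h1 ⊢
    linear_combination (norm := module) h1
  A_one μ r hr hrp := by omega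

theorem quadCoeff_linear (hp : p.NoU) : quadCoeff ((3 : ℕ) • v • p) = 0 := by
  rw [quadCoeff, map_nsmul, pd_X_smul_self, hp 0, smul_zero, add_zero, map_nsmul, hp 0, smul_zero,
    smul_zero]

theorem linCoeff_linear (hp : p.NoU) : linCoeff ((3 : ℕ) • v • p) = (3 : ℕ) • p := by
  rw [linCoeff, quadCoeff_linear hp, map_nsmul, pd_X_smul_self, hp 0, smul_zero, add_zero,
    smul_zero, sub_zero]

theorem core_linear (hp : p.NoU) (h1 : (9 : ℕ) • ⁅p, pd x p⁆ = -p) :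
    core ((3 : ℕ) • v • p) = (-9 : ℂ) • p := by
  rw [← Nat.cast_smul_eq_nsmul ℂ] at h1
  rw [core, linCoeff_linear hp, map_nsmul, lie_nsmul, nsmul_lie]
  push_cast at h1
  linear_combination (norm := module) (9 : ℂ) • h1

theorem centralPart_linear (hp : p.NoU) (h1 : (9 : ℕ) • ⁅p, pd x p⁆ = -p) :
    centralPart ((3 : ℕ) • v • p) = 0 := by
  rw [← Nat.cast_smul_eq_nsmul ℂ] at h1
  rw [centralPart, quadCoeff_linear hp, linCoeff_linear hp, map_nsmul, lie_nsmul, nsmul_lie,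
    map_zero, smul_zero, smul_zero, sub_zero]
  push_cast at h1
  linear_combination (norm := module) h1

end Construction

end PSeries

end JetCoord

/-! ### The Lax pair with values in sl_2(ℂ[λ]) -/

namespace JetCoord

namespace PSeries

variable {L L' : Type} [LieRing L] [LieAlgebra ℂ L] [LieRing L'] [LieAlgebra ℂ L']

theorem ev_map (φ : L →ₗ⁅ℂ⁆ L') (S : PSeries L) : ev (map φ S) = φ (ev S) := rfl

theorem map_quadCoeff (φ : L →ₗ⁅ℂ⁆ L') (A : PSeries L) :
    map φ (quadCoeff A) = quadCoeff (map φ A) := by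
  rw [quadCoeff, quadCoeff, map_smul, map_pd, map_pd]

theorem map_linCoeff (φ : L →ₗ⁅ℂ⁆ L') (A : PSeries L) :
    map φ (linCoeff A) = linCoeff (map φ A) := by
  rw [linCoeff, linCoeff, map_sub, map_nsmul, map_fun_smul, map_pd, map_quadCoeff]

theorem map_core (φ : L →ₗ⁅ℂ⁆ L') (A : PSeries L) : map φ (core A) = core (map φ A) := by
  rw [core, core, map_smul, LieHom.map_lie, map_pd, map_linCoeff]

theorem map_centralPart (φ : L →ₗ⁅ℂ⁆ L') (A : PSeries L) :
    map φ (centralPart A) = centralPart (map φ A) := by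
  rw [centralPart, centralPart, map_add, LieHom.map_lie, map_smul, map_sub, map_smul,
    map_fun_smul, map_pd, map_pd, map_linCoeff, map_quadCoeff]

theorem map_iterate_pd (φ : L →ₗ⁅ℂ⁆ L') (c : JetCoord) (n : ℕ) (S : PSeries L) :
    map φ ((pd c)^[n] S) = (pd c)^[n] (map φ S) := by
  induction n generalizing S with
  | zero => rfl
  | succ n ih => rw [Function.iterate_succ_apply, Function.iterate_succ_apply, ih, map_pd]

end PSeries

section Sl2

open Polynomial

/-- The matrix with entries `p, q, s, -p`. -/
noncomputable def sl2Mk (p q s : ℂ[X]) : Sl2Poly :=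
  (⟨!![p, q; s, -p], by
    change Matrix.trace !![p, q; s, -p] = 0
    simp [Matrix.trace_fin_two]⟩ : LieAlgebra.SpecialLinear.sl (Fin 2) ℂ[X])

theorem sl2Mk_surjective (y : Sl2Poly) : ∃ p q s, y = sl2Mk p q s := by
  obtain ⟨m, hm⟩ := (y : LieAlgebra.SpecialLinear.sl (Fin 2) ℂ[X])
  have hm' : m 0 0 + m 1 1 = 0 := by
    rw [← Matrix.trace_fin_two]
    exact hm
  refine ⟨m 0 0, m 0 1, m 1 0, Subtype.ext ?_⟩
  refine Matrix.ext fun i j => ?_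
  fin_cases i <;> fin_cases j
  exacts [rfl, rfl, rfl, (neg_eq_of_add_eq_zero_right hm').symm]

theorem sl2Mk_eq_zero {p q s : ℂ[X]} (h : sl2Mk p q s = 0) : p = 0 ∧ q = 0 ∧ s = 0 := by
  have h' : (!![p, q; s, -p] : Matrix (Fin 2) (Fin 2) ℂ[X]) = 0 := congrArg Subtype.val h
  exact ⟨congrFun (congrFun h' 0) 0, congrFun (congrFun h' 0) 1, congrFun (congrFun h' 1) 0⟩

theorem sl2Mk_zero : sl2Mk 0 0 0 = 0 := by
  apply Subtype.ext
  refine Matrix.ext fun i j => ?_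
  fin_cases i <;> fin_cases j
  exacts [rfl, rfl, rfl, neg_zero]

theorem sl2Mk_add (p q s p' q' s' : ℂ[X]) :
    sl2Mk p q s + sl2Mk p' q' s' = sl2Mk (p + p') (q + q') (s + s') := by
  apply Subtype.ext
  refine Matrix.ext fun i j => ?_
  fin_cases i <;> fin_cases j
  exacts [rfl, rfl, rfl, (neg_add p p').symm]

theorem smul_sl2Mk (r : ℂ) (p q s : ℂ[X]) :
    r • sl2Mk p q s = sl2Mk (C r * p) (C r * q) (C r * s) := by
  apply Subtype.ext
  refine Matrix.ext fun i j => ?_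
  fin_cases i <;> fin_cases j
  exacts [rfl, rfl, rfl, mul_neg (C r) p]

theorem lie_sl2Mk (p q s p' q' s' : ℂ[X]) : ⁅sl2Mk p q s, sl2Mk p' q' s'⁆
    = sl2Mk (q * s' - s * q') (2 * (p * q' - q * p')) (2 * (s * p' - p * s')) := by
  apply Subtype.ext
  change (!![p, q; s, -p] : Matrix (Fin 2) (Fin 2) ℂ[X]) * !![p', q'; s', -p']
    - !![p', q'; s', -p'] * !![p, q; s, -p] = !![_, _; _, _]
  rw [Matrix.mul_fin_two, Matrix.mul_fin_two]
  refine Matrix.ext fun i j => ?_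
  fin_cases i <;> fin_cases j <;> simp <;> ring

theorem nsmul_sl2Mk (n : ℕ) (p q s : ℂ[X]) :
    n • sl2Mk p q s = sl2Mk (n * p) (n * q) (n * s) := by
  rw [← Nat.cast_smul_eq_nsmul ℂ, smul_sl2Mk]
  simp

theorem neg_sl2Mk (p q s : ℂ[X]) : -sl2Mk p q s = sl2Mk (-p) (-q) (-s) := by
  rw [neg_eq_iff_add_eq_zero, sl2Mk_add]
  simp [sl2Mk_zero]

end Sl2

section FlatSection

open PSeries

variable {L : Type} [LieRing L] [LieAlgebra ℂ L]

/-- The constant term of the component `B` of a zero-curvature representation. -/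
noncomputable def flatConst (a : Point) (α α' e : L) : L :=
  (3 : ℕ) • a (u 2) • e - (3 : ℕ) • a (u 1) • ⁅α, e⁆ + (α' + a (u 0) • α)

/-- The `A`-component of a zero-curvature representation of the KdV equation. -/
noncomputable def flatP (a : Point) (α α' e : L) : PSeries L :=
  expSeries α (flatConst a α α' e) e

variable {a : Point} {α α' e : L}

theorem noU_flatP : (flatP a α α' e).NoU := noU_expSeries _ _ _

theorem lie_flatP (h1 : (9 : ℕ) • ⁅e, ⁅α, e⁆⁆ = -e) :
    (9 : ℕ) • ⁅flatP a α α' e, pd x (flatP a α α' e)⁆ = -flatP a α α' e := by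
  rw [← Nat.cast_smul_eq_nsmul ℂ] at h1 ⊢
  rw [flatP, pd_x_expSeries, lie_expSeries, ← expSeries_smul, h1, ← neg_one_smul ℂ,
    expSeries_smul, neg_one_smul]

/-- The zero-curvature representation of the KdV equation defined by elements that satisfy the
relations between `(λ e + f) / 2`, its multiple by `λ`, and a multiple of `e`. -/
theorem isNormalZCR_flat (h1 : (9 : ℕ) • ⁅e, ⁅α, e⁆⁆ = -e)
    (h2 : (9 : ℕ) • ⁅e, ⁅α, ⁅α, e⁆⁆⁆ = -⁅α, e⁆) (hα : ⁅α, α'⁆ = 0)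
    (h3 : ⁅e, α'⁆ = -⁅α, ⁅α, ⁅α, e⁆⁆⁆) :
    IsNormalZCR a 0 ((3 : ℕ) • (MvPolynomial.X (u 0) : Fun) • flatP a α α' e)
      (linearB a (flatP a α α' e) (expSeries α (flatConst a α α' e) (α' + a (u 0) • α)
        - const (flatConst a α α' e))) := by
  have hneg : ∀ β y : L, expSeries α β (-y) = -expSeries α β y := fun β y => by
    rw [← neg_one_smul ℂ, expSeries_smul, neg_one_smul]
  have hzero : ∀ β : L, expSeries α β 0 = 0 := fun β => by
    rw [← zero_smul ℂ 0, expSeries_smul, zero_smul]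
  refine isNormalZCR_linear noU_flatP ((noU_expSeries _ _ _).sub (noU_const _)) ?_ (lie_flatP h1)
    ?_ ?_ ?_
  · rw [map_sub, pd_const, pd_x_expSeries, lie_add, lie_smul, lie_self, hα, smul_zero, add_zero,
      hzero, sub_zero]
  · rw [← Nat.cast_smul_eq_nsmul ℂ] at h2 ⊢
    rw [flatP, pd_x_expSeries, pd_x_expSeries, lie_expSeries, ← expSeries_smul, h2, hneg]
  · rw [flatP, pd_t_expSeries, pd_x_expSeries, pd_x_expSeries, pd_x_expSeries, lie_sub,
      lie_expSeries, lie_add, lie_smul, h3, ← lie_skew e α, expSeries_add, expSeries_smul, hneg,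
      hneg, ← lie_skew (const _)]
    module
  -- On the t-axis the required combination is the exponential series of `flatConst` minus its
  -- constant term; `flatConst` is defined to make this so.
  · intro μ hx hμ
    rw [← coeff_expSeries_self_sub_const α (flatConst a α α' e) hx hμ]
    have key : ∀ β : L, expSeries α β (flatConst a α α' e) = (3 : ℕ) • a (u 2) • expSeries α β e
        - (3 : ℕ) • a (u 1) • expSeries α β ⁅α, e⁆ + expSeries α β (α' + a (u 0) • α) := by
      intro β
      simp only [flatConst, sub_eq_add_neg, expSeries_add, hneg, ← Nat.cast_smul_eq_nsmul ℂ,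
        expSeries_smul]
    rw [key, flatP, pd_x_expSeries]
    congr 1
    abel

theorem exists_hom_flat (h1 : (9 : ℕ) • ⁅e, ⁅α, e⁆⁆ = -e)
    (h2 : (9 : ℕ) • ⁅e, ⁅α, ⁅α, e⁆⁆⁆ = -⁅α, e⁆) (hα : ⁅α, α'⁆ = 0)
    (h3 : ⁅e, α'⁆ = -⁅α, ⁅α, ⁅α, e⁆⁆⁆) :
    ∃ φ : FAlg kdv 3 0 a →ₗ⁅ℂ⁆ L, φ (genE a) = (-9 : ℂ) • e ∧
      φ (genF a) = (-9 : ℂ) • ⁅α, ⁅α, e⁆⁆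
        - (1 / 2 : ℂ) • ⁅(-9 : ℂ) • e, (-9 : ℂ) • ⁅α, ⁅α, ⁅α, e⁆⁆⁆⁆ ∧
      φ (genH₁ a) = (-9 : ℂ) • ⁅α, ⁅α, ⁅α, e⁆⁆⁆ ∧ φ (ev (centralPart (genA kdv 3 0 a))) = 0 ∧
      φ (ev (quadCoeff (genA kdv 3 0 a))) = 0 ∧ φ (ev (pd t (quadCoeff (genA kdv 3 0 a)))) = 0 := by
  obtain ⟨φ, hA, -⟩ := exists_hom_of_isNormalZCR (isNormalZCR_flat (a := a) h1 h2 hα h3)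
  have hr : map φ (core (genA kdv 3 0 a)) = (-9 : ℂ) • flatP a α α' e := by
    rw [map_core, hA, core_linear noU_flatP (lie_flatP h1)]
  refine ⟨φ, ?_, ?_, ?_, ?_, ?_, ?_⟩
  · rw [genE, ← ev_map, hr, map_smul, flatP, ev_expSeries]
  · rw [genF, ← ev_map, map_sub, map_smul, LieHom.map_lie, map_iterate_pd, map_iterate_pd, map_sub,
      map_smul, LieHom.map_lie, hr]
    simp only [Function.iterate_succ_apply, Function.iterate_zero, id, map_smul, flatP,
      pd_x_expSeries, ev_expSeries]
  · rw [genH₁, ← ev_map, map_iterate_pd, hr]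
    simp only [Function.iterate_succ_apply, Function.iterate_zero, id, map_smul, flatP,
      pd_x_expSeries, ev_expSeries]
  · rw [← ev_map, map_centralPart, hA, centralPart_linear noU_flatP (lie_flatP h1), map_zero]
  · rw [← ev_map, map_quadCoeff, hA, quadCoeff_linear noU_flatP, map_zero]
  · rw [← ev_map, map_pd, map_quadCoeff, hA, quadCoeff_linear noU_flatP, map_zero, map_zero]

end FlatSection

section Sl2Hom

open PSeries Polynomial

variable (a : Point)

local notation "𝔸" => genA kdv 3 0 a

theorem exists_hom_sl2 : ∃ φ : FAlg kdv 3 0 a →ₗ⁅ℂ⁆ Sl2Poly, φ (genE a) = sl2Mk 0 1 0 ∧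
    φ (genF a) = sl2Mk 0 0 (-C (1 / 2)) ∧ φ (genH₁ a) = sl2Mk (-C (1 / 2) * X) 0 0 ∧
    φ (ev (centralPart 𝔸)) = 0 ∧ φ (ev (quadCoeff 𝔸)) = 0 ∧ φ (ev (pd t (quadCoeff 𝔸))) = 0 := by
  obtain ⟨c, hc⟩ : ∃ c : ℂ[X], c = C (1 / 2) := ⟨_, rfl⟩
  obtain ⟨k, hk⟩ : ∃ k : ℂ[X], k = C (1 / 9) := ⟨_, rfl⟩
  have hc2 : 2 * c = 1 := by rw [hc, ← C_ofNat, ← C_mul]; norm_num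
  have hk9 : 9 * k = 1 := by rw [hk, ← C_ofNat, ← C_mul]; norm_num
  -- Here c = 1/2 and k = 1/9. The element α is ½λe - f, by which x-differentiation acts, for e =
  -- E₁₂ and f = -½E₂₁; α' is λα, and the local `e` is -E₁₂/9 because `core` multiplies it by -9.
  let α := sl2Mk 0 (c * X) c
  let α' := sl2Mk 0 (c * X * X) (c * X)
  let e := sl2Mk 0 (-k) 0
  have e1 : ⁅α, e⁆ = sl2Mk (c * k) 0 0 := by
    rw [lie_sl2Mk]
    congr 1 <;> ring
  have e2 : ⁅α, ⁅α, e⁆⁆ = sl2Mk 0 (-c * k * X) (c * k) := by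
    rw [e1, lie_sl2Mk]
    congr 1
    · ring
    · linear_combination -c * k * X * hc2
    · linear_combination c * k * hc2
  have e3 : ⁅α, ⁅α, ⁅α, e⁆⁆⁆ = sl2Mk (c * k * X) 0 0 := by
    rw [e2, lie_sl2Mk]
    congr 1
    · linear_combination c * k * X * hc2
    · ring
    · ring
  have r1 : (9 : ℕ) • ⁅e, ⁅α, e⁆⁆ = -e := by
    rw [e1, lie_sl2Mk, nsmul_sl2Mk, neg_sl2Mk]
    push_cast
    congr 1
    · ring
    · linear_combination 9 * k ^ 2 * hc2 + k * hk9
    · ring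
  have r2 : (9 : ℕ) • ⁅e, ⁅α, ⁅α, e⁆⁆⁆ = -⁅α, e⁆ := by
    rw [e2, e1, lie_sl2Mk, nsmul_sl2Mk, neg_sl2Mk]
    push_cast
    congr 1
    · linear_combination -c * k * hk9
    · ring
    · ring
  have rα : ⁅α, α'⁆ = 0 := by
    rw [lie_sl2Mk, ← sl2Mk_zero]
    congr 1 <;> ring
  have r3 : ⁅e, α'⁆ = -⁅α, ⁅α, ⁅α, e⁆⁆⁆ := by
    rw [e3, lie_sl2Mk, neg_sl2Mk]
    congr 1 <;> ring
  have hC9 : (C (-9 : ℂ) : ℂ[X]) = -9 := by rw [C_neg, C_ofNat]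
  have hE : (-9 : ℂ) • e = sl2Mk 0 1 0 := by
    rw [smul_sl2Mk, hC9]
    congr 1
    · ring
    · linear_combination hk9
    · ring
  have hH : (-9 : ℂ) • ⁅α, ⁅α, ⁅α, e⁆⁆⁆ = sl2Mk (-c * X) 0 0 := by
    rw [e3, smul_sl2Mk, hC9]
    congr 1
    · linear_combination -c * X * hk9
    · ring
    · ring
  obtain ⟨φ, pE, pF, pH, pZ⟩ := exists_hom_flat (a := a) r1 r2 rα r3
  refine ⟨φ, pE.trans hE, pF.trans ?_, ?_, pZ⟩
  · rw [hE, hH, e2, lie_sl2Mk, smul_sl2Mk, smul_sl2Mk, sub_eq_add_neg, neg_sl2Mk, sl2Mk_add, hC9,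
      ← hc]
    congr 1
    · ring
    · linear_combination c * X * hk9 - c * X * hc2
    · linear_combination -c * hk9
  · rw [← hc]
    exact pH.trans hH

end Sl2Hom

end JetCoord

/-! ### Conservation laws and the abelian summand -/

namespace JetCoord

/-- The three-dimensional abelian Lie algebra. -/
def Abelian3 : Type := Fin 3 → ℂ

namespace Abelian3

noncomputable instance : AddCommGroup Abelian3 := inferInstanceAs (AddCommGroup (Fin 3 → ℂ))

noncomputable instance : Module ℂ Abelian3 := inferInstanceAs (Module ℂ (Fin 3 → ℂ))

noncomputable instance : LieRing Abelian3 where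
  bracket _ _ := 0
  add_lie _ _ _ := (add_zero 0).symm
  lie_add _ _ _ := (add_zero 0).symm
  lie_self _ := rfl
  leibniz_lie _ _ _ := (add_zero 0).symm

noncomputable instance : LieAlgebra ℂ Abelian3 where
  lie_smul _ _ _ := (smul_zero _).symm

instance : IsLieAbelian Abelian3 := ⟨fun _ _ => rfl⟩

theorem finrank_eq : Module.finrank ℂ Abelian3 = 3 := Module.finrank_fin_fun ℂ

/-- The standard basis. -/
noncomputable def basis (i : Fin 3) : Abelian3 := Pi.single (M := fun _ : Fin 3 => ℂ) i 1

theorem eq_sum (c : Abelian3) : ∃ r₀ r₁ r₂ : ℂ, c = r₀ • basis 0 + r₁ • basis 1 + r₂ • basis 2 := by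
  refine ⟨c 0, c 1, c 2, funext fun i => ?_⟩
  change c i = c 0 * (Pi.single 0 1 : Fin 3 → ℂ) i + c 1 * (Pi.single 1 1 : Fin 3 → ℂ) i
    + c 2 * (Pi.single 2 1 : Fin 3 → ℂ) i
  fin_cases i <;> simp

theorem eq_zero_of_sum {r₀ r₁ r₂ : ℂ} (h : r₀ • basis 0 + r₁ • basis 1 + r₂ • basis 2 = 0) :
    r₀ = 0 ∧ r₁ = 0 ∧ r₂ = 0 := by
  have h' : ∀ i, r₀ * (Pi.single 0 1 : Fin 3 → ℂ) i + r₁ * (Pi.single 1 1 : Fin 3 → ℂ) i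
    + r₂ * (Pi.single 2 1 : Fin 3 → ℂ) i = 0 := fun i => congrFun h i
  exact ⟨by simpa using h' 0, by simpa using h' 1, by simpa using h' 2⟩

end Abelian3

namespace PSeries

section ConservationLaws

variable (a : Point) {L : Type} [LieRing L] [LieAlgebra ℂ L]

local notation "X" => (MvPolynomial.X x : Fun)
local notation "T" => (MvPolynomial.X t : Fun)
local notation "v" => (MvPolynomial.X (u 0) : Fun)
local notation "v₁" => (MvPolynomial.X (u 1) : Fun)
local notation "v₂" => (MvPolynomial.X (u 2) : Fun)
local notation "α" k:max => (MvPolynomial.C (a (u k)) : Fun)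

/-- The current of the conserved density `2 u_0`. -/
noncomputable def massCurrent : Fun := 2 * v₂ + v * (2 * α 0 + v)

/-- The current of the conserved density `3 (u_0 - a_0)^2`. -/
noncomputable def momentumCurrent : Fun :=
  v * (6 * (v₂ + α 2) + 2 * v * v + 3 * α 0 * v) - 3 * v₁ * (v₁ + 2 * α 1)

/-- The current of the conserved density that expresses Galilean invariance. -/
noncomputable def galileanCurrent : Fun :=
  3 * X * massCurrent a + 6 * α 2 * X - 6 * v₁ + T * (momentumCurrent a + 3 * α 0 * massCurrent a)

/-- The density that expresses Galilean invariance. -/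
noncomputable def galileanDensity : Fun := v * (6 * X + 3 * T * v + 6 * α 0 * T)

/-- A vector field applied to a polynomial. -/
noncomputable def fieldPoly (V : JetCoord → Fun) (n : ℕ) (g : Fun) : Fun :=
  taylorAt a (V x) * MvPolynomial.pderiv x g + taylorAt a (V t) * MvPolynomial.pderiv t g
    + ∑ k ∈ Finset.range (n + 1), taylorAt a (V (u k)) * MvPolynomial.pderiv (u k) g

theorem field_smul_const (V : JetCoord → Fun) (n : ℕ) (g : Fun) (y : L) :
    field V a n (g • const y) = fieldPoly a V n g • const y := by
  rw [field_smul, (noU_const y).field_eq]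
  simp [pd_const, fieldPoly]

theorem pderiv_ofNat (c : JetCoord) (n : ℕ) [n.AtLeastTwo] :
    MvPolynomial.pderiv c (OfNat.ofNat n : Fun) = 0 :=
  Derivation.map_natCast (MvPolynomial.pderiv c) n

theorem fieldPoly_massCurrent : fieldPoly a totalX 2 (massCurrent a)
    = fieldPoly a (totalT kdv) 0 (v * 2) := by
  simp [fieldPoly, massCurrent, Finset.sum_range_succ, totalX, totalT, kdv, taylorAt,
    pderiv_ofNat _ 2, MvPolynomial.pderiv_X, Pi.single_apply]
  ring

theorem fieldPoly_momentumCurrent : fieldPoly a totalX 2 (momentumCurrent a)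
    = fieldPoly a (totalT kdv) 0 (v * (3 * v)) := by
  simp [fieldPoly, momentumCurrent, Finset.sum_range_succ, totalX, totalT, kdv, taylorAt,
    pderiv_ofNat _ 2, pderiv_ofNat _ 3, pderiv_ofNat _ 6, MvPolynomial.pderiv_X, Pi.single_apply]
  ring

theorem fieldPoly_galileanCurrent : fieldPoly a totalX 2 (galileanCurrent a)
    = fieldPoly a (totalT kdv) 0 (galileanDensity a) := by
  simp [fieldPoly, galileanCurrent, galileanDensity, massCurrent, momentumCurrent,
    Finset.sum_range_succ, totalX, totalT, kdv, taylorAt,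
    pderiv_ofNat _ 2, pderiv_ofNat _ 3, pderiv_ofNat _ 6, MvPolynomial.pderiv_X, Pi.single_apply]
  ring

/-- The coefficients of the powers of `t - t_0` vanish. -/
def VanishesOnT (S : PSeries L) : Prop := ∀ μ : Mono, μ x = 0 → μ.NoU → coeff μ S = 0

theorem VanishesOnT.add {S S' : PSeries L} (h : VanishesOnT S) (h' : VanishesOnT S') :
    VanishesOnT (S + S') := fun μ hx hμ => by rw [map_add, h μ hx hμ, h' μ hx hμ, add_zero]

theorem VanishesOnT.sub {S S' : PSeries L} (h : VanishesOnT S) (h' : VanishesOnT S') :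
    VanishesOnT (S - S') := fun μ hx hμ => by rw [map_sub, h μ hx hμ, h' μ hx hμ, sub_zero]

theorem VanishesOnT.fun_smul {S : PSeries L} (h : VanishesOnT S) (g : Fun) :
    VanishesOnT (g • S) := fun μ hx hμ => by
  rw [coeff_fun_smul]
  refine Finset.sum_eq_zero fun q hq => ?_
  rw [Finset.HasAntidiagonal.mem_antidiagonal] at hq
  have hle : ∀ c, q.2 c ≤ μ c := fun c => by rw [← hq, Finsupp.add_apply]; omega
  rw [h q.2 (Nat.le_zero.1 (hx ▸ hle x)) (fun k => Nat.le_zero.1 (hμ k ▸ hle (u k))), smul_zero]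

theorem vanishesOnT_X_smul (S : PSeries L) : VanishesOnT (X • S) :=
  fun _ hx _ => coeff_X_smul_eq_zero hx S

theorem vanishesOnT_u_smul (k : ℕ) (S : PSeries L) :
    VanishesOnT ((MvPolynomial.X (u k) : Fun) • S) :=
  fun _ _ hμ => coeff_X_smul_eq_zero (hμ k) S

theorem vanishesOnT_massCurrent (S : PSeries L) : VanishesOnT (massCurrent a • S) := by
  rw [massCurrent, add_smul, mul_smul, mul_smul]
  exact ((vanishesOnT_u_smul 2 S).fun_smul _).add (vanishesOnT_u_smul 0 _)

theorem vanishesOnT_momentumCurrent (S : PSeries L) : VanishesOnT (momentumCurrent a • S) := by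
  rw [momentumCurrent, mul_assoc 3, sub_smul, mul_smul, mul_smul, mul_smul]
  exact (vanishesOnT_u_smul 0 _).sub ((vanishesOnT_u_smul 1 _).fun_smul _)

theorem vanishesOnT_galileanCurrent (S : PSeries L) : VanishesOnT (galileanCurrent a • S) := by
  rw [galileanCurrent, add_smul, sub_smul, add_smul, mul_smul (3 * X), mul_smul (6 * α 2),
    mul_smul _ v₁, mul_smul T, add_smul, mul_smul (3 * α 0)]
  exact ((((vanishesOnT_massCurrent a S).fun_smul _).add
    ((vanishesOnT_X_smul S).fun_smul _)).sub ((vanishesOnT_u_smul 1 S).fun_smul _)).add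
    (((vanishesOnT_momentumCurrent a S).add
      ((vanishesOnT_massCurrent a S).fun_smul _)).fun_smul _)

/-- The density of a combination of conservation laws. -/
noncomputable def abelianA (y₀ y₁ y₂ : L) : PSeries L :=
  (v * 2) • const y₀ + (v * (3 * v)) • const y₁ + galileanDensity a • const y₂

/-- The current of a combination of conservation laws. -/
noncomputable def abelianB (y₀ y₁ y₂ : L) : PSeries L :=
  massCurrent a • const y₀ + momentumCurrent a • const y₁ + galileanCurrent a • const y₂

theorem pd_smul_const (c : JetCoord) (g : Fun) (y : L) :
    pd c (g • const y) = MvPolynomial.pderiv c g • const y := by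
  rw [pd_smul, pd_const, smul_zero, add_zero]

theorem isNormalZCR_abelian [IsLieAbelian L] (y₀ y₁ y₂ : L) :
    IsNormalZCR a 0 (abelianA a y₀ y₁ y₂) (abelianB a y₀ y₁ y₂) where
  A_order k hk := by
    have h0 : k ≠ 0 := by omega
    simp [abelianA, galileanDensity, pd_smul_const, pderiv_ofNat _ 2, pderiv_ofNat _ 3, pderiv_ofNat _ 6, MvPolynomial.pderiv_X, h0]
  B_order k hk := by
    have h0 : k ≠ 0 := by omega
    have h1 : k ≠ 1 := by omega
    have h2 : k ≠ 2 := by omega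
    simp [abelianB, galileanCurrent, massCurrent, momentumCurrent, pd_smul_const, pderiv_ofNat _ 2,
      pderiv_ofNat _ 3, pderiv_ofNat _ 6, MvPolynomial.pderiv_X, h0, h1, h2]
  zcr := by
    have h0 : ⁅abelianA a y₀ y₁ y₂, abelianB a y₀ y₁ y₂⁆ = 0 := by
      ext μ
      rw [coeff_lie, map_zero]
      exact Finset.sum_eq_zero fun q _ => trivial_lie_zero _ _ _ _
    rw [h0, add_zero, sub_eq_zero, abelianA, abelianB]
    simp only [map_add, field_smul_const, zero_add, fieldPoly_massCurrent,
      fieldPoly_momentumCurrent, fieldPoly_galileanCurrent]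
  A_zero μ hμ := by
    rw [abelianA, galileanDensity, mul_smul, mul_smul v (3 * v), mul_smul v (_ + _), map_add, map_add,
      coeff_X_smul_eq_zero (hμ 0), coeff_X_smul_eq_zero (hμ 0), coeff_X_smul_eq_zero (hμ 0),
      add_zero, add_zero]
  B_zero :=
    ((vanishesOnT_massCurrent a _).add (vanishesOnT_momentumCurrent a _)).add
      (vanishesOnT_galileanCurrent a _)
  A_one μ r hr hrp := by omega

theorem quadCoeff_abelian (y₀ y₁ y₂ : L) :
    quadCoeff (abelianA a y₀ y₁ y₂) = (3 : ℕ) • const y₁ + (T * 3) • const y₂ := by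
  have h : ∀ (S S' : PSeries L), S = (2 : ℕ) • S' → (1 / 2 : ℂ) • S = S' := by
    rintro _ S rfl
    rw [← Nat.cast_smul_eq_nsmul ℂ, smul_smul]
    norm_num
  apply h
  simp [abelianA, galileanDensity, pd_smul_const, pderiv_ofNat _ 2, pderiv_ofNat _ 3, pderiv_ofNat _ 6, MvPolynomial.pderiv_X]
  module

theorem linCoeff_abelian (y₀ y₁ y₂ : L) : linCoeff (abelianA a y₀ y₁ y₂)
    = (2 : ℕ) • const y₀ + (X * 6 + T * (6 * α 0)) • const y₂ := by
  rw [linCoeff, quadCoeff_abelian]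
  simp [abelianA, galileanDensity, pd_smul_const, pderiv_ofNat _ 2, pderiv_ofNat _ 3, pderiv_ofNat _ 6, MvPolynomial.pderiv_X]
  module

/-- The densities 2v, 3v² and the Galilean one contribute to different invariants: 2v to P, 3v² to
Q, and the term 3tv² to Q_t. This separates the three central generators. -/
theorem exists_hom_abelian [IsLieAbelian L] (y₀ y₁ y₂ : L) :
    ∃ φ : FAlg kdv 3 0 a →ₗ⁅ℂ⁆ L, φ (ev (centralPart (genA kdv 3 0 a))) = (2 / 3 : ℂ) • y₀ ∧
      φ (ev (quadCoeff (genA kdv 3 0 a))) = (3 : ℂ) • y₁ ∧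
      φ (ev (pd t (quadCoeff (genA kdv 3 0 a)))) = (3 : ℂ) • y₂ := by
  obtain ⟨φ, hA, -⟩ := exists_hom_of_isNormalZCR (isNormalZCR_abelian a y₀ y₁ y₂)
  have hX : ∀ (c : JetCoord) (S : PSeries L), ev ((MvPolynomial.X c : Fun) • S) = 0 :=
    fun c S => by rw [ev_apply, coeff_X_smul_eq_zero rfl]
  have hc : ∀ y : L, ev (const y) = y := fun y => by rw [ev_apply, coeff_const_zero]
  have ht : pd t (quadCoeff (abelianA a y₀ y₁ y₂)) = (3 : ℕ) • const y₂ := by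
    rw [quadCoeff_abelian, map_add, map_nsmul, pd_const, pd_smul_const]
    simp [pderiv_ofNat _ 3, ofNat_smul_eq_nsmul Fun]
  refine ⟨φ, ?_, ?_, ?_⟩
  · have h0 : ∀ S : PSeries L, ⁅S, pd x S⁆ = 0 := fun S => by
      ext μ
      rw [coeff_lie, map_zero]
      exact Finset.sum_eq_zero fun q _ => trivial_lie_zero _ _ _ _
    rw [← ev_map, map_centralPart, hA, centralPart, h0, ht, linCoeff_abelian, add_smul,
      mul_smul, mul_smul, zero_add, map_smul, map_sub, map_add, map_add, map_nsmul, hX, hX,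
      map_smul, hX, hc]
    module
  · rw [← ev_map, map_quadCoeff, hA, quadCoeff_abelian, mul_smul, map_add, hX, map_nsmul, hc]
    module
  · rw [← ev_map, map_pd, map_quadCoeff, hA, ht, map_nsmul, hc]
    module

end ConservationLaws

end PSeries

end JetCoord

/-! ### Coordinates on level 0 and the isomorphism -/

namespace JetCoord

open PSeries

section Combination

open Polynomial

variable {L L' : Type} [LieRing L] [LieAlgebra ℂ L] [LieRing L'] [LieAlgebra ℂ L']

/-- The combination of the elements `w n` whose coefficients are those of a polynomial. -/
noncomputable def combination (w : ℕ → L) : ℂ[X] →ₗ[ℂ] L :=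
  (Polynomial.basisMonomials ℂ).constr ℂ w

theorem combination_monomial (w : ℕ → L) (n : ℕ) (r : ℂ) :
    combination w (monomial n r) = r • w n := by
  have h := (Polynomial.basisMonomials ℂ).constr_basis ℂ w n
  rw [Polynomial.coe_basisMonomials] at h
  rw [combination, ← h, ← map_smul, smul_monomial, smul_eq_mul, mul_one]

theorem span_le_range_combination (w : ℕ → L) :
    Submodule.span ℂ (Set.range w) ≤ LinearMap.range (combination w) := by
  rw [Submodule.span_le]
  rintro _ ⟨n, rfl⟩
  exact ⟨monomial n 1, by rw [combination_monomial, one_smul]⟩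

theorem exists_combination {e f h₁ : L} {Z : Submodule ℂ L} {y : L}
    (hy : y ∈ currentSpan e f h₁ ⊔ Z) : ∃ (p q s : ℂ[X]), ∃ z ∈ Z,
      y = combination (currentH e f h₁) p + combination (currentE e h₁) q
        + combination (currentF e f h₁) s + z := by
  obtain ⟨c, hc, z, hz, rfl⟩ := Submodule.mem_sup.1 hy
  rw [currentSpan, Submodule.span_union, Submodule.span_union] at hc
  obtain ⟨c', hc', y₃, h₃, rfl⟩ := Submodule.mem_sup.1 hc
  obtain ⟨y₁, h₁, y₂, h₂, rfl⟩ := Submodule.mem_sup.1 hc'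
  obtain ⟨q, rfl⟩ := span_le_range_combination _ h₁
  obtain ⟨p, rfl⟩ := span_le_range_combination _ h₂
  obtain ⟨s, rfl⟩ := span_le_range_combination _ h₃
  exact ⟨p, q, s, z, hz, by abel⟩

theorem map_combination (φ : L →ₗ⁅ℂ⁆ L') (w : ℕ → L) (p : ℂ[X]) :
    φ (combination w p) = combination (fun n => φ (w n)) p := by
  induction p using Polynomial.induction_on' with
  | add p q hp hq => rw [map_add, map_add, map_add, hp, hq]
  | monomial n r => rw [combination_monomial, combination_monomial, map_smul]

theorem currentE_sl2 (n : ℕ) :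
    currentE (sl2Mk 0 1 0) (sl2Mk (-C (1 / 2) * X) 0 0) n = sl2Mk 0 (X ^ n) 0 := by
  have h2 : 2 * (C (1 / 2) : ℂ[X]) = 1 := by rw [← C_ofNat, ← C_mul]; norm_num
  induction n with
  | zero => rw [currentE, pow_zero]
  | succ n ih =>
    rw [currentE, ih, lie_sl2Mk]
    congr 1
    · ring
    · linear_combination X ^ (n + 1) * h2
    · ring

theorem currentH_sl2 (n : ℕ) :
    currentH (sl2Mk 0 1 0) (sl2Mk 0 0 (-C (1 / 2))) (sl2Mk (-C (1 / 2) * X) 0 0) n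
      = sl2Mk (-C (1 / 2) * X ^ n) 0 0 := by
  rw [currentH, currentE_sl2, lie_sl2Mk]
  congr 1 <;> ring

theorem currentF_sl2 (n : ℕ) :
    currentF (sl2Mk 0 1 0) (sl2Mk 0 0 (-C (1 / 2))) (sl2Mk (-C (1 / 2) * X) 0 0) n
      = sl2Mk 0 0 (-C (1 / 2) * X ^ n) := by
  have h2 : 2 * (C (1 / 2) : ℂ[X]) = 1 := by rw [← C_ofNat, ← C_mul]; norm_num
  rw [currentF, currentH_sl2, lie_sl2Mk]
  congr 1
  · ring
  · ring
  · linear_combination -C (1 / 2) * X ^ n * h2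

theorem combination_sl2Mk (w₀ w₁ w₂ : ℂ[X]) (p : ℂ[X]) :
    combination (fun n => sl2Mk (w₀ * X ^ n) (w₁ * X ^ n) (w₂ * X ^ n)) p
      = sl2Mk (w₀ * p) (w₁ * p) (w₂ * p) := by
  induction p using Polynomial.induction_on' with
  | add p q hp hq => rw [map_add, hp, hq, sl2Mk_add, mul_add, mul_add, mul_add]
  | monomial n r =>
    rw [combination_monomial, smul_sl2Mk, ← C_mul_X_pow_eq_monomial]
    congr 1 <;> ring

end Combination

section Isomorphism

open Polynomial

variable (a : Point)

theorem map_decomposition {L L' : Type} [LieRing L] [LieAlgebra ℂ L] [LieRing L']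
    [LieAlgebra ℂ L'] (φ : L →ₗ⁅ℂ⁆ L') (y₁ y₂ y₃ z₁ z₂ z₃ : L) (r₁ r₂ r₃ : ℂ) :
    φ (y₁ + y₂ + y₃ + (r₁ • z₁ + r₂ • z₂ + r₃ • z₃))
      = φ y₁ + φ y₂ + φ y₃ + (r₁ • φ z₁ + r₂ • φ z₂ + r₃ • φ z₃) := by
  simp only [map_add, map_smul]

theorem combination_eq_zero {L : Type} [LieRing L] [LieAlgebra ℂ L] {w : ℕ → L}
    (h : ∀ n, w n = 0) (p : ℂ[X]) : combination w p = 0 := by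
  induction p using Polynomial.induction_on' with
  | add p q hp hq => rw [map_add, hp, hq, add_zero]
  | monomial n r => rw [combination_monomial, h, smul_zero]

theorem map_combination_of_isLieAbelian {L L' : Type} [LieRing L] [LieAlgebra ℂ L] [LieRing L']
    [LieAlgebra ℂ L'] [IsLieAbelian L'] (χ : L →ₗ⁅ℂ⁆ L') {e h f e₁ h₁ : L}
    (hd : IsCurrentData e h f e₁ h₁) (p q s : ℂ[X]) :
    χ (combination (currentH e f h₁) p) = 0 ∧ χ (combination (currentE e h₁) q) = 0 ∧
      χ (combination (currentF e f h₁) s) = 0 := by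
  refine ⟨?_, ?_, ?_⟩ <;> rw [map_combination] <;> refine combination_eq_zero (fun n => ?_) _
  · rw [currentH, LieHom.map_lie, trivial_lie_zero]
  -- Every E_n is the bracket [E_n, H_0], so a homomorphism to an abelian algebra kills it.
  · rw [← add_zero n, ← (hd.lie_table n 0).2.1, LieHom.map_lie, trivial_lie_zero]
  · rw [currentF, LieHom.map_lie, trivial_lie_zero]

/-- The element of `𝔽^0` with given coordinates. -/
noncomputable def element (p q s : ℂ[X]) (r₀ r₁ r₂ : ℂ) : FAlg kdv 3 0 a :=
  combination (currentH (genE a) (genF a) (genH₁ a)) p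
    + combination (currentE (genE a) (genH₁ a)) q
    + combination (currentF (genE a) (genF a) (genH₁ a)) s
    + (r₀ • ev (centralPart (genA kdv 3 0 a)) + r₁ • ev (quadCoeff (genA kdv 3 0 a))
      + r₂ • ev (pd t (quadCoeff (genA kdv 3 0 a))))

theorem exists_eq_element (y : FAlg kdv 3 0 a) :
    ∃ p q s r₀ r₁ r₂, y = element a p q s r₀ r₁ r₂ := by
  obtain ⟨p, q, s, z, hz, rfl⟩ := exists_combination (mem_currentSpan_sup_centralSpan a y)
  obtain ⟨r₀, r₁, r₂, rfl⟩ := Submodule.mem_span_triple.1 hz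
  exact ⟨p, q, s, r₀, r₁, r₂, rfl⟩

/-- The map to sl_2 kills the central generators and the map to the abelian algebra kills the
currents, so together they are diagonal in the spanning family. This shows its linear independence.
-/
theorem exists_coordinates : ∃ (φ : FAlg kdv 3 0 a →ₗ⁅ℂ⁆ Sl2Poly)
    (χ : FAlg kdv 3 0 a →ₗ⁅ℂ⁆ Abelian3), ∀ p q s r₀ r₁ r₂,
      φ (element a p q s r₀ r₁ r₂) = sl2Mk (-C (1 / 2) * p) q (-C (1 / 2) * s) ∧
      χ (element a p q s r₀ r₁ r₂) = (r₀ * (2 / 3)) • Abelian3.basis 0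
        + (r₁ * 3) • Abelian3.basis 1 + (r₂ * 3) • Abelian3.basis 2 := by
  obtain ⟨φ, φE, φF, φH, φW, φQ, φQ'⟩ := exists_hom_sl2 a
  obtain ⟨χ, χW, χQ, χQ'⟩ := exists_hom_abelian a (Abelian3.basis 0) (Abelian3.basis 1)
    (Abelian3.basis 2)
  refine ⟨φ, χ, fun p q s r₀ r₁ r₂ => ⟨?_, ?_⟩⟩
  · have hH := combination_sl2Mk (-C (1 / 2)) 0 0 p
    have hE := combination_sl2Mk 0 1 0 q
    have hF := combination_sl2Mk 0 0 (-C (1 / 2)) s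
    simp only [zero_mul, one_mul] at hH hE hF
    rw [element, map_decomposition, map_combination, map_combination, map_combination, φW, φQ, φQ']
    simp only [map_currentE, map_currentH, map_currentF, φE, φF, φH, currentE_sl2, currentH_sl2,
      currentF_sl2, hE, hF, hH, smul_zero, add_zero, sl2Mk_add, zero_add]
  · obtain ⟨hH, hE, hF⟩ := map_combination_of_isLieAbelian χ (isCurrentData_gen a) p q s
    rw [element, map_decomposition, hH, hE, hF, χW, χQ, χQ']
    module

/-- `𝔽^0` is isomorphic to the direct sum of `sl_2(ℂ[λ])` and a three-dimensional abelian Lie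
algebra. -/
theorem exists_equiv : Nonempty (FAlg kdv 3 0 a ≃ₗ⁅ℂ⁆ Sl2Poly × Abelian3) := by
  obtain ⟨φ, χ, h⟩ := exists_coordinates a
  have h2 : (C (1 / 2) : ℂ[X]) * 2 = 1 := by rw [← C_ofNat, ← C_mul]; norm_num
  have hne : (-C (1 / 2) : ℂ[X]) ≠ 0 := by simp
  refine ⟨LieEquiv.ofBijective (φ.prod χ) ⟨?_, ?_⟩⟩
  · refine (injective_iff_map_eq_zero _).2 fun y hy => ?_
    obtain ⟨p, q, s, r₀, r₁, r₂, rfl⟩ := exists_eq_element a y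
    have hφ : φ (element a p q s r₀ r₁ r₂) = 0 := congrArg Prod.fst hy
    have hχ : χ (element a p q s r₀ r₁ r₂) = 0 := congrArg Prod.snd hy
    rw [(h p q s r₀ r₁ r₂).1] at hφ
    rw [(h p q s r₀ r₁ r₂).2] at hχ
    obtain ⟨hp, rfl, hs⟩ := sl2Mk_eq_zero hφ
    obtain ⟨h₀, h₁, h₂⟩ := Abelian3.eq_zero_of_sum hχ
    obtain rfl := (mul_eq_zero.1 hp).resolve_left hne
    obtain rfl := (mul_eq_zero.1 hs).resolve_left hne
    obtain rfl : r₀ = 0 := (mul_eq_zero.1 h₀).resolve_right (by norm_num)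
    obtain rfl : r₁ = 0 := (mul_eq_zero.1 h₁).resolve_right (by norm_num)
    obtain rfl : r₂ = 0 := (mul_eq_zero.1 h₂).resolve_right (by norm_num)
    simp [element]
  · rintro ⟨y, c⟩
    obtain ⟨p, q, s, rfl⟩ := sl2Mk_surjective y
    obtain ⟨r₀, r₁, r₂, rfl⟩ := Abelian3.eq_sum c
    -- These factors invert the diagonal entries -1/2, 1, -1/2, 2/3, 3, 3 of the two coordinate
    -- maps.
    refine ⟨element a (-2 * p) q (-2 * s) (r₀ * (3 / 2)) (r₁ / 3) (r₂ / 3), Prod.ext ?_ ?_⟩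
    · refine (h _ _ _ _ _ _).1.trans ?_
      congr 1
      · linear_combination p * h2
      · linear_combination s * h2
    · refine (h _ _ _ _ _ _).2.trans ?_
      congr 1
      · congr 1
        · congr 1; ring
        · congr 1; ring
      · congr 1; ring

end Isomorphism

end JetCoord

theorem mainTheorem4 (a : JetCoord.Point) :
    (∃ (C : Type) (_ : LieRing C) (_ : LieAlgebra ℂ C),
      IsLieAbelian C ∧ Module.finrank ℂ C = 3 ∧
        Nonempty (JetCoord.FAlg JetCoord.kdv 3 0 a ≃ₗ⁅ℂ⁆ JetCoord.Sl2Poly × C)) ∧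
    ∀ p : ℕ, 0 < p →
      Function.Surjective (JetCoord.toZero JetCoord.kdv 3 a p) ∧
        LieRing.IsNilpotent (JetCoord.toZero JetCoord.kdv 3 a p).ker :=
  ⟨⟨JetCoord.Abelian3, inferInstance, inferInstance, inferInstance,
    JetCoord.Abelian3.finrank_eq, JetCoord.exists_equiv a⟩,
    fun p _ => ⟨JetCoord.toZero_surjective _ _ _ _, JetCoord.isNilpotent_ker_toZero a p⟩⟩
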